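/- **Theorem.** Let $\mathbf E$ be a $\Pi W$-pretopos, that is, an exact category with finite disjoint stable sums which is locally cartesian closed and in which, for every map $f\colon B\to A$, the polynomial functor $P_f(X)=\sum_{a\in A}X^{B_a}$ has an initial algebra. Let $\mathbf C$ be an internal category in $\mathbf E$, with object of objects $C_0$ and object of arrows $C_1$. A *site* on $\mathbf C$ is a commutative square consisting of $m\colon \underline{\mathrm{Cov}}\to C_1$, $\mathrm{cod}\colon C_1\to C_0$, $\phi\colon\underline{\mathrm{Cov}}\to\mathrm{Cov}$ and a map $\mathrm{Cov}\to C_0$; an element $U\in\mathrm{Cov}$ over $C\in C_0$ is thought of as the covering family $(m(i)\colon C_i\to C\mid i\in\underline{\mathrm{Cov}}_U)$. It is required that the following holds in the internal logic of $\mathbf E$: * (C) for every covering family $(\alpha_i\colon C_i\to C\mid i\in I)$ and every arrow $f\colon D\to C$ there is a covering family $(\beta_j\colon D_j\to D\mid j\in J)$ such that every $f\beta_j$ factors through some $\alpha_i$. A *Grothendieck site* is a site for which moreover, in the internal logic, * (M) every object $C$ has a covering family containing $1_C$; * (L) for every covering family $(\alpha_i\colon C_i\to C\mid i\in I)$ and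 every assignment to each $i\in I$ of a covering family $(\beta_{ij}\colon C_{ij}\to C_i\mid j\in I_i)$ there is a covering family $(\gamma_l\colon D_l\to C\mid l\in L)$ such that every $\gamma_l$ factors through some $\alpha_i\beta_{ij}$. A site is *strong* if the family in (C) is given by a map of $\mathbf E$ as a function of $f$ and $(\alpha_i)_i$. A Grothendieck site is *strong* if the family in (C) and the family in (L) are both given by maps of $\mathbf E$ as functions of the respective initial data. A site is a *collection site* if $(\phi,m)$ is a collection span over $C_0$: in the internal logic, for every $U\in\mathrm{Cov}$ over $C\in C_0$ and every cover $F\twoheadrightarrow\underline{\mathrm{Cov}}_U$ there are $U'\in\mathrm{Cov}$ over the same $C$ and a cover $\underline{\mathrm{Cov}}_{U'}\twoheadrightarrow\underline{\mathrm{Cov}}_U$ which commutes with the maps $m$ to $C_1$ and factors through $F$. (Here the clause about arbitrary $F$ is understood by Kripke–Joyal forcing, for $F$ at an arbitrary stage.) Two sites on $\mathbf C$ are *equivalent* if they have the same sheaves: an internal presheaf $P$ on $\mathbf C$ satisfies the (internal) sheaf condition for all covering families of the one site if and only if it does so for all covering families of the other. Then: 1. for every strong site on $\mathbf C$ there is an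 equivalent strong Grothendieck site on $\mathbf C$; 2. for every collection site on $\mathbf C$ there is an equivalent Grothendieck site on $\mathbf C$ that is also a collection site. -/

import Mathlib

open CategoryTheory CategoryTheory.Limits

universe v u

noncomputable section

/-! ### Pi-pretoposes and PiW-pretoposes -/

/-- A `Π`-pretopos: a category which is exact (regular, and every internal equivalence relation
has a quotient for which the evident square is both a pullback and a coequalizer), has finite
disjoint and stable sums, and is locally cartesian closed.  Stability of quotients under pullback
is part of `Regular`. -/
class PiPretopos (E : Type u) [Category.{v} E] : Prop extends Regular E, FinitaryExtensive E where
  exists_quotient : ∀ {R X : E} (r s : R ⟶ X), IsEquivalenceRelation r s →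
    ∃ (Q : E) (q : X ⟶ Q) (w : r ≫ q = s ≫ q),
      IsKernelPair q r s ∧ Nonempty (IsColimit (Cofork.ofπ q w))
  locally_cartesian_closed : ∀ {B A : E} (f : B ⟶ A), (Over.pullback f).IsLeftAdjoint

/-- The dependent product functor `Π_f : E/B ⥤ E/A`, right adjoint to pullback along `f`. -/
def depProd {E : Type u} [Category.{v} E] [PiPretopos E] {B A : E} (f : B ⟶ A) :
    Over B ⥤ Over A :=
  haveI := PiPretopos.locally_cartesian_closed f
  (Over.pullback f).rightAdjoint

/-- The adjunction between pullback along `f` and `Π_f`. -/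
def depProdAdj {E : Type u} [Category.{v} E] [PiPretopos E] {B A : E} (f : B ⟶ A) :
    Over.pullback f ⊣ depProd f :=
  haveI := PiPretopos.locally_cartesian_closed f
  Adjunction.ofIsLeftAdjoint (Over.pullback f)

/-- The polynomial functor `P_f(X) = Σ_{a ∈ A} X^{B_a}` of a map `f : B ⟶ A`. -/
def polyFunctor {E : Type u} [Category.{v} E] [PiPretopos E] {B A : E} (f : B ⟶ A) : E ⥤ E :=
  Over.star B ⋙ depProd f ⋙ Over.forget A

/-- A `ΠW`-pretopos: a `Π`-pretopos in which every map `f` has a W-type, i.e. the polynomial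
functor `P_f` has an initial algebra. -/
class PiWPretopos (E : Type u) [Category.{v} E] : Prop extends PiPretopos E where
  exists_wType : ∀ {B A : E} (f : B ⟶ A), HasInitial (Endofunctor.Algebra (polyFunctor f))

/-! ### Internal categories and internal presheaves -/

/-- An internal category: `comp` sends a pair `(g, f)` with `dom g = cod f` to `g ∘ f`. -/
structure InternalCategory (E : Type u) [Category.{v} E] [HasPullbacks E] where
  C₀ : E
  C₁ : E
  dom : C₁ ⟶ C₀
  cod : C₁ ⟶ C₀
  id : C₀ ⟶ C₁
  comp : pullback dom cod ⟶ C₁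
  id_dom : id ≫ dom = 𝟙 C₀
  id_cod : id ≫ cod = 𝟙 C₀
  comp_dom : comp ≫ dom = pullback.snd dom cod ≫ dom
  comp_cod : comp ≫ cod = pullback.fst dom cod ≫ cod
  /-- `f ∘ 1 = f` -/
  comp_id : ∀ {T : E} (f : T ⟶ C₁) (h : f ≫ dom = (f ≫ dom ≫ id) ≫ cod),
    pullback.lift f (f ≫ dom ≫ id) h ≫ comp = f
  /-- `1 ∘ f = f` -/
  id_comp : ∀ {T : E} (f : T ⟶ C₁) (h : (f ≫ cod ≫ id) ≫ dom = f ≫ cod),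
    pullback.lift (f ≫ cod ≫ id) f h ≫ comp = f
  /-- `(h ∘ g) ∘ f = h ∘ (g ∘ f)` -/
  assoc : ∀ {T : E} (h g f : T ⟶ C₁) (hg : h ≫ dom = g ≫ cod) (gf : g ≫ dom = f ≫ cod)
    (hg_f : (pullback.lift h g hg ≫ comp) ≫ dom = f ≫ cod)
    (h_gf : h ≫ dom = (pullback.lift g f gf ≫ comp) ≫ cod),
    pullback.lift (pullback.lift h g hg ≫ comp) f hg_f ≫ comp =
      pullback.lift h (pullback.lift g f gf ≫ comp) h_gf ≫ comp

namespace InternalCategory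

variable {E : Type u} [Category.{v} E] [HasPullbacks E]

/-- For generalized arrows `g`, `f`, `k` of `C` at stage `T`: `g` and `f` are composable
and `g ∘ f = k`. -/
def IsComp (C : InternalCategory E) {T : E} (g f k : T ⟶ C.C₁) : Prop :=
  ∃ h : g ≫ C.dom = f ≫ C.cod, pullback.lift g f h ≫ C.comp = k

end InternalCategory

/-- An internal presheaf on `C`: an object `P` over `C₀` with an action sending a pair `(x, α)`,
where `x ∈ P(cod α)`, to `x · α ∈ P(dom α)`. -/
structure InternalPresheaf {E : Type u} [Category.{v} E] [HasPullbacks E]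
    (C : InternalCategory E) where
  P : E
  toObj : P ⟶ C.C₀
  act : pullback toObj C.cod ⟶ P
  act_toObj : act ≫ toObj = pullback.snd toObj C.cod ≫ C.dom
  /-- `x · 1 = x` -/
  act_id : ∀ {T : E} (x : T ⟶ P) (h : x ≫ toObj = (x ≫ toObj ≫ C.id) ≫ C.cod),
    pullback.lift x (x ≫ toObj ≫ C.id) h ≫ act = x
  /-- `(x · g) · f = x · (g ∘ f)` -/
  act_comp : ∀ {T : E} (x : T ⟶ P) (g f : T ⟶ C.C₁) (xg : x ≫ toObj = g ≫ C.cod)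
    (gf : g ≫ C.dom = f ≫ C.cod)
    (xg_f : (pullback.lift x g xg ≫ act) ≫ toObj = f ≫ C.cod)
    (x_gf : x ≫ toObj = (pullback.lift g f gf ≫ C.comp) ≫ C.cod),
    pullback.lift (pullback.lift x g xg ≫ act) f xg_f ≫ act =
      pullback.lift x (pullback.lift g f gf ≫ C.comp) x_gf ≫ act

namespace InternalPresheaf

variable {E : Type u} [Category.{v} E] [HasPullbacks E] {C : InternalCategory E}

/-- For generalized elements at stage `T`: `x · a` is defined and equal to `y`. -/
def IsAct (P : InternalPresheaf C) {T : E} (x : T ⟶ P.P) (a : T ⟶ C.C₁) (y : T ⟶ P.P) : Prop :=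
  ∃ h : x ≫ P.toObj = a ≫ C.cod, pullback.lift x a h ≫ P.act = y

end InternalPresheaf

/-! ### Internal sites

Conditions stated in the internal logic are unfolded by the usual forcing clauses: universally
quantified variables are generalized elements, at an arbitrary later stage, and an existential
quantifier is witnessed after passing to a cover (regular epimorphism) of the stage.  In a pretopos
the regular epimorphisms, the epimorphisms and the covers are the same maps. -/

/-- A commutative square `Idx ⟶ C₁ ⟶ C₀`, `Idx ⟶ Cov ⟶ C₀`: over each `U ∈ Cov` lying over
`c ∈ C₀` there is an index object `Idx_U`, indexing a family `m(i)`, `i ∈ Idx_U`, of arrows with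
codomain `c`. -/
structure CoveringFamilies {E : Type u} [Category.{v} E] [HasPullbacks E]
    (C : InternalCategory E) where
  Cov : E
  Idx : E
  toObj : Cov ⟶ C.C₀
  φ : Idx ⟶ Cov
  m : Idx ⟶ C.C₁
  comm : m ≫ C.cod = φ ≫ toObj

namespace CoveringFamilies

section

variable {E : Type u} [Category.{v} E] [HasPullbacks E] {C : InternalCategory E}

/-- The arrow `a` factors through some member of the covering family `U`:
there are `i ∈ Idx_U` and `g` with `a = m(i) ∘ g`. -/
def FactorsThrough (J : CoveringFamilies C) {S : E} (a : S ⟶ C.C₁) (U : S ⟶ J.Cov) : Prop :=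
  ∃ (S' : E) (q : S' ⟶ S) (i : S' ⟶ J.Idx) (g : S' ⟶ C.C₁), IsRegularEpi q ∧
    i ≫ J.φ = q ≫ U ∧ C.IsComp (i ≫ J.m) g (q ≫ a)

/-- `V` is a covering family of `dom f`, and for every `j ∈ Idx_V` the composite `f ∘ m(j)` factors
through some member of `U`. -/
def IsPullbackFamily (J : CoveringFamilies C) {T : E} (V : T ⟶ J.Cov) (f : T ⟶ C.C₁)
    (U : T ⟶ J.Cov) : Prop :=
  V ≫ J.toObj = f ≫ C.dom ∧
    ∀ (S : E) (s : S ⟶ T) (j : S ⟶ J.Idx) (k : S ⟶ C.C₁),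
      j ≫ J.φ = s ≫ V → C.IsComp (s ≫ f) (j ≫ J.m) k → J.FactorsThrough k (s ≫ U)

/-- Let `U` be a covering family at stage `T` and let `t` assign to each `i ∈ Idx_U` a covering
family `t(i)`.  The arrow `a` (at stage `S`, over `s : S ⟶ T`) factors through some composite
`m(i) ∘ m(j)` with `i ∈ Idx_U` and `j ∈ Idx_{t(i)}`. -/
def FactorsThroughComposite (J : CoveringFamilies C) {S T : E} (a : S ⟶ C.C₁) (s : S ⟶ T)
    (U : T ⟶ J.Cov) (t : pullback U J.φ ⟶ J.Cov) : Prop :=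
  ∃ (S' : E) (q : S' ⟶ S) (i j : S' ⟶ J.Idx) (g b : S' ⟶ C.C₁)
    (h : (q ≫ s) ≫ U = i ≫ J.φ), IsRegularEpi q ∧
      j ≫ J.φ = pullback.lift (q ≫ s) i h ≫ t ∧
      C.IsComp (i ≫ J.m) (j ≫ J.m) b ∧ C.IsComp b g (q ≫ a)

/-- `V` (at stage `T'`, over `p : T' ⟶ T`) is a covering family of the object covered by `U`, and
each of its members factors through some `m(i) ∘ m(j)` with `i ∈ Idx_U` and `j ∈ Idx_{t(i)}`. -/
def IsCompositeFamily (J : CoveringFamilies C) {T' T : E} (p : T' ⟶ T) (V : T' ⟶ J.Cov)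
    (U : T ⟶ J.Cov) (t : pullback U J.φ ⟶ J.Cov) : Prop :=
  V ≫ J.toObj = p ≫ U ≫ J.toObj ∧
    ∀ (S : E) (s : S ⟶ T') (l : S ⟶ J.Idx), l ≫ J.φ = s ≫ V →
      J.FactorsThroughComposite (l ≫ J.m) (s ≫ p) U t

/-- Condition (C): every covering family `U` of `cod f` has a pullback family along `f`. -/
def ConditionC (J : CoveringFamilies C) : Prop :=
  ∀ (T : E) (f : T ⟶ C.C₁) (U : T ⟶ J.Cov), f ≫ C.cod = U ≫ J.toObj →
    ∃ (T' : E) (p : T' ⟶ T) (V : T' ⟶ J.Cov), IsRegularEpi p ∧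
      J.IsPullbackFamily V (p ≫ f) (p ≫ U)

/-- Condition (C) in the strong form: the pullback family is given by a map
`C₁ ×_{C₀} Cov ⟶ Cov`, i.e. as a function of `f` and `U`. -/
def StrongConditionC (J : CoveringFamilies C) : Prop :=
  ∃ σ : pullback C.cod J.toObj ⟶ J.Cov,
    J.IsPullbackFamily σ (pullback.fst C.cod J.toObj) (pullback.snd C.cod J.toObj)

/-- Condition (M): every object `x` has a covering family containing the identity of `x`. -/
def ConditionM (J : CoveringFamilies C) : Prop :=
  ∀ (T : E) (x : T ⟶ C.C₀),
    ∃ (T' : E) (p : T' ⟶ T) (U : T' ⟶ J.Cov) (i : T' ⟶ J.Idx), IsRegularEpi p ∧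
      U ≫ J.toObj = p ≫ x ∧ i ≫ J.φ = U ∧ i ≫ J.m = p ≫ x ≫ C.id

/-- Condition (L): given a covering family `U` and a covering family `t(i)` of `dom m(i)` for every
`i ∈ Idx_U`, there is a covering family each of whose members factors through some
`m(i) ∘ m(j)` with `i ∈ Idx_U` and `j ∈ Idx_{t(i)}`. -/
def ConditionL (J : CoveringFamilies C) : Prop :=
  ∀ (T : E) (U : T ⟶ J.Cov) (t : pullback U J.φ ⟶ J.Cov),
    t ≫ J.toObj = pullback.snd U J.φ ≫ J.m ≫ C.dom →
    ∃ (T' : E) (p : T' ⟶ T) (V : T' ⟶ J.Cov), IsRegularEpi p ∧ J.IsCompositeFamily p V U t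

end

section

variable {E : Type u} [Category.{v} E] [PiPretopos E] {C : InternalCategory E}

/-- The object over `Cov` of initial data for condition (L):
`Σ_{U ∈ Cov} Π_{i ∈ Idx_U} Cov(dom m(i))`. -/
def compositeData (J : CoveringFamilies C) : Over J.Cov :=
  (depProd J.φ).obj (Over.mk (pullback.snd J.toObj (J.m ≫ C.dom)))

/-- The generic assignment `i ↦ t(i)`, over the generic element `(U, t)` of `compositeData`. -/
def genericAssignment (J : CoveringFamilies C) : pullback J.compositeData.hom J.φ ⟶ J.Cov :=
  ((depProdAdj J.φ).counit.app (Over.mk (pullback.snd J.toObj (J.m ≫ C.dom)))).left ≫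
    pullback.fst J.toObj (J.m ≫ C.dom)

/-- Condition (L) in the strong form: the composite family is given by a map from the object of
initial data to `Cov`. -/
def StrongConditionL (J : CoveringFamilies C) : Prop :=
  ∃ V : J.compositeData.left ⟶ J.Cov,
    J.IsCompositeFamily (𝟙 _) V J.compositeData.hom J.genericAssignment

end

end CoveringFamilies

/-- `g : D ⟶ C'`, `h : D ⟶ B` is a collection span over `A` (where `a : C' ⟶ A`): for every cover
`e : F ↠ D_c` of a fibre of `g` there is another fibre `D_{c'}` of `g`, over the same element of
`A`, and a cover `D_{c'} ↠ D_c` over `B` which factors as `e ∘ r`. -/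
def IsCollectionSpan {E : Type u} [Category.{v} E] [HasPullbacks E] {A B C' D : E}
    (g : D ⟶ C') (h : D ⟶ B) (a : C' ⟶ A) : Prop :=
  ∀ (T : E) (c : T ⟶ C') (F : E) (e : F ⟶ pullback c g), IsRegularEpi e →
    ∃ (T' : E) (t : T' ⟶ T) (c' : T' ⟶ C') (r : pullback c' g ⟶ F)
      (w : pullback.fst c' g ≫ t = (r ≫ e) ≫ pullback.fst c g),
      IsRegularEpi t ∧ c' ≫ a = t ≫ c ≫ a ∧
      (r ≫ e) ≫ pullback.snd c g ≫ h = pullback.snd c' g ≫ h ∧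
      IsRegularEpi (pullback.lift (pullback.fst c' g) (r ≫ e) w)

/-- An internal site with underlying category `C`. -/
structure InternalSite {E : Type u} [Category.{v} E] [HasPullbacks E]
    (C : InternalCategory E) extends CoveringFamilies C where
  conditionC : toCoveringFamilies.ConditionC

namespace InternalSite

section

variable {E : Type u} [Category.{v} E] [HasPullbacks E] {C : InternalCategory E}

/-- A strong site. -/
def IsStrong (J : InternalSite C) : Prop := J.StrongConditionC

/-- A Grothendieck site. -/
def IsGrothendieck (J : InternalSite C) : Prop := J.ConditionM ∧ J.ConditionL

/-- A collection site. -/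
def IsCollection (J : InternalSite C) : Prop := IsCollectionSpan J.φ J.m J.toObj

/-- Let `U` be a covering family at stage `T` and let `x` assign to each `i ∈ Idx_U` an element
`x_i` of `P`.  The family is compatible: `x_i ∈ P(dom m(i))`, and `x_i · g = x_{i'} · g'`
whenever `m(i) ∘ g = m(i') ∘ g'`. -/
def IsCompatible (J : InternalSite C) (P : InternalPresheaf C) {T : E} (U : T ⟶ J.Cov)
    (x : pullback U J.φ ⟶ P.P) : Prop :=
  x ≫ P.toObj = pullback.snd U J.φ ≫ J.m ≫ C.dom ∧
    ∀ (S : E) (i i' : S ⟶ pullback U J.φ) (g g' k : S ⟶ C.C₁),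
      i ≫ pullback.fst U J.φ = i' ≫ pullback.fst U J.φ →
      C.IsComp (i ≫ pullback.snd U J.φ ≫ J.m) g k →
      C.IsComp (i' ≫ pullback.snd U J.φ ≫ J.m) g' k →
      ∃ z : S ⟶ P.P, P.IsAct (i ≫ x) g z ∧ P.IsAct (i' ≫ x) g' z

/-- `P` is a sheaf: every compatible family has a unique amalgamation, i.e. a unique
`y ∈ P(C)` with `y · m(i) = x_i` for all `i ∈ Idx_U`.  (Being unique, the amalgamation exists
at the given stage and not merely on a cover of it.) -/
def IsSheaf (J : InternalSite C) (P : InternalPresheaf C) : Prop :=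
  ∀ (T : E) (U : T ⟶ J.Cov) (x : pullback U J.φ ⟶ P.P), J.IsCompatible P U x →
    ∃! y : T ⟶ P.P, y ≫ P.toObj = U ≫ J.toObj ∧
      P.IsAct (pullback.fst U J.φ ≫ y) (pullback.snd U J.φ ≫ J.m) x

/-- Two sites on the same underlying category are equivalent: they have the same sheaves. -/
def Equivalent (J K : InternalSite C) : Prop :=
  ∀ P : InternalPresheaf C, J.IsSheaf P ↔ K.IsSheaf P

end

/-- A strong Grothendieck site: a Grothendieck site in which (C) and (L) hold in the strong
form. -/
def IsStrongGrothendieck {E : Type u} [Category.{v} E] [PiPretopos E] {C : InternalCategory E}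
    (J : InternalSite C) : Prop :=
  J.IsGrothendieck ∧ J.StrongConditionC ∧ J.StrongConditionL

end InternalSite

end

/-!
The Grothendieck site is the site of well-founded trees built from the covering families of the
given one.  A tree over an object `x` is either a bare leaf, or a covering family `U` of `x`
together with a tree over `dom m(i)` for every index `i` of `U`.  Each tree is regarded as a
covering family: it is indexed by its leaves, and its member at a leaf is the composite of the
arrows on the path from the root to the leaf.  Condition (M) holds because of bare leaves, and
condition (L) because trees can be grafted onto the leaves of a tree.

*Construction of trees.*  The trees and their leaves are dependent W-types, that is, W-types with a
typing condition on the labels of the children of a node.  Those whose typing condition holds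
hereditarily have to be cut out of a W-type without an object of truth values to define a predicate
by recursion; `exists_hereditary` obtains them as an equalizer of two maps to a second W-type. The
result, `nonempty_trees`, is a structure `Trees J` of trees with a principle of dependent
elimination, on which everything else rests.

*The internal logic.*  A predicate on generalized elements of an object is `Definable` if it is
represented by a subobject.  Definable predicates are closed under conjunction, implication and
quantification over an object, with the forcing clauses used in the statement of the conditions.
Dependent elimination along the subobject representing a predicate is a proof by induction; when the
predicate carries a witness as one of its variables, it is a definition by recursion.

*Strong sites.*  Grafting is a recursion, so it is given by a map (`Trees.strongConditionL`).  The
pullback of a tree along `f` is also obtained by recursion: pull the covering family `U` at the root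
back along `f`, choose for each index `j` of the pullback an index `i` of `U` such that `f ∘ m(j)`
factors as `m(i) ∘ g`, and pull the subtree at `i` back along `g`.  This choice is not given by a
map.  Therefore the covering families are first replaced by the sieves they generate: in a sieve the
arrow `f ∘ m(j)` is itself an index, with `g` an identity (`Trees.strongConditionC`).  Passing to
sieves changes neither the strength of (C) nor the sheaves (`equivalent_sieveFamilies`).

*Collection sites.*  Here the same induction shows that every tree has some pullback along `f`; the
collection axiom at the root chooses the pullbacks of the subtrees as a function of an index of a
refining covering family (`Trees.conditionC`).  Similarly, a cover of the object of leaves of a tree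
is refined by induction on the tree, one node at a time (`Trees.exists_isRefinement`), which shows
that trees form a collection site (`Trees.isCollectionSpan`).

*Sheaves.*  A sheaf for trees is a sheaf for the given site, because a covering family is a tree of
height one.  Conversely, in a sheaf for the given site, a compatible family on the leaves of a tree
is amalgamated by recursion on the tree (`Trees.equivalent`).
-/

noncomputable section

namespace PredicativeSite

attribute [local simp] pullback.lift_fst pullback.lift_snd pullback.lift_fst_assoc
  pullback.lift_snd_assoc prod.lift_fst prod.lift_snd prod.lift_fst_assoc prod.lift_snd_assoc
  coprod.inl_desc coprod.inr_desc coprod.inl_desc_assoc coprod.inr_desc_assoc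

/-! ### Regular epimorphisms and extensive coproducts -/

section RegularEpi

variable {E : Type u} [Category.{v} E]

lemma isRegularEpi_id (X : E) : IsRegularEpi (𝟙 X) := inferInstance

/-- Factoring through a monomorphism is a local property. -/
lemma exists_lift_of_cover {S T X Y : E} {q : S ⟶ T} (hq : IsRegularEpi q) (i : X ⟶ Y) [Mono i]
    {t : T ⟶ Y} {y : S ⟶ X} (h : y ≫ i = q ≫ t) : ∃ t' : T ⟶ X, t' ≫ i = t := by
  have sq : CommSq y q i t := ⟨h⟩
  exact ⟨sq.lift, sq.fac_right⟩

/-- Morphisms glue along regular epimorphisms. -/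
lemma exists_desc_of_cover {S T Z : E} {q : S ⟶ T} (hq : IsRegularEpi q) {y : S ⟶ Z}
    (h : ∀ (R : E) (a b : R ⟶ S), a ≫ q = b ≫ q → a ≫ y = b ≫ y) : ∃ z : T ⟶ Z, q ≫ z = y :=
  ⟨IsRegularEpi.desc q y (h _ _ _ (IsRegularEpi.w q)), IsRegularEpi.fac q y _⟩

variable [Regular E]

lemma isRegularEpi_comp {X Y Z : E} {f : X ⟶ Y} {g : Y ⟶ Z} (hf : IsRegularEpi f)
    (hg : IsRegularEpi g) : IsRegularEpi (f ≫ g) := by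
  have : StrongEpi (f ≫ g) := strongEpi_comp f g
  infer_instance

lemma isRegularEpi_of_comp {X Y Z : E} {f : X ⟶ Y} {g : Y ⟶ Z} (h : IsRegularEpi (f ≫ g)) :
    IsRegularEpi g := by
  have : StrongEpi g := strongEpi_of_strongEpi f g
  infer_instance

lemma isRegularEpi_pullback_fst {X Y Z : E} (f : X ⟶ Z) {g : Y ⟶ Z} (h : IsRegularEpi g) :
    IsRegularEpi (pullback.fst f g) := inferInstance

end RegularEpi

section Extensive

variable {E : Type u} [Category.{v} E] [FinitaryExtensive E]

lemma isPullback_inl_inr (X Y : E) :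
    IsPullback (initial.to X) (initial.to Y) (coprod.inl : X ⟶ X ⨿ Y) coprod.inr :=
  FinitaryExtensive.isPullback_initial_to_binaryCofan (colimit.isColimit (pair X Y))

/-- A stage over which a generalized element lies in both summands of a coproduct is initial. -/
lemma nonempty_isInitial_of_inl_eq_inr {X Y T : E} {x : T ⟶ X} {y : T ⟶ Y}
    (h : x ≫ coprod.inl = y ≫ (coprod.inr : Y ⟶ X ⨿ Y)) : Nonempty (IsInitial T) := by
  have := initialIsInitial.isIso_to ((isPullback_inl_inr X Y).lift x y h)
  exact ⟨initialIsInitial.ofIso (asIso ((isPullback_inl_inr X Y).lift x y h)).symm⟩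

/-- Case distinction on a generalized element `x` of a coproduct: a morphism may be defined
separately over the two summands. -/
lemma exists_desc_of_coprod [HasPullbacks E] {L V T X : E} (x : T ⟶ L ⨿ V)
    (y0 : pullback x coprod.inl ⟶ X) (y1 : pullback x coprod.inr ⟶ X) :
    ∃ y : T ⟶ X, pullback.fst x coprod.inl ≫ y = y0 ∧ pullback.fst x coprod.inr ≫ y = y1 ∧
      ∀ y' : T ⟶ X, pullback.fst x coprod.inl ≫ y' = y0 → pullback.fst x coprod.inr ≫ y' = y1 →
        y' = y := by
  have hc : Nonempty (IsColimit (BinaryCofan.mk (pullback.fst x (coprod.inl : L ⟶ L ⨿ V))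
      (pullback.fst x (coprod.inr : V ⟶ L ⨿ V)))) := by
    refine (BinaryCofan.isVanKampen_iff _).1 (FinitaryExtensive.vanKampen _ (coprodIsCoprod L V))
      (BinaryCofan.mk _ _) (pullback.snd x coprod.inl) (pullback.snd x coprod.inr) x ?_ ?_ |>.2 ?_
    · exact (pullback.condition (f := x) (g := (coprod.inl : L ⟶ L ⨿ V))).symm
    · exact (pullback.condition (f := x) (g := (coprod.inr : V ⟶ L ⨿ V))).symm
    · exact ⟨IsPullback.of_hasPullback x coprod.inl, IsPullback.of_hasPullback x coprod.inr⟩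
  obtain ⟨hc⟩ := hc
  obtain ⟨y, hl, hr⟩ := BinaryCofan.IsColimit.desc' hc y0 y1
  exact ⟨y, hl, hr, fun y' hl' hr' => BinaryCofan.IsColimit.hom_ext hc
    (hl'.trans hl.symm) (hr'.trans hr.symm)⟩

/-- Existence of a lift along `q` may be proved by case distinction on a generalized element `x` of
a coproduct. -/
lemma exists_lift_of_coprod [HasPullbacks E] {L V T X D : E} (x : T ⟶ L ⨿ V) (q : X ⟶ D)
    (d : T ⟶ D)
    (h0 : ∀ (S : E) (s : S ⟶ T) (c : S ⟶ L), s ≫ x = c ≫ coprod.inl → ∃ y, y ≫ q = s ≫ d)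
    (h1 : ∀ (S : E) (s : S ⟶ T) (c : S ⟶ V), s ≫ x = c ≫ coprod.inr → ∃ y, y ≫ q = s ≫ d) :
    ∃ y, y ≫ q = d := by
  obtain ⟨y0, hy0⟩ := h0 _ _ _ (pullback.condition (f := x) (g := coprod.inl))
  obtain ⟨y1, hy1⟩ := h1 _ _ _ (pullback.condition (f := x) (g := coprod.inr))
  obtain ⟨y, hl, hr, -⟩ := exists_desc_of_coprod x y0 y1
  obtain ⟨z, -, -, hz⟩ := exists_desc_of_coprod x (pullback.fst x coprod.inl ≫ d)
    (pullback.fst x coprod.inr ≫ d)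
  refine ⟨y, (hz (y ≫ q) ?_ ?_).trans (hz d rfl rfl).symm⟩
  · rw [← Category.assoc, hl, hy0]
  · rw [← Category.assoc, hr, hy1]

end Extensive

/-! ### Families indexed by the fibres of a map -/

section PbMap

variable {E : Type u} [Category.{v} E] [HasPullbacks E]

/-- Reindexing of fibres along a change of stage `s : S ⟶ T`: a family over the fibres of `f` at
`a : T ⟶ A` is a map out of `pullback a f`, and its restriction along `s` is its composite with
`pbMap f s h`.  The restricted parameter `a'` is kept free, subject to an equation. -/
def pbMap {A B S T : E} {a : T ⟶ A} {a' : S ⟶ A} (f : B ⟶ A) (s : S ⟶ T) (h : s ≫ a = a') :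
    pullback a' f ⟶ pullback a f :=
  pullback.lift (pullback.fst a' f ≫ s) (pullback.snd a' f)
    (by rw [Category.assoc, h, pullback.condition])

variable {A B S T : E} {a : T ⟶ A} {a' : S ⟶ A} (f : B ⟶ A) (s : S ⟶ T) (h : s ≫ a = a')

@[simp]
lemma pbMap_fst : pbMap f s h ≫ pullback.fst a f = pullback.fst a' f ≫ s := by simp [pbMap]

@[simp]
lemma pbMap_fst_assoc {Z : E} (z : T ⟶ Z) :
    pbMap f s h ≫ pullback.fst a f ≫ z = pullback.fst a' f ≫ s ≫ z := by simp [pbMap]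

@[simp]
lemma pbMap_snd : pbMap f s h ≫ pullback.snd a f = pullback.snd a' f := by simp [pbMap]

@[simp]
lemma pbMap_snd_assoc {Z : E} (z : B ⟶ Z) :
    pbMap f s h ≫ pullback.snd a f ≫ z = pullback.snd a' f ≫ z := by simp [pbMap]

@[simp]
lemma lift_pbMap {R : E} (r : R ⟶ S) (b : R ⟶ B) (w : r ≫ a' = b ≫ f) :
    pullback.lift r b w ≫ pbMap f s h =
      pullback.lift (r ≫ s) b (by rw [Category.assoc, h, w]) := by
  apply pullback.hom_ext <;> simp

@[simp]
lemma lift_pbMap_assoc {R Z : E} (r : R ⟶ S) (b : R ⟶ B) (w : r ≫ a' = b ≫ f)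
    (z : pullback a f ⟶ Z) :
    pullback.lift r b w ≫ pbMap f s h ≫ z =
      pullback.lift (r ≫ s) b (by rw [Category.assoc, h, w]) ≫ z := by
  rw [← Category.assoc, lift_pbMap]

@[simp]
lemma pbMap_pbMap {R : E} (r : R ⟶ S) {a'' : R ⟶ A} (w : r ≫ a' = a'') :
    pbMap f r w ≫ pbMap f s h = pbMap f (r ≫ s) (by rw [Category.assoc, h, w]) := by
  apply pullback.hom_ext <;> simp

@[simp]
lemma pbMap_pbMap_assoc {R Z : E} (r : R ⟶ S) {a'' : R ⟶ A} (w : r ≫ a' = a'')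
    (z : pullback a f ⟶ Z) :
    pbMap f r w ≫ pbMap f s h ≫ z =
      pbMap f (r ≫ s) (by rw [Category.assoc, h, w]) ≫ z := by
  rw [← Category.assoc, pbMap_pbMap]

@[simp]
lemma pbMap_id (h : 𝟙 T ≫ a = a) : pbMap f (𝟙 T) h = 𝟙 _ := by
  apply pullback.hom_ext <;> simp

end PbMap

variable {E : Type u} [Category.{v} E] [PiPretopos E]

section Pi

variable {A B : E} (f : B ⟶ A) (X : Over B)

/-- Evaluation for the dependent product `Π_f X`. -/
def piEval : pullback ((depProd f).obj X).hom f ⟶ X.left :=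
  ((depProdAdj f).counit.app X).left

@[simp]
lemma piEval_hom : piEval f X ≫ X.hom = pullback.snd _ _ :=
  Over.w ((depProdAdj f).counit.app X)

variable {f X}

/-- Over `a`, elements of `Π_f X` are sections of `X` over the fibre of `f` at `a`; evaluation
recovers the section. -/
lemma exists_piCurry {T : E} (a : T ⟶ A) (t : pullback a f ⟶ X.left)
    (ht : t ≫ X.hom = pullback.snd a f) :
    ∃ (c : T ⟶ ((depProd f).obj X).left) (h : c ≫ ((depProd f).obj X).hom = a),
      pbMap f c h ≫ piEval f X = t := by
  let t' : (Over.pullback f).obj (Over.mk a) ⟶ X := Over.homMk t ht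
  let c := (depProdAdj f).homEquiv (Over.mk a) X t'
  refine ⟨c.left, Over.w c, ?_⟩
  have h := congrArg CommaMorphism.left
    (((depProdAdj f).homEquiv_counit (X := Over.mk a) (Y := X) (g := c)).symm)
  rw [show ((depProdAdj f).homEquiv (Over.mk a) X).symm c = t' by simp [c]] at h
  exact h

lemma piCurry_ext {T : E} {c c' : T ⟶ ((depProd f).obj X).left}
    (h : c' ≫ ((depProd f).obj X).hom = c ≫ ((depProd f).obj X).hom)
    (e : pbMap f c rfl ≫ piEval f X = pbMap f c' h ≫ piEval f X) : c = c' := by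
  let a := c ≫ ((depProd f).obj X).hom
  let k : Over.mk a ⟶ (depProd f).obj X := Over.homMk c rfl
  let k' : Over.mk a ⟶ (depProd f).obj X := Over.homMk c' h
  have : k = k' := by
    apply ((depProdAdj f).homEquiv (Over.mk a) X).symm.injective
    rw [(depProdAdj f).homEquiv_counit, (depProdAdj f).homEquiv_counit]
    ext
    exact e
  exact congrArg CommaMorphism.left this

end Pi

section Poly

variable {A B : E} (f : B ⟶ A) (X : E)

/-- The parameter `a` of an element `(a, t)` of `P_f(X)`. -/
def polyLabel : (polyFunctor f).obj X ⟶ A :=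
  ((depProd f).obj ((Over.star B).obj X)).hom

/-- The family `t : B_a → X` of an element `(a, t)` of `P_f(X)`. -/
def polyChild : pullback (polyLabel f X) f ⟶ X :=
  piEval f ((Over.star B).obj X) ≫ (prod.snd : B ⨯ X ⟶ X)

variable {f X}

lemma star_obj_hom_eq (B X : E) : ((Over.star B).obj X).hom = (prod.fst : B ⨯ X ⟶ B) :=
  (Over.star_obj_hom B X).trans (prod.lift_fst _ _)

/-- The element `c` of `P_f(X)` is the pair of `a` and `t`. -/
def IsPoly {T : E} (c : T ⟶ (polyFunctor f).obj X) (a : T ⟶ A) (t : pullback a f ⟶ X) : Prop :=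
  ∃ h : c ≫ polyLabel f X = a, pbMap f c h ≫ polyChild f X = t

lemma IsPoly.restrict {T : E} {c : T ⟶ (polyFunctor f).obj X} {a : T ⟶ A}
    {t : pullback a f ⟶ X} (h : IsPoly c a t) {S : E} (s : S ⟶ T) {a' : S ⟶ A}
    (hs : s ≫ a = a') : IsPoly (s ≫ c) a' (pbMap f s hs ≫ t) := by
  obtain ⟨h1, rfl⟩ := h
  exact ⟨by rw [Category.assoc, h1, hs], by simp⟩

lemma IsPoly.unique {T : E} {c : T ⟶ (polyFunctor f).obj X} {a : T ⟶ A}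
    {t t' : pullback a f ⟶ X} (h : IsPoly c a t) (h' : IsPoly c a t') : t = t' := by
  obtain ⟨_, rfl⟩ := h
  obtain ⟨_, rfl⟩ := h'
  rfl

lemma exists_poly {T : E} (a : T ⟶ A) (t : pullback a f ⟶ X) :
    ∃ c : T ⟶ (polyFunctor f).obj X, IsPoly c a t := by
  obtain ⟨c, h, e⟩ := exists_piCurry (f := f) (X := (Over.star B).obj X) a
    (prod.lift (pullback.snd a f) t)
    ((congrArg (prod.lift (pullback.snd a f) t ≫ ·) (star_obj_hom_eq B X)).trans
      (prod.lift_fst _ _))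
  exact ⟨c, h, (Category.assoc _ _ _).symm.trans
    ((congrArg (· ≫ (prod.snd : B ⨯ X ⟶ X)) e).trans (prod.lift_snd _ _))⟩

lemma poly_ext {T : E} {c c' : T ⟶ (polyFunctor f).obj X} {a : T ⟶ A} {t : pullback a f ⟶ X}
    (hc : IsPoly c a t) (hc' : IsPoly c' a t) : c = c' := by
  obtain ⟨rfl, rfl⟩ := hc
  obtain ⟨h, e⟩ := hc'
  replace e := e.symm
  have key : ∀ (d : T ⟶ (polyFunctor f).obj X) (h : d ≫ polyLabel f X = c ≫ polyLabel f X),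
      (pbMap f d h ≫ piEval f ((Over.star B).obj X)) ≫ (prod.fst : B ⨯ X ⟶ B) =
        pullback.snd (c ≫ polyLabel f X) f := fun d h =>
    (congrArg ((pbMap f d h ≫ piEval f ((Over.star B).obj X)) ≫ ·) (star_obj_hom_eq B X).symm).trans
      ((Category.assoc _ _ _).trans ((congrArg (pbMap f d h ≫ ·)
        (piEval_hom f ((Over.star B).obj X))).trans (pbMap_snd _ _ _)))
  exact piCurry_ext (f := f) (X := (Over.star B).obj X) h
    (Limits.prod.hom_ext ((key c rfl).trans (key c' h).symm)
      ((Category.assoc _ _ _).trans (e.trans (Category.assoc _ _ _).symm)))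

lemma polyMap_label {X Y : E} (g : X ⟶ Y) :
    (polyFunctor f).map g ≫ polyLabel f Y = polyLabel f X :=
  Over.w ((depProd f).map ((Over.star B).map g))

lemma polyMap_child {X Y : E} (g : X ⟶ Y) :
    pbMap f ((polyFunctor f).map g) (polyMap_label g) ≫ polyChild f Y = polyChild f X ≫ g := by
  have h : pbMap f ((polyFunctor f).map g) (polyMap_label g) ≫ piEval f ((Over.star B).obj Y) =
      piEval f ((Over.star B).obj X) ≫ ((Over.star B).map g).left :=
    congrArg CommaMorphism.left ((depProdAdj f).counit.naturality ((Over.star B).map g))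
  exact (Category.assoc _ _ _).symm.trans ((congrArg (· ≫ (prod.snd : B ⨯ Y ⟶ Y)) h).trans
    ((Category.assoc _ _ _).trans ((congrArg (piEval f ((Over.star B).obj X) ≫ ·)
      (prod.map_snd _ _)).trans (Category.assoc _ _ _).symm)))

end Poly

/-! ### Well-founded coalgebras and W-types -/

/-- A coalgebra for the polynomial functor `P_f`, in the form of a label map and, over each `d`,
a family of children indexed by the fibre of `f` at the label of `d`. -/
structure PolyCoalgebra {A B : E} (f : B ⟶ A) where
  D : E
  label : D ⟶ A
  child : pullback label f ⟶ D

namespace PolyCoalgebra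

variable {A B : E} {f : B ⟶ A}

/-- The element `d` has label `a` and family of children `t`. -/
def IsNode (c : PolyCoalgebra f) {T : E} (d : T ⟶ c.D) (a : T ⟶ A) (t : pullback a f ⟶ c.D) :
    Prop :=
  ∃ h : d ≫ c.label = a, pbMap f d h ≫ c.child = t

lemma IsNode.restrict {c : PolyCoalgebra f} {T : E} {d : T ⟶ c.D} {a : T ⟶ A}
    {t : pullback a f ⟶ c.D} (h : c.IsNode d a t) {S : E} (s : S ⟶ T) {a' : S ⟶ A}
    (hs : s ≫ a = a') : c.IsNode (s ≫ d) a' (pbMap f s hs ≫ t) := by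
  obtain ⟨h1, rfl⟩ := h
  exact ⟨by rw [Category.assoc, h1, hs], by simp⟩

lemma IsNode.unique {c : PolyCoalgebra f} {T : E} {d : T ⟶ c.D} {a : T ⟶ A}
    {t t' : pullback a f ⟶ c.D} (h : c.IsNode d a t) (h' : c.IsNode d a t') : t = t' := by
  obtain ⟨_, rfl⟩ := h
  obtain ⟨_, rfl⟩ := h'
  rfl

/-- A coalgebra is well-founded if it admits dependent elimination: a family `q : X ⟶ D` has a
section as soon as an element of `X` over `d` can be found from elements of `X` over all the
children of `d`.  The relation `Rel`, stable under change of stage, records how the value of the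
section at `d` depends on its values at the children of `d`. -/
def IsWellFounded (c : PolyCoalgebra f) : Prop :=
  ∀ (X : E) (q : X ⟶ c.D)
    (Rel : ∀ (T : E) (_ : T ⟶ c.D) (a : T ⟶ A) (_ : pullback a f ⟶ X) (_ : T ⟶ X), Prop),
    (∀ (S T : E) (s : S ⟶ T) (d : T ⟶ c.D) (a : T ⟶ A) (a' : S ⟶ A) (h : s ≫ a = a')
      (y : pullback a f ⟶ X) (x : T ⟶ X),
      Rel T d a y x → Rel S (s ≫ d) a' (pbMap f s h ≫ y) (s ≫ x)) →
    (∀ (T : E) (d : T ⟶ c.D) (a : T ⟶ A) (h : d ≫ c.label = a) (y : pullback a f ⟶ X),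
      y ≫ q = pbMap f d h ≫ c.child → ∃ x : T ⟶ X, x ≫ q = d ∧ Rel T d a y x) →
    ∃ r : c.D ⟶ X, r ≫ q = 𝟙 _ ∧
      ∀ (T : E) (d : T ⟶ c.D) (a : T ⟶ A) (h : d ≫ c.label = a),
        Rel T d a (pbMap f d h ≫ c.child ≫ r) (d ≫ r)

/-- A coalgebra with a coalgebra morphism to a well-founded one is well-founded. -/
theorem IsWellFounded.of_hom {c c' : PolyCoalgebra f} (hc : c.IsWellFounded) (p : c'.D ⟶ c.D)
    (hl : p ≫ c.label = c'.label) (hch : c'.child ≫ p = pbMap f p hl ≫ c.child) :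
    c'.IsWellFounded := by
  intro X q Rel hRel step
  let Y := (depProd p).obj (Over.mk q)
  let ev : pullback Y.hom p ⟶ X := piEval p (Over.mk q)
  have hev : ev ≫ q = pullback.snd _ _ := piEval_hom p (Over.mk q)
  -- The eliminated family over `w` consists of the sections of `X` over the fibre of `p` at `w`.
  refine Exists.elim (hc Y.left Y.hom
    (fun T w a y z => ∀ (S : E) (s : S ⟶ T) (d : S ⟶ c'.D) (a' : S ⟶ A) (ha : s ≫ a = a')
      (hd : d ≫ c'.label = a') (hz : (s ≫ z) ≫ Y.hom = d ≫ p)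
      (hy : (pbMap f s ha ≫ y) ≫ Y.hom = (pbMap f d hd ≫ c'.child) ≫ p),
      Rel S d a' (pullback.lift (pbMap f s ha ≫ y) (pbMap f d hd ≫ c'.child) hy ≫ ev)
        (pullback.lift (s ≫ z) d hz ≫ ev)) ?_ ?_) ?_
  · intro S T s w a a' h y z H R s' d a'' ha hd hz hy
    have := H R (s' ≫ s) d a'' (by simp [h, ha]) hd (by simpa using hz)
      (by simpa using hy)
    simpa using this
  · intro T w a h y hy
    -- The generic element of the fibre of `p` at `w` is the second projection.
    let d := pullback.snd w p
    have hd : d ≫ c'.label = pullback.fst w p ≫ a := by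
      rw [← h, ← hl, pullback.condition_assoc]
    have hy' : (pbMap f (pullback.fst w p) rfl ≫ y) ≫ Y.hom = (pbMap f d hd ≫ c'.child) ≫ p := by
      simp only [Category.assoc, hch, hy, pbMap_pbMap_assoc, d, pullback.condition]
    obtain ⟨x, hx, hxr⟩ := step _ d _ hd
      (pullback.lift (pbMap f (pullback.fst w p) rfl ≫ y) (pbMap f d hd ≫ c'.child) hy' ≫ ev)
      (by simp [hev])
    obtain ⟨z, hz, hzx⟩ := exists_piCurry (f := p) (X := Over.mk q) w x hx
    refine ⟨z, hz, ?_⟩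
    intro S s d' a' ha hd' hz' hy''
    have e : s ≫ w = d' ≫ p := by rw [← hz', Category.assoc, hz]
    have := hRel _ _ (pullback.lift s d' e) d _ a' (by simpa using ha) _ _ hxr
    convert this using 1
    · simp [d]
    · simp only [← Category.assoc]
      congr 1
      apply pullback.hom_ext <;> simp [d]
    · rw [← hzx]
      simp only [lift_pbMap_assoc]
      rfl
  · rintro r ⟨hr, hrel⟩
    refine ⟨pullback.lift (p ≫ r) (𝟙 _) (by simp [hr]) ≫ ev, by simp [hev], ?_⟩
    intro T d a h
    have h1 := hrel T (d ≫ p) a (by simp [hl, h]) T (𝟙 _) d a (by simp) h (by simp [hr])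
      (by simp [hr, hch])
    convert h1 using 1
    · simp only [← Category.assoc]
      congr 1
      have hch' : c'.child ≫ p ≫ r = pbMap f p hl ≫ c.child ≫ r := by
        rw [← Category.assoc, hch, Category.assoc]
      apply pullback.hom_ext <;> simp [hch']
    · simp only [← Category.assoc]
      congr 1
      apply pullback.hom_ext <;> simp

end PolyCoalgebra

section WType

variable {A B : E} (f : B ⟶ A)

/-- Every map of a `ΠW`-pretopos has a W-type: a well-founded coalgebra whose elements correspond to
pairs of a label and a family of children. -/
theorem exists_wType {E : Type u} [Category.{v} E] [PiWPretopos E] {A B : E} (f : B ⟶ A) :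
    ∃ c : PolyCoalgebra f, c.IsWellFounded ∧
      (∀ (T : E) (a : T ⟶ A) (t : pullback a f ⟶ c.D), ∃ w : T ⟶ c.D, c.IsNode w a t) ∧
      (∀ (T : E) (w w' : T ⟶ c.D) (a : T ⟶ A) (t : pullback a f ⟶ c.D),
        c.IsNode w a t → c.IsNode w' a t → w = w') := by
  have := PiWPretopos.exists_wType f
  let I : Endofunctor.Algebra (polyFunctor f) := ⊥_ _
  have : IsIso I.str := Endofunctor.Algebra.Initial.str_isIso initialIsInitial
  refine ⟨⟨(polyFunctor f).obj I.a, polyLabel f _, polyChild f _ ≫ inv I.str⟩, ?_, ?_, ?_⟩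
  · intro X q Rel hRel step
    dsimp only at q Rel hRel step ⊢
    obtain ⟨x, hx, hxr⟩ := step _ ((polyFunctor f).map (q ≫ I.str)) (polyLabel f X)
      (polyMap_label _) (polyChild f X) (by
        rw [← Category.assoc, polyMap_child]; simp)
    let r : I ⟶ ⟨X, x⟩ := initial.to _
    have hr : (polyFunctor f).map r.f ≫ x = I.str ≫ r.f := r.h
    let e : (⟨X, x⟩ : Endofunctor.Algebra (polyFunctor f)) ⟶ I :=
      ⟨q ≫ I.str, by dsimp only; rw [← Category.assoc, hx]⟩
    have hre : r.f ≫ q ≫ I.str = 𝟙 _ :=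
      congrArg Endofunctor.Algebra.Hom.f (initialIsInitial.hom_ext (r ≫ e) (𝟙 I))
    refine ⟨I.str ≫ r.f, ?_, ?_⟩
    · rw [← cancel_mono I.str, Category.assoc, Category.assoc, hre]; simp
    · intro T d a h
      have := hRel _ _ (d ≫ (polyFunctor f).map r.f) _ _ a
        (by rw [Category.assoc, polyMap_label, h]) _ _ hxr
      convert this using 1
      · rw [Category.assoc, ← Functor.map_comp, hre, CategoryTheory.Functor.map_id,
          Category.comp_id]
      · rw [Category.assoc, IsIso.inv_hom_id_assoc, ← polyMap_child r.f, pbMap_pbMap_assoc]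
      · rw [Category.assoc, hr]
  · intro T a t
    obtain ⟨w, h, e⟩ := exists_poly a (t ≫ I.str)
    exact ⟨w, h, by rw [← Category.assoc, e]; simp⟩
  · rintro T w w' a t ⟨h, e⟩ ⟨h', e'⟩
    dsimp only at h e h' e'
    have e1 := e.trans e'.symm
    rw [← Category.assoc, ← Category.assoc, cancel_mono] at e1
    exact poly_ext ⟨h, e1⟩ ⟨h', rfl⟩

end WType

/-! ### First-order definable predicates on generalized elements -/

/-- A predicate on the generalized elements of `X` is definable if it is represented by a subobject
of `X`.  Definable predicates are closed under the connectives and quantifiers of first-order logic,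
read by the Kripke-Joyal clauses; only for them is induction available. -/
def Definable {E : Type u} [Category.{v} E] {X : E} (P : ∀ T : E, (T ⟶ X) → Prop) : Prop :=
  ∃ (M : E) (i : M ⟶ X), Mono i ∧ ∀ (T : E) (t : T ⟶ X), P T t ↔ ∃ t' : T ⟶ M, t' ≫ i = t

namespace Definable

section

variable {E : Type u} [Category.{v} E] {X : E} {P Q : ∀ T : E, (T ⟶ X) → Prop}

lemma congr (h : Definable P) (e : ∀ (T : E) (t : T ⟶ X), P T t ↔ Q T t) : Definable Q := by
  obtain ⟨M, i, hi, hM⟩ := h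
  exact ⟨M, i, hi, fun T t => (e T t).symm.trans (hM T t)⟩

lemma stable (h : Definable P) {S T : E} (s : S ⟶ T) {t : T ⟶ X} (ht : P T t) : P S (s ≫ t) := by
  obtain ⟨M, i, hi, hM⟩ := h
  obtain ⟨t', rfl⟩ := (hM _ _).1 ht
  exact (hM _ _).2 ⟨s ≫ t', by simp⟩

lemma of_cover (h : Definable P) {S T : E} {q : S ⟶ T} (hq : IsRegularEpi q) {t : T ⟶ X}
    (ht : P S (q ≫ t)) : P T t := by
  obtain ⟨M, i, hi, hM⟩ := h
  obtain ⟨t', e⟩ := (hM _ _).1 ht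
  exact (hM _ _).2 (exists_lift_of_cover hq i e)

end

variable {E : Type u} [Category.{v} E] [PiPretopos E] {X Y Z : E} {P Q : ∀ T : E, (T ⟶ X) → Prop}

lemma comap (h : Definable P) (g : Y ⟶ X) : Definable (fun T (t : T ⟶ Y) => P T (t ≫ g)) := by
  obtain ⟨M, i, hi, hM⟩ := h
  refine ⟨pullback g i, pullback.fst g i, inferInstance, fun T t => (hM _ _).trans ⟨?_, ?_⟩⟩
  · rintro ⟨t', e⟩
    exact ⟨pullback.lift t t' e.symm, by simp⟩
  · rintro ⟨t', rfl⟩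
    exact ⟨t' ≫ pullback.snd g i, by simp [pullback.condition]⟩

lemma and (h : Definable P) (h' : Definable Q) : Definable (fun T t => P T t ∧ Q T t) := by
  obtain ⟨M, i, hi, hM⟩ := h
  obtain ⟨N, j, hj, hN⟩ := h'
  refine ⟨pullback i j, pullback.fst i j ≫ i, inferInstance, fun T t =>
    (and_congr (hM _ _) (hN _ _)).trans ⟨?_, ?_⟩⟩
  · rintro ⟨⟨a, ha⟩, ⟨b, hb⟩⟩
    exact ⟨pullback.lift a b (ha.trans hb.symm), by simp [ha]⟩
  · rintro ⟨t', rfl⟩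
    exact ⟨⟨t' ≫ pullback.fst i j, by simp⟩, ⟨t' ≫ pullback.snd i j, by simp [pullback.condition]⟩⟩

lemma eq (a b : X ⟶ Z) : Definable (fun T (t : T ⟶ X) => t ≫ a = t ≫ b) :=
  ⟨equalizer a b, equalizer.ι a b, inferInstance, fun _ t =>
    ⟨fun h => ⟨equalizer.lift t h, by simp⟩, by
      rintro ⟨t', rfl⟩
      rw [Category.assoc, Category.assoc, equalizer.condition]⟩⟩

/-- The graph of a map out of a pullback, regarded as a partial binary operation. -/
lemma graph {A B D : E} {f : A ⟶ D} {g : B ⟶ D} (k : pullback f g ⟶ Z) (a : X ⟶ A) (b : X ⟶ B)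
    (z : X ⟶ Z) :
    Definable (fun T (t : T ⟶ X) =>
      ∃ h : (t ≫ a) ≫ f = (t ≫ b) ≫ g, pullback.lift (t ≫ a) (t ≫ b) h ≫ k = t ≫ z) := by
  let m : pullback f g ⟶ A ⨯ (B ⨯ Z) :=
    prod.lift (pullback.fst f g) (prod.lift (pullback.snd f g) k)
  have hm : Mono m := ⟨fun c d h => by
    apply pullback.hom_ext
    · simpa [m] using congrArg (· ≫ prod.fst) h
    · simpa [m] using congrArg (· ≫ prod.snd ≫ prod.fst) h⟩
  have hd : Definable (fun T (t : T ⟶ A ⨯ (B ⨯ Z)) => ∃ t' : T ⟶ pullback f g, t' ≫ m = t) :=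
    ⟨_, m, hm, fun _ _ => Iff.rfl⟩
  refine (hd.comap (prod.lift a (prod.lift b z))).congr fun T t => ⟨?_, ?_⟩
  · rintro ⟨t', h⟩
    have h1 : t' ≫ pullback.fst f g = t ≫ a := by simpa [m] using congrArg (· ≫ prod.fst) h
    have h2 : t' ≫ pullback.snd f g = t ≫ b := by
      simpa [m] using congrArg (· ≫ prod.snd ≫ prod.fst) h
    have h3 : t' ≫ k = t ≫ z := by simpa [m] using congrArg (· ≫ prod.snd ≫ prod.snd) h
    have h4 : (t ≫ a) ≫ f = (t ≫ b) ≫ g := by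
      rw [← h1, ← h2, Category.assoc, Category.assoc, pullback.condition]
    refine ⟨h4, ?_⟩
    rw [← h3]
    congr 1
    apply pullback.hom_ext <;> simp [h1, h2]
  · rintro ⟨h, hk⟩
    refine ⟨pullback.lift _ _ h, ?_⟩
    apply Limits.prod.hom_ext
    · simp [m]
    · apply Limits.prod.hom_ext <;> simp [m, hk]

/-- Universal quantification over the fibres of a map. -/
lemma all_fibre {P : ∀ T : E, (T ⟶ Y) → Prop} (h : Definable P) (f : Y ⟶ X) :
    Definable (fun T (t : T ⟶ X) => ∀ (S : E) (s : S ⟶ T) (y : S ⟶ Y), y ≫ f = s ≫ t → P S y) := by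
  obtain ⟨M, i, hi, hM⟩ := h
  let I := (depProd f).obj (Over.mk i)
  have hev : piEval f (Over.mk i) ≫ i = pullback.snd I.hom f := piEval_hom f (Over.mk i)
  refine ⟨I.left, I.hom, ⟨fun {R} a b hab => ?_⟩, fun T t => ⟨fun H => ?_, ?_⟩⟩
  · refine piCurry_ext (f := f) (X := Over.mk i) hab.symm ?_
    refine (cancel_mono i).1 ?_
    rw [Category.assoc, Category.assoc, hev, pbMap_snd, pbMap_snd]
  · obtain ⟨t', e⟩ := (hM _ _).1 (H _ (pullback.fst t f) (pullback.snd t f) pullback.condition.symm)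
    obtain ⟨c, hc, -⟩ := exists_piCurry (f := f) (X := Over.mk i) t t' e
    exact ⟨c, hc⟩
  · rintro ⟨t', rfl⟩ S s y hy
    refine (hM _ _).2 ⟨pullback.lift (s ≫ t') y (by rw [hy, Category.assoc]) ≫
      piEval f (Over.mk i), ?_⟩
    rw [Category.assoc, hev, pullback.lift_snd]

lemma imp (h : Definable P) (h' : Definable Q) :
    Definable (fun T (t : T ⟶ X) => ∀ (S : E) (s : S ⟶ T), P S (s ≫ t) → Q S (s ≫ t)) := by
  obtain ⟨M, i, hi, hM⟩ := h
  refine ((h'.comap i).all_fibre i).congr fun T t => ⟨fun H S s hP => ?_, fun H S s y hy => ?_⟩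
  · obtain ⟨t', e⟩ := (hM _ _).1 hP
    simpa [e] using H S s t' e
  · simpa [hy] using H S s ((hM _ _).2 ⟨y, hy⟩)

/-- Bounded universal quantification over the elements of `Z`. -/
lemma all {P Q : ∀ T : E, (T ⟶ X ⨯ Z) → Prop} (h : Definable P) (h' : Definable Q) :
    Definable (fun T (t : T ⟶ X) => ∀ (S : E) (s : S ⟶ T) (z : S ⟶ Z),
      P S (prod.lift (s ≫ t) z) → Q S (prod.lift (s ≫ t) z)) := by
  refine ((h.imp h').all_fibre prod.fst).congr fun T t => ⟨fun H S s z hP => ?_,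
    fun H S s y hy R r hP => ?_⟩
  · simpa using H S s (prod.lift (s ≫ t) z) (by simp) S (𝟙 S) (by simpa using hP)
  · have e : r ≫ y = prod.lift ((r ≫ s) ≫ t) (r ≫ y ≫ prod.snd) := by
      apply Limits.prod.hom_ext <;> simp [hy]
    rw [e] at hP ⊢
    exact H _ _ _ hP

/-- Existential quantification over the fibres of a map. -/
lemma ex_fibre {P : ∀ T : E, (T ⟶ Y) → Prop} (h : Definable P) (f : Y ⟶ X) :
    Definable (fun T (t : T ⟶ X) => ∃ (S : E) (q : S ⟶ T) (y : S ⟶ Y),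
      IsRegularEpi q ∧ y ≫ f = q ≫ t ∧ P S y) := by
  obtain ⟨M, i, hi, hM⟩ := h
  let F := Regular.strongEpiMonoFactorisation (i ≫ f)
  have hF : F.e ≫ F.m = i ≫ f := F.fac
  have hFe : IsRegularEpi F.e := inferInstance
  refine ⟨F.I, F.m, inferInstance, fun T t => ⟨?_, ?_⟩⟩
  · rintro ⟨S, q, y, hq, hy, hP⟩
    obtain ⟨y', rfl⟩ := (hM _ _).1 hP
    refine exists_lift_of_cover hq F.m (y := y' ≫ F.e) ?_
    rw [Category.assoc, hF, ← hy, Category.assoc]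
  · rintro ⟨t', rfl⟩
    refine ⟨pullback t' F.e, pullback.fst _ _, pullback.snd _ _ ≫ i,
      isRegularEpi_pullback_fst _ hFe, ?_, (hM _ _).2 ⟨_, rfl⟩⟩
    rw [pullback.condition_assoc, hF, Category.assoc]

/-- Existential quantification over the elements of `Z`. -/
lemma ex {P : ∀ T : E, (T ⟶ X ⨯ Z) → Prop} (h : Definable P) :
    Definable (fun T (t : T ⟶ X) => ∃ (S : E) (q : S ⟶ T) (z : S ⟶ Z),
      IsRegularEpi q ∧ P S (prod.lift (q ≫ t) z)) := by
  refine (h.ex_fibre prod.fst).congr fun T t => ⟨?_, ?_⟩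
  · rintro ⟨S, q, y, hq, hy, hP⟩
    refine ⟨S, q, y ≫ prod.snd, hq, ?_⟩
    have e : y = prod.lift (q ≫ t) (y ≫ prod.snd) := by
      apply Limits.prod.hom_ext <;> simp [hy]
    rwa [← e]
  · rintro ⟨S, q, z, hq, hP⟩
    exact ⟨S, q, _, hq, by simp, hP⟩

end Definable

/-! ### Dependent W-types -/

section Hereditary

section

variable {E : Type u} [Category.{v} E] [PiPretopos E] {A B Z : E} {f : B ⟶ A}

/-- The polynomial whose parameters are pairs of an `a` and a `Z`-valued decoration of the fibre
of `f` over `a`. -/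
abbrev decorated (f : B ⟶ A) (Z : E) : pullback (polyLabel f Z) f ⟶ (polyFunctor f).obj Z :=
  pullback.fst (polyLabel f Z) f

/-- Decorating a parameter does not change the fibre over it. -/
def decoratedFibre {T : E} {c : T ⟶ (polyFunctor f).obj Z} {a : T ⟶ A}
    (h : c ≫ polyLabel f Z = a) : pullback c (decorated f Z) ⟶ pullback a f :=
  pullback.lift (pullback.fst _ _) (pullback.snd c (decorated f Z) ≫ pullback.snd _ _) (by
    rw [← h, pullback.condition_assoc, Category.assoc, pullback.condition])

instance {T : E} {c : T ⟶ (polyFunctor f).obj Z} {a : T ⟶ A} (h : c ≫ polyLabel f Z = a) :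
    Epi (decoratedFibre h) := by
  have hw : (pullback.fst a f ≫ c) ≫ polyLabel f Z = pullback.snd a f ≫ f := by
    rw [Category.assoc, h, pullback.condition]
  have : pullback.lift (pullback.fst a f) (pullback.lift (pullback.fst a f ≫ c)
      (pullback.snd a f) hw) (by simp) ≫ decoratedFibre h = 𝟙 _ := by
    apply pullback.hom_ext <;> simp [decoratedFibre]
  exact SplitEpi.epi ⟨_, this⟩

lemma pbMap_decoratedFibre {S T : E} (s : S ⟶ T) {c : T ⟶ (polyFunctor f).obj Z} {a : T ⟶ A}
    (h : c ≫ polyLabel f Z = a) {c' : S ⟶ (polyFunctor f).obj Z} {a' : S ⟶ A}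
    (h' : c' ≫ polyLabel f Z = a') (hc : s ≫ c = c') (ha : s ≫ a = a') :
    pbMap (decorated f Z) s hc ≫ decoratedFibre h = decoratedFibre h' ≫ pbMap f s ha := by
  apply pullback.hom_ext <;> simp [decoratedFibre]

end

variable {E : Type u} [Category.{v} E] [PiWPretopos E] {A B Z : E} {f : B ⟶ A}

/-- Over a well-founded coalgebra, the elements all of whose hereditary children satisfy an equation
`u = v` form a definable class.

Since there is no object of truth values this is not a definition by recursion.  Instead, an element
is mapped to the tree of its descendants, decorated at each node with the values of `u` at its
children, and to the same tree decorated with `v`; the class is the equalizer of these two maps. -/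
theorem exists_hereditary {c : PolyCoalgebra f} (hc : c.IsWellFounded)
    (u v : pullback c.label f ⟶ Z) :
    ∃ P : ∀ T : E, (T ⟶ c.D) → Prop, Definable P ∧ ∀ (T : E) (d : T ⟶ c.D),
      P T d ↔ (pbMap f d rfl ≫ u = pbMap f d rfl ≫ v ∧ P _ (pbMap f d rfl ≫ c.child)) := by
  obtain ⟨W, -, hmk, hext⟩ := exists_wType (decorated f Z)
  have key : ∀ u : pullback c.label f ⟶ Z, ∃ α : c.D ⟶ W.D, ∀ (T : E) (d : T ⟶ c.D),
      ∃ (m : T ⟶ (polyFunctor f).obj Z) (hm : m ≫ polyLabel f Z = d ≫ c.label),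
        IsPoly m (d ≫ c.label) (pbMap f d rfl ≫ u) ∧
        W.IsNode (d ≫ α) m (decoratedFibre hm ≫ (pbMap f d rfl ≫ c.child) ≫ α) := by
    intro u
    obtain ⟨r, hr, hrel⟩ := hc (c.D ⨯ W.D) prod.fst
      (fun T d a y x => ∃ (h : d ≫ c.label = a) (m : T ⟶ (polyFunctor f).obj Z)
        (hm : m ≫ polyLabel f Z = a), IsPoly m a (pbMap f d h ≫ u) ∧
        W.IsNode (x ≫ prod.snd) m (decoratedFibre hm ≫ y ≫ prod.snd)) (by
      rintro S T s d a a' h y x ⟨hd, m, hm, h1, h2⟩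
      refine ⟨by rw [Category.assoc, hd, h], s ≫ m, by rw [Category.assoc, hm, h], ?_, ?_⟩
      · simpa using h1.restrict s h
      · have := h2.restrict s rfl
        rw [← Category.assoc (pbMap _ _ _),
          pbMap_decoratedFibre s hm (by rw [Category.assoc, hm, h]) rfl h] at this
        simpa using this) (by
      intro T d a h y hy
      obtain ⟨m, hm⟩ := exists_poly a (pbMap f d h ≫ u)
      obtain ⟨w, hw⟩ := hmk T m (decoratedFibre hm.1 ≫ y ≫ prod.snd)
      exact ⟨prod.lift d w, by simp, h, m, hm.1, hm, by simpa using hw⟩)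
    refine ⟨r ≫ prod.snd, fun T d => ?_⟩
    obtain ⟨_, m, hm, h1, h2⟩ := hrel T d _ rfl
    exact ⟨m, hm, h1, by simpa using h2⟩
  obtain ⟨α, hα⟩ := key u
  obtain ⟨β, hβ⟩ := key v
  refine ⟨fun T d => d ≫ α = d ≫ β, Definable.eq α β, fun T d => ?_⟩
  obtain ⟨m, hm, e1, c1⟩ := hα T d
  obtain ⟨n, hn, e2, c2⟩ := hβ T d
  constructor
  · intro h
    dsimp only at h
    rw [h] at c1
    obtain rfl : m = n := c1.1.symm.trans c2.1
    refine ⟨e1.unique e2, ?_⟩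
    change _ ≫ α = _ ≫ β
    rw [← cancel_epi (decoratedFibre hm)]
    exact c1.unique c2
  · rintro ⟨h1, h2⟩
    change _ ≫ α = _ ≫ β at h2
    rw [← h1] at e2
    obtain rfl := poly_ext e1 e2
    rw [← h2] at c2
    exact hext T _ _ _ _ c1 c2

/-- Dependent W-types: for `f : B ⟶ A` and maps `o : A ⟶ Z`, `β : B ⟶ Z`, the trees with labels in
`A` in which the child at `b` of any node has a label of sort `β b`, where `o` gives the sorts
of labels. -/
theorem exists_dependentWType (f : B ⟶ A) (o : A ⟶ Z) (β : B ⟶ Z) :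
    ∃ c : PolyCoalgebra f, c.IsWellFounded ∧
      c.child ≫ c.label ≫ o = pullback.snd _ _ ≫ β ∧
      (∀ (T : E) (a : T ⟶ A) (t : pullback a f ⟶ c.D),
        t ≫ c.label ≫ o = pullback.snd _ _ ≫ β → ∃ w : T ⟶ c.D, c.IsNode w a t) ∧
      (∀ (T : E) (w w' : T ⟶ c.D) (a : T ⟶ A) (t : pullback a f ⟶ c.D),
        c.IsNode w a t → c.IsNode w' a t → w = w') := by
  obtain ⟨W, hW, hmk, hext⟩ := exists_wType f
  obtain ⟨P, ⟨M, i, hi, hM⟩, hP⟩ := exists_hereditary hW (W.child ≫ W.label ≫ o)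
    (pullback.snd _ _ ≫ β)
  have hi' : P M i := (hM _ _).2 ⟨𝟙 _, by simp⟩
  obtain ⟨h1, h2⟩ := (hP _ _).1 hi'
  obtain ⟨ch, hch⟩ := (hM _ _).1 h2
  have hch' : ∀ {Y : E} (y : W.D ⟶ Y), ch ≫ i ≫ y = pbMap f i rfl ≫ W.child ≫ y := by
    intro Y y
    rw [← Category.assoc, hch, Category.assoc]
  refine ⟨⟨M, i ≫ W.label, ch⟩, hW.of_hom i rfl hch, ?_, ?_, ?_⟩
  · simp only [Category.assoc, hch']
    simpa using h1
  · intro T a t ht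
    dsimp only at t ht
    obtain ⟨w, h, e⟩ := hmk T a (t ≫ i)
    have hw : P T w := by
      subst h
      exact (hP _ _).2 ⟨by simp [reassoc_of% e, ← ht], (hM _ _).2 ⟨t, e.symm⟩⟩
    obtain ⟨w', rfl⟩ := (hM _ _).1 hw
    refine ⟨w', by simpa using h, ?_⟩
    rw [← cancel_mono i, ← e, Category.assoc, hch]
    simp
  · rintro T w w' a t ⟨h, e⟩ ⟨h', e'⟩
    dsimp only at w w' t h e h' e'
    rw [← cancel_mono i]
    refine hext T _ _ a (t ≫ i) ⟨by simpa using h, ?_⟩ ⟨by simpa using h', ?_⟩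
    · rw [← e, Category.assoc (pbMap f w h), hch, pbMap_pbMap_assoc]
    · rw [← e', Category.assoc (pbMap f w' h'), hch, pbMap_pbMap_assoc]

end Hereditary

/-! ### Trees with leaves -/

section Sum

variable {E : Type u} [Category.{v} E] [PiPretopos E] {B V L : E} {φ : B ⟶ V}

/-- The fibre of `φ` over an element of `V` is the fibre of `inr ∘ φ` over the corresponding element
of `L ⨿ V`. -/
def sumFibre (φ : B ⟶ V) {T : E} (U : T ⟶ V) {a : T ⟶ L ⨿ V} (h : U ≫ coprod.inr = a) :
    pullback U φ ⟶ pullback a (φ ≫ coprod.inr) :=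
  pullback.lift (pullback.fst _ _) (pullback.snd _ _) (by rw [← h, pullback.condition_assoc])

instance {T : E} (U : T ⟶ V) {a : T ⟶ L ⨿ V} (h : U ≫ coprod.inr = a) :
    IsIso (sumFibre φ U h) := by
  have hw : pullback.fst a (φ ≫ coprod.inr) ≫ U = pullback.snd a (φ ≫ coprod.inr) ≫ φ := by
    rw [← cancel_mono (coprod.inr : V ⟶ L ⨿ V), Category.assoc, h, Category.assoc,
      pullback.condition]
  refine ⟨pullback.lift (pullback.fst _ _) (pullback.snd _ _) hw, ?_, ?_⟩ <;>
  · apply pullback.hom_ext <;> simp [sumFibre]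

lemma pbMap_sumFibre {S T : E} (s : S ⟶ T) {U : T ⟶ V} {a : T ⟶ L ⨿ V} (h : U ≫ coprod.inr = a)
    {U' : S ⟶ V} {a' : S ⟶ L ⨿ V} (h' : U' ≫ coprod.inr = a') (hU : s ≫ U = U')
    (ha : s ≫ a = a') :
    pbMap φ s hU ≫ sumFibre φ U h = sumFibre φ U' h' ≫ pbMap _ s ha := by
  apply pullback.hom_ext <;> simp [sumFibre]

/-- The fibre of `inr ∘ φ` over an element of `L` is empty. -/
lemma nonempty_isInitial_fibre {T : E} {a : T ⟶ L ⨿ V} {c : T ⟶ L} (h : a = c ≫ coprod.inl) :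
    Nonempty (IsInitial (pullback a (φ ≫ coprod.inr))) := by
  subst h
  refine nonempty_isInitial_of_inl_eq_inr (x := pullback.fst _ _ ≫ c)
    (y := pullback.snd _ _ ≫ φ) ?_
  simpa using pullback.condition (f := c ≫ coprod.inl) (g := φ ≫ coprod.inr)

namespace PolyCoalgebra

/-- The element `d` is a branching node, with label `U` in `V` and family of children `t`. -/
def IsSup (c : PolyCoalgebra (φ ≫ (coprod.inr : V ⟶ L ⨿ V))) {T : E} (d : T ⟶ c.D) (U : T ⟶ V)
    (t : pullback U φ ⟶ c.D) : Prop :=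
  ∃ t', c.IsNode d (U ≫ coprod.inr) t' ∧ sumFibre φ U rfl ≫ t' = t

variable {c : PolyCoalgebra (φ ≫ (coprod.inr : V ⟶ L ⨿ V))} {T : E} {d : T ⟶ c.D} {U : T ⟶ V}
  {t : pullback U φ ⟶ c.D}

lemma IsSup.restrict (h : c.IsSup d U t) {S : E} (s : S ⟶ T) {U' : S ⟶ V} (hs : s ≫ U = U') :
    c.IsSup (s ≫ d) U' (pbMap φ s hs ≫ t) := by
  obtain ⟨t', h1, rfl⟩ := h
  refine ⟨_, h1.restrict s (by rw [← hs, Category.assoc]), ?_⟩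
  rw [← Category.assoc (sumFibre _ _ _), ← pbMap_sumFibre s rfl rfl hs, Category.assoc]

lemma IsSup.label_eq (h : c.IsSup d U t) : d ≫ c.label = U ≫ coprod.inr := h.choose_spec.1.1

lemma IsSup.unique (h : c.IsSup d U t) {U' : T ⟶ V} {t' : pullback U' φ ⟶ c.D}
    (h' : c.IsSup d U' t') : ∃ e : U = U', t = pbMap φ (𝟙 T) (by simp [e]) ≫ t' := by
  have e : U = U' := by
    rw [← cancel_mono (coprod.inr : V ⟶ L ⨿ V), ← h.label_eq, h'.label_eq]
  subst e
  obtain ⟨t1, h1, rfl⟩ := h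
  obtain ⟨t2, h2, rfl⟩ := h'
  obtain rfl := h1.unique h2
  exact ⟨rfl, by simp⟩

lemma isSup_of_label (h : d ≫ c.label = U ≫ coprod.inr) :
    c.IsSup d U (sumFibre φ U rfl ≫ pbMap _ d h ≫ c.child) :=
  ⟨_, ⟨h, rfl⟩, rfl⟩

lemma IsSup.lift_comp (h : c.IsSup d U t) {S : E} (s : S ⟶ T) (i : S ⟶ B) (hi : s ≫ U = i ≫ φ) :
    pullback.lift s i hi ≫ t = pullback.lift (s ≫ d) i (by
      rw [Category.assoc, h.label_eq, ← Category.assoc, hi, Category.assoc]) ≫ c.child := by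
  obtain ⟨t', ⟨hl, rfl⟩, rfl⟩ := h
  simp only [← Category.assoc]
  congr 1
  apply pullback.hom_ext <;> simp [sumFibre]

lemma exists_isSup {Z : E} {o : L ⨿ V ⟶ Z} {β : B ⟶ Z}
    (hmk : ∀ (T : E) (a : T ⟶ L ⨿ V) (t : pullback a (φ ≫ coprod.inr) ⟶ c.D),
        t ≫ c.label ≫ o = pullback.snd _ _ ≫ β → ∃ w : T ⟶ c.D, c.IsNode w a t)
    (U : T ⟶ V) (t : pullback U φ ⟶ c.D) (ht : t ≫ c.label ≫ o = pullback.snd _ _ ≫ β) :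
    ∃ w : T ⟶ c.D, c.IsSup w U t := by
  obtain ⟨w, hw⟩ := hmk T (U ≫ coprod.inr) (inv (sumFibre φ U rfl) ≫ t) (by
    rw [← cancel_epi (sumFibre φ U rfl), Category.assoc, IsIso.hom_inv_id_assoc, ht]
    simp [sumFibre])
  exact ⟨w, _, hw, by simp⟩

/-- The fibre over a label in the left summand is empty, so such a label is carried by a tree
without children. -/
lemma exists_of_initial_fibre {Z : E} {o : L ⨿ V ⟶ Z} {β : B ⟶ Z}
    (hmk : ∀ (T : E) (a : T ⟶ L ⨿ V) (t : pullback a (φ ≫ coprod.inr) ⟶ c.D),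
        t ≫ c.label ≫ o = pullback.snd _ _ ≫ β → ∃ w : T ⟶ c.D, c.IsNode w a t) :
    ∃ l : L ⟶ c.D, l ≫ c.label = coprod.inl := by
  obtain ⟨hI⟩ := nonempty_isInitial_fibre (φ := φ)
    (Category.id_comp (coprod.inl : L ⟶ L ⨿ V)).symm
  obtain ⟨w, hw, -⟩ := hmk L coprod.inl (hI.to _) (hI.hom_ext _ _)
  exact ⟨w, hw⟩

lemma eq_of_label_inl
    (hext : ∀ (T : E) (w w' : T ⟶ c.D) (a : T ⟶ L ⨿ V) (t : pullback a (φ ≫ coprod.inr) ⟶ c.D),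
      c.IsNode w a t → c.IsNode w' a t → w = w')
    {x : T ⟶ L} {d d' : T ⟶ c.D} (h : d ≫ c.label = x ≫ coprod.inl)
    (h' : d' ≫ c.label = x ≫ coprod.inl) : d = d' := by
  obtain ⟨hI⟩ := nonempty_isInitial_fibre (φ := φ) h
  exact hext T _ _ (d ≫ c.label) (hI.to _) ⟨rfl, hI.hom_ext _ _⟩ ⟨h'.trans h.symm, hI.hom_ext _ _⟩

lemma IsSup.ext
    (hext : ∀ (T : E) (w w' : T ⟶ c.D) (a : T ⟶ L ⨿ V) (t : pullback a (φ ≫ coprod.inr) ⟶ c.D),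
      c.IsNode w a t → c.IsNode w' a t → w = w')
    (h : c.IsSup d U t) {d' : T ⟶ c.D} (h' : c.IsSup d' U t) : d = d' := by
  obtain ⟨t1, h1, e1⟩ := h
  obtain ⟨t2, h2, e2⟩ := h'
  obtain rfl : t1 = t2 := by rw [← cancel_epi (sumFibre φ U rfl), e1, e2]
  exact hext _ _ _ _ _ h1 h2

/-- Dependent elimination for a family over a well-founded object of trees. -/
lemma IsWellFounded.elim_sum (hwf : c.IsWellFounded) {leaf : L ⟶ c.D}
    (heq : ∀ (T : E) (w : T ⟶ c.D) (x : T ⟶ L), w ≫ c.label = x ≫ coprod.inl → w = x ≫ leaf)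
    {D X : E} (p : D ⟶ c.D) (q : X ⟶ D)
    (h0 : ∀ (T : E) (d : T ⟶ D) (x : T ⟶ L), d ≫ p = x ≫ leaf → ∃ x : T ⟶ X, x ≫ q = d)
    (h1 : ∀ (T : E) (d : T ⟶ D) (U : T ⟶ V) (t : pullback U φ ⟶ c.D), c.IsSup (d ≫ p) U t →
      ∃ e : pullback U φ ⟶ D, e ≫ p = t ∧
        ∀ (S : E) (s : S ⟶ T) (y : pullback (s ≫ U) φ ⟶ X),
          y ≫ q = pbMap φ s rfl ≫ e → ∃ x : S ⟶ X, x ≫ q = s ≫ d) :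
    ∃ r : D ⟶ X, r ≫ q = 𝟙 D := by
  -- The children of an element of `D` are chosen at the generic element lying over a node.
  let d₁ := pullback.fst (p ≫ c.label) (coprod.inr : V ⟶ L ⨿ V)
  let U₁ := pullback.snd (p ≫ c.label) (coprod.inr : V ⟶ L ⨿ V)
  have hd₁ : (d₁ ≫ p) ≫ c.label = U₁ ≫ coprod.inr := by
    rw [Category.assoc]; exact pullback.condition
  have hs := isSup_of_label hd₁
  obtain ⟨e₁, he₁, H⟩ := h1 _ d₁ U₁ _ hs
  let ch : pullback (p ≫ c.label) (φ ≫ (coprod.inr : V ⟶ L ⨿ V)) ⟶ D :=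
    pullback.lift (pullback.lift (pullback.fst _ _) (pullback.snd _ _ ≫ φ)
      (by simpa using pullback.condition)) (pullback.snd _ _) (by simp [U₁]) ≫ e₁
  let cD : PolyCoalgebra (φ ≫ (coprod.inr : V ⟶ L ⨿ V)) := ⟨D, p ≫ c.label, ch⟩
  have hcD : cD.IsWellFounded := hwf.of_hom p rfl (by
    dsimp only [cD, ch]
    rw [Category.assoc, he₁, hs.lift_comp]
    congr 1
    apply pullback.hom_ext <;> simp [d₁])
  -- Pulled back along `p`, the coalgebra of trees yields a well-founded coalgebra structure on `D`.
  obtain ⟨r, hr, -⟩ := hcD X q (fun _ _ _ _ _ => True) (fun _ _ _ _ _ _ _ _ _ _ => trivial)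
    (fun T d a h y hy => by
      refine (exists_lift_of_coprod a q d ?_ ?_).imp fun x hx => ⟨hx, trivial⟩
      · intro S s x hx
        exact h0 S (s ≫ d) x (heq _ _ _ (by rw [← hx, ← h]; simp [cD]))
      · intro S s U hU
        have hk : (s ≫ d) ≫ p ≫ c.label = U ≫ coprod.inr := by rw [← hU, ← h]; simp [cD]
        obtain ⟨k, e1, rfl⟩ : ∃ k, k ≫ d₁ = s ≫ d ∧ k ≫ U₁ = U :=
          ⟨pullback.lift (s ≫ d) U hk, pullback.lift_fst _ _ _, pullback.lift_snd _ _ _⟩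
        rw [← e1]
        refine H S k (pullback.lift (pullback.fst _ _ ≫ s) (pullback.snd _ _) ?_ ≫ y) ?_
        · rw [Category.assoc, hU, pullback.condition_assoc]
        · rw [Category.assoc, hy]
          simp only [cD, ch, ← Category.assoc]
          congr 1
          apply pullback.hom_ext
          · apply pullback.hom_ext
            · simpa [d₁] using congrArg (pullback.fst (k ≫ U₁) φ ≫ ·) e1.symm
            · simpa [U₁] using pullback.condition.symm
          · simp)
  exact ⟨r, hr⟩

end PolyCoalgebra

end Sum

section Comp

variable {E : Type u} [Category.{v} E] [HasPullbacks E] {C : InternalCategory E} {T : E}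

lemma isComp_restrict {g f k : T ⟶ C.C₁} (h : C.IsComp g f k) {S : E} (s : S ⟶ T) :
    C.IsComp (s ≫ g) (s ≫ f) (s ≫ k) := by
  obtain ⟨h, rfl⟩ := h
  have e : s ≫ pullback.lift g f h = pullback.lift (s ≫ g) (s ≫ f) (by simp [h]) := by
    apply pullback.hom_ext <;> simp
  exact ⟨by simp [h], by rw [← e, Category.assoc]⟩

lemma isComp_restrict' {g f k : T ⟶ C.C₁} (h : C.IsComp g f k) {S : E} {s : S ⟶ T}
    {g' f' k' : S ⟶ C.C₁} (hg : s ≫ g = g') (hf : s ≫ f = f') (hk : s ≫ k = k') :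
    C.IsComp g' f' k' := by
  subst hg hf hk
  exact isComp_restrict h s

lemma exists_isComp {g f : T ⟶ C.C₁} (h : g ≫ C.dom = f ≫ C.cod) : ∃ k, C.IsComp g f k :=
  ⟨_, h, rfl⟩

lemma isComp_unique {g f k k' : T ⟶ C.C₁} (h : C.IsComp g f k) (h' : C.IsComp g f k') : k = k' := by
  obtain ⟨_, rfl⟩ := h
  obtain ⟨_, rfl⟩ := h'
  rfl

lemma isComp_dom {g f k : T ⟶ C.C₁} (h : C.IsComp g f k) : k ≫ C.dom = f ≫ C.dom := by
  obtain ⟨h, rfl⟩ := h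
  rw [Category.assoc, C.comp_dom, pullback.lift_snd_assoc]

lemma isComp_cod {g f k : T ⟶ C.C₁} (h : C.IsComp g f k) : k ≫ C.cod = g ≫ C.cod := by
  obtain ⟨h, rfl⟩ := h
  rw [Category.assoc, C.comp_cod, pullback.lift_fst_assoc]

lemma isComp_assoc {h g f hg gf k : T ⟶ C.C₁} (h1 : C.IsComp h g hg) (h2 : C.IsComp g f gf) :
    C.IsComp hg f k ↔ C.IsComp h gf k := by
  have d1 : hg ≫ C.dom = f ≫ C.cod := by rw [isComp_dom h1, h2.1]
  have d2 : h ≫ C.dom = gf ≫ C.cod := by rw [isComp_cod h2, h1.1]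
  obtain ⟨e1, rfl⟩ := h1
  obtain ⟨e2, rfl⟩ := h2
  have := C.assoc h g f e1 e2 d1 d2
  exact ⟨fun ⟨_, e⟩ => ⟨d2, this.symm.trans e⟩, fun ⟨_, e⟩ => ⟨d1, this.trans e⟩⟩

lemma isComp_id {f : T ⟶ C.C₁} {x : T ⟶ C.C₀} (h : f ≫ C.dom = x) :
    C.IsComp f (x ≫ C.id) f := by
  subst h
  have h : f ≫ C.dom = ((f ≫ C.dom) ≫ C.id) ≫ C.cod := by simp [C.id_cod]
  exact ⟨h, by simpa using C.comp_id f (by simpa using h)⟩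

lemma isComp_id_left {f : T ⟶ C.C₁} {x : T ⟶ C.C₀} (h : f ≫ C.cod = x) :
    C.IsComp (x ≫ C.id) f f := by
  subst h
  have h : ((f ≫ C.cod) ≫ C.id) ≫ C.dom = f ≫ C.cod := by simp [C.id_dom]
  exact ⟨h, by simpa using C.id_comp f (by simpa using h)⟩

end Comp

/-- The well-founded trees over a family `J` of covering families, and their leaves.  A tree `w`
over an object `x` is either a bare leaf, `leaf x`, or it consists of a covering family `U` of `x`
and a tree over `dom m(i)` for each index `i` of `U`.  A leaf of `leaf x` is trivial; a leaf of the
second kind of tree consists of an index `i` of `U` and a leaf of the tree at `i`.  The map `m`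
sends a leaf, which is a path through the tree, to the composite arrow along this path. -/
structure Trees {E : Type u} [Category.{v} E] [PiPretopos E] {C : InternalCategory E}
    (J : CoveringFamilies C) where
  W : E
  L : E
  ob : W ⟶ C.C₀
  leaf : C.C₀ ⟶ W
  leaf_ob : leaf ≫ ob = 𝟙 _
  /-- `w` is the tree given by `U` and the family of trees `t`. -/
  IsNode : ∀ {T : E} (_ : T ⟶ W) (U : T ⟶ J.Cov) (_ : pullback U J.φ ⟶ W), Prop
  node_restrict : ∀ {T : E} {w : T ⟶ W} {U : T ⟶ J.Cov} {t : pullback U J.φ ⟶ W},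
    IsNode w U t → ∀ {S : E} (s : S ⟶ T) {U' : S ⟶ J.Cov} (hs : s ≫ U = U'),
      IsNode (s ≫ w) U' (pbMap J.φ s hs ≫ t)
  node_ob : ∀ {T : E} {w : T ⟶ W} {U : T ⟶ J.Cov} {t : pullback U J.φ ⟶ W},
    IsNode w U t → w ≫ ob = U ≫ J.toObj
  node_typed : ∀ {T : E} {w : T ⟶ W} {U : T ⟶ J.Cov} {t : pullback U J.φ ⟶ W},
    IsNode w U t → t ≫ ob = pullback.snd _ _ ≫ J.m ≫ C.dom
  exists_node : ∀ {T : E} (U : T ⟶ J.Cov) (t : pullback U J.φ ⟶ W),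
    t ≫ ob = pullback.snd _ _ ≫ J.m ≫ C.dom → ∃ w : T ⟶ W, IsNode w U t
  /-- Dependent elimination along a map `p` to the object of trees.  To find a section of `q` it
  suffices to lift elements over bare leaves, and to lift an element over a node given lifts of some
  family of elements over its subtrees. -/
  elim : ∀ {D X : E} (p : D ⟶ W) (q : X ⟶ D),
    (∀ (T : E) (d : T ⟶ D) (c : T ⟶ C.C₀), d ≫ p = c ≫ leaf → ∃ x : T ⟶ X, x ≫ q = d) →
    (∀ (T : E) (d : T ⟶ D) (U : T ⟶ J.Cov) (t : pullback U J.φ ⟶ W), IsNode (d ≫ p) U t →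
      ∃ e : pullback U J.φ ⟶ D, e ≫ p = t ∧
        ∀ (S : E) (s : S ⟶ T) (y : pullback (s ≫ U) J.φ ⟶ X),
          y ≫ q = pbMap J.φ s rfl ≫ e → ∃ x : S ⟶ X, x ≫ q = s ≫ d) →
    ∃ r : D ⟶ X, r ≫ q = 𝟙 D
  root : L ⟶ W
  m : L ⟶ C.C₁
  m_cod : m ≫ C.cod = root ≫ ob
  triv : C.C₀ ⟶ L
  triv_root : triv ≫ root = leaf
  triv_m : triv ≫ m = C.id
  eq_triv : ∀ {T : E} (l : T ⟶ L) (c : T ⟶ C.C₀), l ≫ root = c ≫ leaf → l = c ≫ triv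
  /-- The leaf `l` is given by the index `i` and the leaf `l'` of the subtree at `i`. -/
  IsCons : ∀ {T : E} (_ : T ⟶ L) (_ : T ⟶ J.Idx) (_ : T ⟶ L), Prop
  cons_restrict : ∀ {T : E} {l : T ⟶ L} {i : T ⟶ J.Idx} {l' : T ⟶ L}, IsCons l i l' →
    ∀ {S : E} (s : S ⟶ T), IsCons (s ≫ l) (s ≫ i) (s ≫ l')
  exists_cons : ∀ {T : E} {w : T ⟶ W} {U : T ⟶ J.Cov} {t : pullback U J.φ ⟶ W}, IsNode w U t →
    ∀ {S : E} (s : S ⟶ T) (i : S ⟶ J.Idx) (h : s ≫ U = i ≫ J.φ) (l' : S ⟶ L),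
      l' ≫ root = pullback.lift s i h ≫ t → ∃ l : S ⟶ L, l ≫ root = s ≫ w ∧ IsCons l i l'
  cons_inv : ∀ {T : E} {w : T ⟶ W} {U : T ⟶ J.Cov} {t : pullback U J.φ ⟶ W}, IsNode w U t →
    ∀ {S : E} (s : S ⟶ T) (l : S ⟶ L), l ≫ root = s ≫ w →
      ∃ (i : S ⟶ J.Idx) (h : s ≫ U = i ≫ J.φ) (l' : S ⟶ L),
        l' ≫ root = pullback.lift s i h ≫ t ∧ IsCons l i l'
  cons_unique : ∀ {T : E} {l : T ⟶ L} {i i' : T ⟶ J.Idx} {l₁ l₂ : T ⟶ L},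
    IsCons l i l₁ → IsCons l i' l₂ → i = i' ∧ l₁ = l₂
  cons_ext : ∀ {T : E} {l l' : T ⟶ L} {i : T ⟶ J.Idx} {l₁ : T ⟶ L},
    IsCons l i l₁ → IsCons l' i l₁ → l ≫ root = l' ≫ root → l = l'
  cons_comp : ∀ {T : E} {l : T ⟶ L} {i : T ⟶ J.Idx} {l' : T ⟶ L}, IsCons l i l' →
    C.IsComp (i ≫ J.m) (l' ≫ m) (l ≫ m)

section Leaves

section

variable {E : Type u} [Category.{v} E] [FinitaryExtensive E] {X Y Y' T : E}

/-- An element of a coproduct which is mapped into the left summand lies in the left summand. -/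
lemma eq_inl_of_desc {b : Y ⟶ Y'} {y : T ⟶ X ⨿ Y} {x : T ⟶ X} [HasPullbacks E]
    (h : y ≫ coprod.desc coprod.inl (b ≫ coprod.inr) = x ≫ (coprod.inl : X ⟶ X ⨿ Y')) :
    y = x ≫ coprod.inl := by
  obtain ⟨z, hz⟩ := exists_lift_of_coprod y (coprod.inl : X ⟶ X ⨿ Y) y
    (fun S s c e => ⟨c, e.symm⟩) (fun S s e he => by
      obtain ⟨hI⟩ := nonempty_isInitial_of_inl_eq_inr (x := s ≫ x) (y := e ≫ b) (by
        rw [Category.assoc, ← h, ← Category.assoc, he]; simp)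
      exact ⟨hI.to _, hI.hom_ext _ _⟩)
  subst hz
  have : z = x := by
    rw [← cancel_mono (coprod.inl : X ⟶ X ⨿ Y'), ← h]; simp
  rw [this]

/-- An element of a coproduct which is mapped into the right summand lies in the right summand. -/
lemma exists_eq_inr_of_desc {b : Y ⟶ Y'} {y : T ⟶ X ⨿ Y} {x : T ⟶ Y'} [HasPullbacks E]
    (h : y ≫ coprod.desc coprod.inl (b ≫ coprod.inr) = x ≫ (coprod.inr : Y' ⟶ X ⨿ Y')) :
    ∃ z, y = z ≫ coprod.inr := by
  obtain ⟨z, hz⟩ := exists_lift_of_coprod y (coprod.inr : Y ⟶ X ⨿ Y) y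
    (fun S s c hc => by
      obtain ⟨hI⟩ := nonempty_isInitial_of_inl_eq_inr (x := c) (y := s ≫ x) (by
        rw [Category.assoc, ← h, ← Category.assoc, hc]; simp)
      exact ⟨hI.to _, hI.hom_ext _ _⟩) (fun S s c e => ⟨c, e.symm⟩)
  exact ⟨z, hz.symm⟩

end

instance {E : Type u} [Category.{v} E] [HasPullbacks E] {T X : E} (e : T ⟶ X) :
    IsIso (pullback.fst e (𝟙 X)) :=
  ⟨pullback.lift (𝟙 _) e (by simp), by apply pullback.hom_ext <;> simp [pullback.condition],
    by simp⟩

variable {E : Type u} [Category.{v} E]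

section Composite

variable [PiPretopos E] {C : InternalCategory E} {J : CoveringFamilies C} {𝒟 : E}

/-- The composite arrow along a path, defined by recursion on the path. -/
lemma exists_composite {cl : PolyCoalgebra (𝟙 𝒟 ≫ (coprod.inr : 𝒟 ⟶ C.C₀ ⨿ 𝒟))}
    (hwf : cl.IsWellFounded) (r : cl.D ⟶ C.C₀)
    (hr0 : ∀ (T : E) (l : T ⟶ cl.D) (c : T ⟶ C.C₀), l ≫ cl.label = c ≫ coprod.inl → l ≫ r = c)
    (i : 𝒟 ⟶ C.C₁)
    (hr1 : ∀ (T : E) (l : T ⟶ cl.D) (e : T ⟶ 𝒟), l ≫ cl.label = e ≫ coprod.inr →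
      l ≫ r = e ≫ i ≫ C.cod)
    (htyped : cl.child ≫ r = pullback.snd _ _ ≫ i ≫ C.dom) :
    ∃ m : cl.D ⟶ C.C₁, m ≫ C.cod = r ∧
      (∀ (T : E) (l : T ⟶ cl.D) (c : T ⟶ C.C₀), l ≫ cl.label = c ≫ coprod.inl →
        l ≫ m = c ≫ C.id) ∧
      (∀ (T : E) (l l' : T ⟶ cl.D) (e : T ⟶ 𝒟),
        cl.IsSup l e (pullback.fst e (𝟙 _) ≫ l') → C.IsComp (e ≫ i) (l' ≫ m) (l ≫ m)) := by
  refine Exists.elim (hwf (pullback r C.cod) (pullback.fst _ _)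
    (fun T _ a y x => (∀ (S : E) (s : S ⟶ T) (c : S ⟶ C.C₀), s ≫ a = c ≫ coprod.inl →
        s ≫ x ≫ pullback.snd _ _ = c ≫ C.id) ∧
      ∀ (S : E) (s : S ⟶ T) (e : S ⟶ 𝒟) (h : s ≫ a = e ≫ 𝟙 𝒟 ≫ coprod.inr),
        C.IsComp (e ≫ i) (pullback.lift s e h ≫ y ≫ pullback.snd _ _) (s ≫ x ≫ pullback.snd _ _))
    ?_ ?_) ?_
  · rintro S T s d a a' h y x ⟨H0, H1⟩
    refine ⟨fun R r c hc => ?_, fun R r e he => ?_⟩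
    · simpa using H0 R (r ≫ s) c (by rw [Category.assoc, h, hc])
    · simpa using H1 R (r ≫ s) e (by rw [Category.assoc, h, he])
  · intro T d a h y hy
    have h0 := pullback.condition (f := a) (g := (coprod.inl : C.C₀ ⟶ C.C₀ ⨿ 𝒟))
    have h1 := pullback.condition (f := a) (g := (coprod.inr : 𝒟 ⟶ C.C₀ ⨿ 𝒟))
    have hd0 := hr0 _ (pullback.fst a (coprod.inl : C.C₀ ⟶ C.C₀ ⨿ 𝒟) ≫ d) (pullback.snd _ _)
      (by rw [← h0, ← h, Category.assoc])
    have hd1 := hr1 _ (pullback.fst a (coprod.inr : 𝒟 ⟶ C.C₀ ⨿ 𝒟) ≫ d) (pullback.snd _ _)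
      (by rw [← h1, ← h, Category.assoc])
    let y' := pullback.lift (pullback.fst a (coprod.inr : 𝒟 ⟶ C.C₀ ⨿ 𝒟)) (pullback.snd _ _)
      (by simpa using h1) ≫ y ≫ pullback.snd r C.cod
    have hk : (pullback.snd a (coprod.inr : 𝒟 ⟶ C.C₀ ⨿ 𝒟) ≫ i) ≫ C.dom = y' ≫ C.cod := by
      simp only [y', Category.assoc]
      rw [← pullback.condition (f := r) (g := C.cod), reassoc_of% hy, htyped]
      simp
    obtain ⟨k, hk⟩ := exists_isComp hk
    have hkc := isComp_cod hk
    obtain ⟨x, hx0, hx1, -⟩ := exists_desc_of_coprod a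
      (pullback.lift (pullback.fst a (coprod.inl : C.C₀ ⟶ C.C₀ ⨿ 𝒟) ≫ d)
        (pullback.snd _ _ ≫ C.id) (by rw [hd0, Category.assoc, C.id_cod, Category.comp_id]) :
        _ ⟶ pullback r C.cod)
      (pullback.lift (pullback.fst a (coprod.inr : 𝒟 ⟶ C.C₀ ⨿ 𝒟) ≫ d) k
        (by rw [hd1, hkc, Category.assoc]))
    refine ⟨x, ?_, fun S s c hc => ?_, fun S s e he => ?_⟩
    · obtain ⟨z, -, -, hz⟩ := exists_desc_of_coprod a (pullback.fst a coprod.inl ≫ d)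
        (pullback.fst a coprod.inr ≫ d)
      refine (hz _ ?_ ?_).trans (hz d rfl rfl).symm
      · rw [reassoc_of% hx0, pullback.lift_fst]
      · rw [reassoc_of% hx1, pullback.lift_fst]
    · have e1 : s = pullback.lift s c hc ≫ pullback.fst _ _ := by simp
      rw [e1, Category.assoc, reassoc_of% hx0]
      simp
    · have he' : s ≫ a = e ≫ coprod.inr := by simpa using he
      refine isComp_restrict' hk (s := pullback.lift s e he') (by simp) ?_ ?_
      · simp only [y', ← Category.assoc]
        congr 2
        apply pullback.hom_ext <;> simp
      · have e1 : s ≫ x = pullback.lift s e he' ≫ pullback.fst _ _ ≫ x := by simp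
        rw [← Category.assoc s, e1, hx1]
        simp
  · rintro s ⟨hs, hrel⟩
    refine ⟨s ≫ pullback.snd _ _, ?_, ?_, ?_⟩
    · rw [Category.assoc, ← pullback.condition, reassoc_of% hs]
    · intro T l c h
      have := (hrel T l _ rfl).1 T (𝟙 _) c (by simpa using h)
      simpa using this
    · intro T l l' e h
      have hl := h.label_eq
      have := (hrel T l _ rfl).2 T (𝟙 _) e (by simpa using hl)
      have e2 := h.lift_comp (𝟙 T) e (by simp)
      simp only [pullback.lift_fst_assoc, Category.id_comp] at e2
      rw [e2]
      simpa using this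

end Composite

/-- Both the trees and their leaves are dependent W-types.  The labels of a tree are the objects
(for bare leaves) and the covering families; a covering family has one child for each index.  A leaf
is a path to it, that is a list: its labels are the objects (for the end of the path) and the steps,
and a step has one child, the remaining path. -/
theorem nonempty_trees [PiWPretopos E] {C : InternalCategory E} (J : CoveringFamilies C) :
    Nonempty (Trees J) := by
  obtain ⟨c, hwf, htyped, hmk, hext⟩ := exists_dependentWType
    (J.φ ≫ (coprod.inr : J.Cov ⟶ C.C₀ ⨿ J.Cov)) (coprod.desc (𝟙 C.C₀) J.toObj) (J.m ≫ C.dom)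
  obtain ⟨leaf, hleaf⟩ := PolyCoalgebra.exists_of_initial_fibre hmk
  have heq : ∀ (T : E) (w : T ⟶ c.D) (x : T ⟶ C.C₀), w ≫ c.label = x ≫ coprod.inl →
      w = x ≫ leaf := fun T w x h =>
    PolyCoalgebra.eq_of_label_inl hext h (by rw [Category.assoc, hleaf])
  -- A step of a path consists of a branching tree and an index of its covering family.
  let 𝒟 := pullback c.label (J.φ ≫ (coprod.inr : J.Cov ⟶ C.C₀ ⨿ J.Cov))
  obtain ⟨cl, lwf, ltyped, lmk, lext⟩ := exists_dependentWType
    (𝟙 𝒟 ≫ (coprod.inr : 𝒟 ⟶ C.C₀ ⨿ 𝒟)) (coprod.desc leaf (pullback.fst _ _)) c.child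
  obtain ⟨triv, htriv⟩ := PolyCoalgebra.exists_of_initial_fibre lmk
  let root : cl.D ⟶ c.D := cl.label ≫ coprod.desc leaf (pullback.fst _ _)
  have hroot : ∀ {Y : E} (y : c.D ⟶ Y), root ≫ y =
    cl.label ≫ coprod.desc leaf (pullback.fst _ _) ≫ y := fun y => Category.assoc _ _ _
  have hroot_label : root ≫ c.label = cl.label ≫ coprod.desc coprod.inl
      ((pullback.snd _ _ ≫ J.φ) ≫ coprod.inr) := by
    rw [hroot]
    congr 1
    apply coprod.hom_ext <;> simp [hleaf, pullback.condition]
  obtain ⟨m, hm, hm0, hm1⟩ := exists_composite lwf (root ≫ c.label ≫ coprod.desc (𝟙 _) J.toObj)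
    (fun T l x h => by simp [hroot, reassoc_of% h, reassoc_of% hleaf])
    (pullback.snd _ _ ≫ J.m)
    (fun T l e h => by
      simp [hroot, reassoc_of% h, pullback.condition_assoc, J.comm])
    (by
      have e : cl.child ≫ root = pullback.snd _ _ ≫ c.child := ltyped
      rw [reassoc_of% e, htyped, Category.assoc])
  have hinv : ∀ {T : E} {w : T ⟶ c.D} {U : T ⟶ J.Cov} {t : pullback U J.φ ⟶ c.D},
      c.IsSup w U t → ∀ (l : T ⟶ cl.D), l ≫ root = w → ∃ e : T ⟶ 𝒟,
        l ≫ cl.label = e ≫ coprod.inr ∧ e ≫ pullback.fst _ _ = w := by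
    intro T w U t h l hl
    obtain ⟨e, he⟩ := exists_eq_inr_of_desc (y := l ≫ cl.label) (x := U)
      (b := pullback.snd c.label (J.φ ≫ coprod.inr) ≫ J.φ) (by
        rw [Category.assoc, ← hroot_label, ← Category.assoc, hl, h.label_eq])
    exact ⟨e, he, by simp [← hl, root, reassoc_of% he]⟩
  exact ⟨{
    W := c.D
    L := cl.D
    ob := c.label ≫ coprod.desc (𝟙 _) J.toObj
    leaf := leaf
    leaf_ob := by simp [reassoc_of% hleaf]
    IsNode := fun w U t => c.IsSup w U t
    node_restrict := fun h _ _ _ hs => h.restrict _ hs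
    node_ob := fun h => by rw [← Category.assoc, h.label_eq]; simp
    node_typed := by
      rintro T w U t ⟨t', ⟨h, rfl⟩, rfl⟩
      rw [Category.assoc, Category.assoc, htyped]
      simp [sumFibre]
    exists_node := fun U t ht => PolyCoalgebra.exists_isSup hmk U t ht
    elim := fun p q h0 h1 => hwf.elim_sum heq p q h0 h1
    root := root
    m := m
    m_cod := hm
    triv := triv
    triv_root := by simp [root, reassoc_of% htriv]
    triv_m := by
      rw [← Category.id_comp C.id]
      exact hm0 _ triv (𝟙 _) (by simpa using htriv)
    eq_triv := fun l x h => PolyCoalgebra.eq_of_label_inl lext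
      (eq_inl_of_desc (b := pullback.snd c.label (J.φ ≫ coprod.inr) ≫ J.φ) (by
        rw [Category.assoc, ← hroot_label, ← Category.assoc, h, Category.assoc, hleaf]))
      (by rw [Category.assoc, htriv])
    IsCons := fun {T} l i l' => ∃ e : T ⟶ 𝒟, e ≫ pullback.fst _ _ = l ≫ root ∧
      e ≫ pullback.snd _ _ = i ∧ cl.IsSup l e (pullback.fst e (𝟙 _) ≫ l')
    cons_restrict := by
      rintro T l i l' ⟨e, h1, h2, h3⟩ S s
      refine ⟨s ≫ e, by simp [h1], by simp [h2], ?_⟩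
      simpa using h3.restrict s rfl
    exists_cons := by
      intro T w U t h S s i hi l' hl'
      rw [h.lift_comp] at hl'
      have hq : (s ≫ w) ≫ c.label = i ≫ J.φ ≫ coprod.inr := by
        rw [Category.assoc, h.label_eq, ← Category.assoc, hi, Category.assoc]
      obtain ⟨e, he⟩ : ∃ e : S ⟶ 𝒟, e = pullback.lift (s ≫ w) i hq := ⟨_, rfl⟩
      rw [← he] at hl'
      have hc : (pullback.fst e (𝟙 𝒟) ≫ l') ≫ root = pullback.snd e (𝟙 𝒟) ≫ c.child := by
        rw [Category.assoc, hl', pullback.condition_assoc, Category.id_comp]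
      obtain ⟨l, hl⟩ := PolyCoalgebra.exists_isSup lmk _ _ hc
      exact ⟨l, by simp [root, reassoc_of% hl.label_eq, he], e, by
        simp [root, reassoc_of% hl.label_eq], by simp [he], hl⟩
    cons_inv := by
      intro T w U t h S s l hl
      obtain ⟨e, he, hw⟩ := hinv (h.restrict s rfl) l hl
      have hi : s ≫ U = (e ≫ pullback.snd _ _) ≫ J.φ := by
        rw [← cancel_mono (coprod.inr : J.Cov ⟶ C.C₀ ⨿ J.Cov), Category.assoc, ← h.label_eq,
          ← Category.assoc, ← hw]
        simp [pullback.condition]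
      have hs := PolyCoalgebra.isSup_of_label he
      obtain ⟨l', hl'⟩ : ∃ l', pullback.fst e (𝟙 𝒟) ≫ l' =
          sumFibre (𝟙 𝒟) e rfl ≫ pbMap _ l he ≫ cl.child := ⟨_, IsIso.hom_inv_id_assoc _ _⟩
      rw [← hl'] at hs
      refine ⟨e ≫ pullback.snd _ _, hi, l', ?_, e, hw.trans hl.symm, rfl, hs⟩
      have e1 : cl.child ≫ root = pullback.snd _ _ ≫ c.child := ltyped
      have hq : (s ≫ w) ≫ c.label = (e ≫ pullback.snd _ _) ≫ J.φ ≫ coprod.inr := by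
        rw [← hw, Category.assoc, pullback.condition, Category.assoc]
      have e2 : pullback.lift (s ≫ w) (e ≫ pullback.snd _ _) hq = e := by
        apply pullback.hom_ext <;> simp [hw]
      rw [h.lift_comp, e2, ← cancel_epi (pullback.fst e (𝟙 𝒟)), reassoc_of% hl', e1,
        pullback.condition_assoc]
      simp [sumFibre]
    cons_unique := by
      rintro T l i i' l₁ l₂ ⟨e, h1, rfl, h3⟩ ⟨e', h1', rfl, h3'⟩
      obtain ⟨rfl, h⟩ := h3.unique h3'
      simp only [pbMap_id, Category.id_comp] at h
      exact ⟨rfl, (cancel_epi _).1 h⟩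
    cons_ext := by
      rintro T l l' i l₁ ⟨e, h1, rfl, h3⟩ ⟨e', h1', h2, h3'⟩ hr
      obtain rfl : e = e' := pullback.hom_ext (by rw [h1, h1', hr]) h2.symm
      exact h3.ext lext h3'
    cons_comp := by
      rintro T l i l' ⟨e, h1, rfl, h3⟩
      simpa using hm1 T l l' e h3 }⟩

end Leaves

/-! ### Covering families -/

section Definable

variable {E : Type u} [Category.{v} E] [PiPretopos E] {C : InternalCategory E}
  {J : CoveringFamilies C} {X : E}

lemma definable_isComp (a b c : X ⟶ C.C₁) :
    Definable (fun T (x : T ⟶ X) => C.IsComp (x ≫ a) (x ≫ b) (x ≫ c)) :=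
  Definable.graph C.comp a b c

lemma definable_factorsThrough (a : X ⟶ C.C₁) (U : X ⟶ J.Cov) :
    Definable (fun T (x : T ⟶ X) => J.FactorsThrough (x ≫ a) (x ≫ U)) := by
  refine (((Definable.eq (prod.snd ≫ prod.fst ≫ J.φ) (prod.fst ≫ U)).and
    (definable_isComp (prod.snd ≫ prod.fst ≫ J.m) (prod.snd ≫ prod.snd)
      (prod.fst ≫ a))).ex (X := X) (Z := J.Idx ⨯ C.C₁)).congr fun T x => ⟨?_, ?_⟩
  · rintro ⟨S, q, z, hq, h1, h2⟩
    exact ⟨S, q, z ≫ prod.fst, z ≫ prod.snd, hq, by simpa using h1, by simpa using h2⟩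
  · rintro ⟨S, q, i, g, hq, h1, h2⟩
    exact ⟨S, q, prod.lift i g, hq, by simpa using h1, by simpa using h2⟩

lemma definable_factorsThroughComposite {T : E} (U : T ⟶ J.Cov) (t : pullback U J.φ ⟶ J.Cov)
    (a : X ⟶ C.C₁) (s : X ⟶ T) :
    Definable (fun S (x : S ⟶ X) => J.FactorsThroughComposite (x ≫ a) (x ≫ s) U t) := by
  let i : X ⨯ ((J.Idx ⨯ J.Idx) ⨯ (C.C₁ ⨯ C.C₁)) ⟶ _ := prod.snd ≫ prod.fst ≫ prod.fst
  let j : X ⨯ ((J.Idx ⨯ J.Idx) ⨯ (C.C₁ ⨯ C.C₁)) ⟶ _ := prod.snd ≫ prod.fst ≫ prod.snd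
  let g : X ⨯ ((J.Idx ⨯ J.Idx) ⨯ (C.C₁ ⨯ C.C₁)) ⟶ _ := prod.snd ≫ prod.snd ≫ prod.fst
  let b : X ⨯ ((J.Idx ⨯ J.Idx) ⨯ (C.C₁ ⨯ C.C₁)) ⟶ _ := prod.snd ≫ prod.snd ≫ prod.snd
  refine (((Definable.graph t (prod.fst ≫ s) i (j ≫ J.φ)).and
    ((definable_isComp (i ≫ J.m) (j ≫ J.m) b).and
      (definable_isComp b g (prod.fst ≫ a)))).ex).congr fun S x => ⟨?_, ?_⟩
  · rintro ⟨R, q, z, hq, ⟨h, h1⟩, h2, h3⟩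
    exact ⟨R, q, z ≫ prod.fst ≫ prod.fst, z ≫ prod.fst ≫ prod.snd, z ≫ prod.snd ≫ prod.fst,
      z ≫ prod.snd ≫ prod.snd, by simpa [i] using h, hq, by simpa [i, j] using h1.symm,
      by simpa [i, j, b] using h2, by simpa [b, g] using h3⟩
  · rintro ⟨R, q, i', j', g', b', h, hq, h1, h2, h3⟩
    exact ⟨R, q, prod.lift (prod.lift i' j') (prod.lift g' b'), hq,
      ⟨by simpa [i] using h, by simpa [i, j] using h1.symm⟩,
      by simpa [i, j, b] using h2, by simpa [b, g] using h3⟩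

lemma definable_isPullbackFamily (V : X ⟶ J.Cov) (f : X ⟶ C.C₁) (U : X ⟶ J.Cov) :
    Definable (fun T (x : T ⟶ X) => J.IsPullbackFamily (x ≫ V) (x ≫ f) (x ≫ U)) := by
  refine ((Definable.eq (V ≫ J.toObj) (f ≫ C.dom)).and
    (Definable.all (X := X) (Z := J.Idx ⨯ C.C₁)
      ((Definable.eq (prod.snd ≫ prod.fst ≫ J.φ) (prod.fst ≫ V)).and
        (definable_isComp (prod.fst ≫ f) (prod.snd ≫ prod.fst ≫ J.m) (prod.snd ≫ prod.snd)))
      (definable_factorsThrough (prod.snd ≫ prod.snd) (prod.fst ≫ U)))).congr fun T x =>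
    and_congr (by simp) ⟨?_, ?_⟩
  · intro H S s j k h1 h2
    simpa using H S s (prod.lift j k) ⟨by simpa using h1, by simpa using h2⟩
  · rintro H S s z ⟨h1, h2⟩
    simpa using H S s (z ≫ prod.fst) (z ≫ prod.snd) (by simpa using h1) (by simpa using h2)

lemma definable_isCompositeFamily {T : E} (U : T ⟶ J.Cov) (t : pullback U J.φ ⟶ J.Cov)
    (p : X ⟶ T) (V : X ⟶ J.Cov) :
    Definable (fun S (x : S ⟶ X) => J.IsCompositeFamily (x ≫ p) (x ≫ V) U t) := by
  refine ((Definable.eq (V ≫ J.toObj) (p ≫ U ≫ J.toObj)).and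
    (Definable.all (X := X) (Z := J.Idx)
      (Definable.eq (prod.snd ≫ J.φ) (prod.fst ≫ V))
      (definable_factorsThroughComposite U t (prod.snd ≫ J.m) (prod.fst ≫ p)))).congr fun S x =>
    and_congr (by simp) ⟨?_, ?_⟩
  · intro H S s l h
    simpa using H S s l (by simpa using h)
  · intro H S s l h
    simpa using H S s l (by simpa using h)

end Definable

section CoveringFamilies

variable {E : Type u} [Category.{v} E]

section

variable [HasPullbacks E] {C : InternalCategory E} {J : CoveringFamilies C} {S T : E}

lemma factorsThrough_of_isComp {a : S ⟶ C.C₁} {U : S ⟶ J.Cov} {i : S ⟶ J.Idx} {g : S ⟶ C.C₁}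
    (hi : i ≫ J.φ = U) (h : C.IsComp (i ≫ J.m) g a) : J.FactorsThrough a U :=
  ⟨S, 𝟙 S, i, g, isRegularEpi_id S, by simpa using hi, by simpa using h⟩

lemma factorsThroughComposite_of_isComp {a : S ⟶ C.C₁} {s : S ⟶ T} {U : T ⟶ J.Cov}
    {t : pullback U J.φ ⟶ J.Cov} {i j : S ⟶ J.Idx} {b g : S ⟶ C.C₁} (h : s ≫ U = i ≫ J.φ)
    (hj : j ≫ J.φ = pullback.lift s i h ≫ t) (hb : C.IsComp (i ≫ J.m) (j ≫ J.m) b)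
    (hg : C.IsComp b g a) : J.FactorsThroughComposite a s U t :=
  ⟨S, 𝟙 S, i, j, g, b, by simpa using h, isRegularEpi_id S, by simpa using hj, hb,
    by simpa using hg⟩

end

variable [PiPretopos E] {C : InternalCategory E} {J : CoveringFamilies C}

lemma genericAssignment_toObj :
    J.genericAssignment ≫ J.toObj = pullback.snd _ _ ≫ J.m ≫ C.dom := by
  have h : piEval J.φ (Over.mk (pullback.snd J.toObj (J.m ≫ C.dom))) ≫
      pullback.snd J.toObj (J.m ≫ C.dom) = pullback.snd _ _ := piEval_hom J.φ (Over.mk _)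
  exact (Category.assoc _ _ _).trans ((congrArg (piEval J.φ (Over.mk _) ≫ ·)
    pullback.condition).trans ((Category.assoc _ _ _).symm.trans (congrArg (· ≫ J.m ≫ C.dom) h)))

/-- The object `compositeData` classifies the initial data for condition (L). -/
lemma exists_compositeData {T : E} (U : T ⟶ J.Cov) (t : pullback U J.φ ⟶ J.Cov)
    (ht : t ≫ J.toObj = pullback.snd U J.φ ≫ J.m ≫ C.dom) :
    ∃ (d : T ⟶ J.compositeData.left) (h : d ≫ J.compositeData.hom = U),
      pbMap J.φ d h ≫ J.genericAssignment = t := by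
  obtain ⟨d, h, e⟩ := exists_piCurry (f := J.φ)
    (X := Over.mk (pullback.snd J.toObj (J.m ≫ C.dom))) U
    (pullback.lift t (pullback.snd U J.φ) ht) (pullback.lift_snd _ _ _)
  refine ⟨d, h, ?_⟩
  exact (Category.assoc _ _ _).symm.trans
    ((congrArg (· ≫ pullback.fst J.toObj (J.m ≫ C.dom)) e).trans (pullback.lift_fst _ _ _))

lemma factorsThroughComposite_pbMap {S T T' : E} {a : S ⟶ C.C₁} {s : S ⟶ T} {d : T ⟶ T'}
    {U' : T' ⟶ J.Cov} {t' : pullback U' J.φ ⟶ J.Cov} {U : T ⟶ J.Cov} (h : d ≫ U' = U)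
    (H : J.FactorsThroughComposite a (s ≫ d) U' t') :
    J.FactorsThroughComposite a s U (pbMap J.φ d h ≫ t') := by
  obtain ⟨R, q, i, j, g, b, hi, hq, hj, hb, hg⟩ := H
  have hi' : (q ≫ s) ≫ U = i ≫ J.φ := by rw [← h, ← hi]; simp
  refine ⟨R, q, i, j, g, b, hi', hq, ?_, hb, hg⟩
  rw [lift_pbMap_assoc, hj]
  congr 2
  simp

lemma conditionL_of_strong (H : J.StrongConditionL) : J.ConditionL := by
  obtain ⟨V, hV, H⟩ := H
  intro T U t ht
  obtain ⟨d, h, rfl⟩ := exists_compositeData U t ht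
  refine ⟨T, 𝟙 T, d ≫ V, isRegularEpi_id T, by rw [Category.assoc, hV, ← h]; simp,
    fun S s l hl => factorsThroughComposite_pbMap h ?_⟩
  simpa using H S (s ≫ d) l (by simpa using hl)

lemma conditionC_of_strong (H : J.StrongConditionC) : J.ConditionC := by
  obtain ⟨V, hV⟩ := H
  intro T f U h
  refine ⟨T, 𝟙 T, pullback.lift f U h ≫ V, isRegularEpi_id T, ?_⟩
  have := (definable_isPullbackFamily V _ _).stable (pullback.lift f U h) (t := 𝟙 _)
    (by simpa using hV)
  simpa using this

end CoveringFamilies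

namespace Trees

variable {E : Type u} [Category.{v} E] [PiPretopos E] {C : InternalCategory E}
  {J : CoveringFamilies C} (K : Trees J)

/-- Every tree is a covering family, indexed by its leaves, whose members are the composites along
the paths to the leaves. -/
abbrev families : CoveringFamilies C := ⟨K.W, K.L, K.ob, K.root, K.m, K.m_cod⟩

/-- Proof by induction on trees, for definable predicates. -/
lemma induction {P : ∀ T : E, (T ⟶ K.W) → Prop} (hP : Definable P)
    (leaf : ∀ (T : E) (c : T ⟶ C.C₀), P T (c ≫ K.leaf))
    (node : ∀ (T : E) (w : T ⟶ K.W) (U : T ⟶ J.Cov) (t : pullback U J.φ ⟶ K.W),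
      K.IsNode w U t → P _ t → P T w) (T : E) (w : T ⟶ K.W) : P T w := by
  obtain ⟨M, i, hi, hM⟩ := hP
  obtain ⟨r, hr⟩ := K.elim (𝟙 _) i
    (fun T d c h => (hM _ _).1 (by
      rw [Category.comp_id] at h
      exact h ▸ leaf T c))
    (fun T d U t h => ⟨t, by simp, fun S s y hy => (hM _ _).1 (by
      refine node S (s ≫ d) _ _ (K.node_restrict (by simpa using h) s rfl) ?_
      exact (hM _ _).2 ⟨y, hy⟩)⟩)
  exact (hM _ _).2 ⟨w ≫ r, by simp [hr]⟩

lemma conditionM : K.families.ConditionM := fun T x =>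
  ⟨T, 𝟙 T, x ≫ K.leaf, x ≫ K.triv, isRegularEpi_id T, by simp [K.leaf_ob], by simp [K.triv_root],
    by simp [K.triv_m]⟩

lemma triv_isComp {T : E} (c : T ⟶ C.C₀) {a : T ⟶ C.C₁} (h : a ≫ C.cod = c) :
    C.IsComp ((c ≫ K.triv) ≫ K.m) a a := by
  rw [Category.assoc, K.triv_m]
  exact isComp_id_left h

/-- Grafting of trees.  Given a tree and, for each of its leaves, a tree over the domain of this
leaf, the latter trees are grafted onto the leaves by recursion on the former. -/
lemma strongConditionL : K.families.StrongConditionL := by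
  let D := K.families.compositeData.left
  let p : D ⟶ K.W := K.families.compositeData.hom
  let G : pullback p K.root ⟶ K.W := K.families.genericAssignment
  have hG : G ≫ K.ob = pullback.snd _ _ ≫ K.m ≫ C.dom := genericAssignment_toObj
  obtain ⟨X, ι, hι, hX⟩ := definable_isCompositeFamily (J := K.families) (X := D ⨯ K.W) p G
    prod.fst prod.snd
  refine Exists.elim (K.elim p (ι ≫ prod.fst) ?_ ?_) ?_
  · intro T d c hc
    have h : d ≫ p = (c ≫ K.triv) ≫ K.root := by rw [hc, Category.assoc, K.triv_root]
    have hob : (pullback.lift d (c ≫ K.triv) h ≫ G) ≫ K.ob = c := by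
      rw [Category.assoc, hG, pullback.lift_snd_assoc, Category.assoc, reassoc_of% K.triv_m,
        C.id_dom, Category.comp_id]
    obtain ⟨x, hx⟩ := (hX T (prod.lift d (pullback.lift d (c ≫ K.triv) h ≫ G))).1 (by
      simp only [prod.lift_fst, prod.lift_snd]
      refine ⟨?_, fun S s l hl => ?_⟩
      · change _ ≫ K.ob = d ≫ p ≫ K.ob
        rw [hob, reassoc_of% hc, K.leaf_ob, Category.comp_id]
      · have hl' : l ≫ K.root = s ≫ pullback.lift d (c ≫ K.triv) h ≫ G := hl
        have hcod : (l ≫ K.m) ≫ C.cod = s ≫ c := by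
          rw [Category.assoc, K.m_cod, reassoc_of% hl', ← Category.assoc _ G, hob]
        refine factorsThroughComposite_of_isComp (J := K.families) (i := (s ≫ c) ≫ K.triv) (j := l)
          (b := l ≫ K.m) (g := ((l ≫ K.m) ≫ C.dom) ≫ C.id) ?_ ?_ ?_ ?_
        · simp [hc, K.triv_root]
        · change l ≫ K.root = _ ≫ G
          rw [hl', ← Category.assoc]
          congr 1
          apply pullback.hom_ext <;> simp
        · exact K.triv_isComp _ hcod
        · exact isComp_id rfl)
    exact ⟨x, by rw [reassoc_of% hx, prod.lift_fst]⟩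
  · intro T d U t hn
    have ht := K.node_typed hn
    -- The leaf of the whole tree given by an index and a leaf of the subtree at this index.
    obtain ⟨l₀, hl₀, hc₀⟩ := K.exists_cons hn (pullback.fst t K.root ≫ pullback.fst U J.φ)
      (pullback.fst t K.root ≫ pullback.snd U J.φ) (by simp [pullback.condition])
      (pullback.snd t K.root) (by
        rw [← pullback.condition]
        congr 1
        apply pullback.hom_ext <;> simp)
    have hd : ((pullback.fst t K.root ≫ pullback.fst U J.φ) ≫ d) ≫ p = l₀ ≫ K.root := by
      rw [hl₀, Category.assoc]
    -- The restriction of the data to the subtrees.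
    obtain ⟨e, he, heG⟩ := exists_compositeData (J := K.families) t (pullback.lift _ _ hd ≫ G) (by
      change _ ≫ K.ob = pullback.snd _ _ ≫ K.m ≫ C.dom
      rw [Category.assoc, hG, pullback.lift_snd_assoc, ← Category.assoc l₀,
        isComp_dom (K.cons_comp hc₀), Category.assoc])
    refine ⟨e, he, fun S s y hy => ?_⟩
    have hQ := (hX _ (y ≫ ι)).2 ⟨y, rfl⟩
    obtain ⟨hob, hQ⟩ := hQ
    have hye : (y ≫ ι) ≫ prod.fst = pbMap J.φ s rfl ≫ e := by simpa using hy
    rw [hye] at hQ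
    obtain ⟨v, hv⟩ := K.exists_node (s ≫ U) ((y ≫ ι) ≫ prod.snd) (by
      refine hob.trans ?_
      change _ ≫ p ≫ K.ob = _
      have he' : e ≫ p = t := he
      rw [hye, Category.assoc, reassoc_of% he', ht, pbMap_snd_assoc])
    obtain ⟨x, hx⟩ := (hX S (prod.lift (s ≫ d) v)).1 (by
      simp only [prod.lift_fst, prod.lift_snd]
      refine ⟨?_, fun R r l hl => ?_⟩
      · change v ≫ K.ob = (s ≫ d) ≫ p ≫ K.ob
        rw [K.node_ob hv, Category.assoc, Category.assoc, ← K.node_ob hn, Category.assoc]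
      · obtain ⟨i, hi, l', hl', hc⟩ := K.cons_inv hv r l hl
        obtain ⟨R', q, l₁, j, g, b, h₁, hq, hj, hb, hg⟩ := hQ R _ l' hl'
        have h₂ : (q ≫ pullback.lift r i hi ≫ pbMap J.φ s rfl) ≫ t = l₁ ≫ K.root := by
          have he' : e ≫ p = t := he
          rw [← he', ← h₁]
          simp
        -- The index `i`, followed by the given path `l₁` of the subtree at `i`.
        let k := pullback.lift _ l₁ h₂
        have hk : k ≫ pullback.fst t K.root ≫ pullback.fst U J.φ = q ≫ r ≫ s := by simp [k]
        have hk' : k ≫ pullback.fst t K.root ≫ pullback.snd U J.φ = q ≫ i := by simp [k]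
        have hd' : (q ≫ r ≫ s ≫ d) ≫ p = (k ≫ l₀) ≫ K.root := by
          rw [Category.assoc k, ← hd, ← Category.assoc k, ← Category.assoc k, hk]
          simp
        have hkc := K.cons_comp (K.cons_restrict hc₀ k)
        rw [hk', show k ≫ pullback.snd t K.root = l₁ by simp [k]] at hkc
        have hlc := K.cons_comp (K.cons_restrict hc q)
        have hg' : C.IsComp b g ((q ≫ l') ≫ K.m) := by simpa using hg
        obtain ⟨b', hb'⟩ := exists_isComp (C := C) (g := (k ≫ l₀) ≫ K.m) (f := j ≫ K.m) (by
          rw [isComp_dom hkc]; exact hb.1)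
        refine ⟨R', q, k ≫ l₀, j, g, _, hd', hq, ?_, hb', ?_⟩
        · rw [hj]
          have e1 : k ≫ pullback.lift _ _ hd = pullback.lift _ _ hd' := by
            apply pullback.hom_ext
            · rw [Category.assoc, pullback.lift_fst, pullback.lift_fst, ← Category.assoc, hk]
              simp
            · simp
          have e2 : pullback.lift _ l₁ h₁ = k ≫ pbMap K.root e he := by
            apply pullback.hom_ext
            · exact (pullback.lift_fst _ _ _).trans ((show _ = k ≫ pullback.fst _ _ ≫ e by
                simp [k]).trans ((congrArg (k ≫ ·) (pbMap_fst K.root e he).symm).trans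
                  (Category.assoc _ _ _).symm))
            · exact (pullback.lift_snd _ _ _).trans ((show _ = k ≫ pullback.snd _ _ by
                simp [k]).trans ((congrArg (k ≫ ·) (pbMap_snd K.root e he).symm).trans
                  (Category.assoc _ _ _).symm))
          rw [← e1, Category.assoc, ← heG]
          exact (congrArg (· ≫ G) e2).trans (Category.assoc _ _ _)
        · simpa using (isComp_assoc ((isComp_assoc hkc hb).1 hb') hg').2 hlc)
    exact ⟨x, by rw [reassoc_of% hx, prod.lift_fst]⟩
  · rintro r hr
    have h := (hX D (r ≫ ι)).2 ⟨r, rfl⟩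
    refine ⟨r ≫ ι ≫ prod.snd, ?_⟩
    simpa [hr] using h

lemma conditionL : K.families.ConditionL := conditionL_of_strong K.strongConditionL

end Trees

/-! ### Sheaves -/

section Act

variable {E : Type u} [Category.{v} E] [HasPullbacks E] {C : InternalCategory E}
  {P : InternalPresheaf C} {T : E}

lemma isAct_restrict {x : T ⟶ P.P} {a : T ⟶ C.C₁} {y : T ⟶ P.P} (h : P.IsAct x a y) {S : E}
    (s : S ⟶ T) : P.IsAct (s ≫ x) (s ≫ a) (s ≫ y) := by
  obtain ⟨h, rfl⟩ := h
  have e : s ≫ pullback.lift x a h = pullback.lift (s ≫ x) (s ≫ a) (by simp [h]) := by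
    apply pullback.hom_ext <;> simp
  exact ⟨by simp [h], by rw [← e, Category.assoc]⟩

lemma exists_isAct {x : T ⟶ P.P} {a : T ⟶ C.C₁} (h : x ≫ P.toObj = a ≫ C.cod) :
    ∃ y, P.IsAct x a y := ⟨_, h, rfl⟩

lemma isAct_unique {x : T ⟶ P.P} {a : T ⟶ C.C₁} {y y' : T ⟶ P.P} (h : P.IsAct x a y)
    (h' : P.IsAct x a y') : y = y' := by
  obtain ⟨_, rfl⟩ := h
  obtain ⟨_, rfl⟩ := h'
  rfl

lemma isAct_toObj {x : T ⟶ P.P} {a : T ⟶ C.C₁} {y : T ⟶ P.P} (h : P.IsAct x a y) :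
    y ≫ P.toObj = a ≫ C.dom := by
  obtain ⟨h, rfl⟩ := h
  rw [Category.assoc, P.act_toObj, pullback.lift_snd_assoc]

lemma isAct_comp {x y z : T ⟶ P.P} {g f gf : T ⟶ C.C₁} (h1 : P.IsAct x g y)
    (h2 : C.IsComp g f gf) : P.IsAct y f z ↔ P.IsAct x gf z := by
  have d1 : y ≫ P.toObj = f ≫ C.cod := by rw [isAct_toObj h1, h2.1]
  have d2 : x ≫ P.toObj = gf ≫ C.cod := by rw [isComp_cod h2, h1.1]
  obtain ⟨e1, rfl⟩ := h1
  obtain ⟨e2, rfl⟩ := h2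
  have := P.act_comp x g f e1 e2 d1 d2
  exact ⟨fun ⟨_, e⟩ => ⟨d2, this.symm.trans e⟩, fun ⟨_, e⟩ => ⟨d1, this.trans e⟩⟩

lemma isAct_id {x : T ⟶ P.P} {c : T ⟶ C.C₀} (h : x ≫ P.toObj = c) : P.IsAct x (c ≫ C.id) x := by
  subst h
  have h : x ≫ P.toObj = ((x ≫ P.toObj) ≫ C.id) ≫ C.cod := by simp [C.id_cod]
  exact ⟨h, by simpa using P.act_id x (by simpa using h)⟩

end Act

section

variable {E : Type u} [Category.{v} E] [PiPretopos E] {C : InternalCategory E}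
  {P : InternalPresheaf C} {X : E}

lemma definable_isAct (x : X ⟶ P.P) (a : X ⟶ C.C₁) (y : X ⟶ P.P) :
    Definable (fun T (t : T ⟶ X) => P.IsAct (t ≫ x) (t ≫ a) (t ≫ y)) :=
  Definable.graph P.act x a y

/-- An equation between values of the action may be verified on a cover. -/
lemma isAct_of_cover {S T : E} {q : S ⟶ T} (hq : IsRegularEpi q) {x : T ⟶ P.P} {a : T ⟶ C.C₁}
    {y : T ⟶ P.P} (h : P.IsAct (q ≫ x) (q ≫ a) (q ≫ y)) : P.IsAct x a y := by
  have := (definable_isAct (P := P) (X := P.P ⨯ (C.C₁ ⨯ P.P)) prod.fst (prod.snd ≫ prod.fst)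
    (prod.snd ≫ prod.snd)).of_cover hq (t := prod.lift x (prod.lift a y)) (by simpa using h)
  simpa using this

/-- A sheaf is separated. -/
lemma eq_of_isSheaf {J : InternalSite C} (hP : J.IsSheaf P) {T : E} {U : T ⟶ J.Cov}
    {y y' : T ⟶ P.P} (hy : y ≫ P.toObj = U ≫ J.toObj) (hy' : y' ≫ P.toObj = U ≫ J.toObj)
    (H : ∀ (S : E) (s : S ⟶ T) (i : S ⟶ J.Idx) (z : S ⟶ P.P), i ≫ J.φ = s ≫ U →
      P.IsAct (s ≫ y) (i ≫ J.m) z → P.IsAct (s ≫ y') (i ≫ J.m) z) : y = y' := by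
  obtain ⟨x, hx⟩ := exists_isAct (P := P) (x := pullback.fst U J.φ ≫ y)
    (a := pullback.snd U J.φ ≫ J.m) (by
      rw [Category.assoc, hy, pullback.condition_assoc, Category.assoc, J.comm])
  have hcomp : J.IsCompatible P U x := by
    refine ⟨by rw [isAct_toObj hx, Category.assoc], fun S i i' g g' k hi h h' => ?_⟩
    have hi1 := isAct_restrict hx i
    have hi2 := isAct_restrict hx i'
    obtain ⟨z, hz⟩ := exists_isAct (P := P) (x := i ≫ x) (a := g) (by
      rw [isAct_toObj hi1, h.1])
    refine ⟨z, hz, (isAct_comp hi2 h').2 ?_⟩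
    have := (isAct_comp hi1 h).1 hz
    rwa [← Category.assoc, hi, Category.assoc] at this
  exact (hP T U x hcomp).unique ⟨hy, hx⟩ ⟨hy', H _ _ _ _ pullback.condition.symm hx⟩

end

section Amalgamation

variable {E : Type u} [Category.{v} E] [PiPretopos E] {C : InternalCategory E}
  {P : InternalPresheaf C} {W L : E} {φ : L ⟶ W} {m : L ⟶ C.C₁}
  {T₀ : E} {w₀ : T₀ ⟶ W} {x₀ : pullback w₀ φ ⟶ P.P} {S : E}

/-- The element `y` has the property which characterizes the restriction along `a` of an
amalgamation of the family `x₀` at `t`: whenever `a ∘ b = m(i) ∘ g`, its restriction along `b` is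
`x₀(i) · g`. -/
def IsPartialAmalgam (m : L ⟶ C.C₁) (x₀ : pullback w₀ φ ⟶ P.P)
    (t : S ⟶ T₀) (a : S ⟶ C.C₁) (y : S ⟶ P.P) : Prop :=
  y ≫ P.toObj = a ≫ C.dom ∧
    ∀ (R : E) (r : R ⟶ S) (i : R ⟶ pullback w₀ φ) (b g k : R ⟶ C.C₁) (z : R ⟶ P.P),
      i ≫ pullback.fst _ _ = r ≫ t → C.IsComp (r ≫ a) b k →
      C.IsComp (i ≫ pullback.snd _ _ ≫ m) g k → P.IsAct (i ≫ x₀) g z → P.IsAct (r ≫ y) b z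

lemma definable_isPartialAmalgam {X : E} (t : X ⟶ T₀) (a : X ⟶ C.C₁) (y : X ⟶ P.P) :
    Definable (fun T (x : T ⟶ X) => IsPartialAmalgam m x₀ (x ≫ t) (x ≫ a) (x ≫ y)) := by
  let i : X ⨯ (pullback w₀ φ ⨯ ((C.C₁ ⨯ (C.C₁ ⨯ C.C₁)) ⨯ P.P)) ⟶ _ := prod.snd ≫ prod.fst
  let b : X ⨯ (pullback w₀ φ ⨯ ((C.C₁ ⨯ (C.C₁ ⨯ C.C₁)) ⨯ P.P)) ⟶ _ :=
    prod.snd ≫ prod.snd ≫ prod.fst ≫ prod.fst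
  let g : X ⨯ (pullback w₀ φ ⨯ ((C.C₁ ⨯ (C.C₁ ⨯ C.C₁)) ⨯ P.P)) ⟶ _ :=
    prod.snd ≫ prod.snd ≫ prod.fst ≫ prod.snd ≫ prod.fst
  let k : X ⨯ (pullback w₀ φ ⨯ ((C.C₁ ⨯ (C.C₁ ⨯ C.C₁)) ⨯ P.P)) ⟶ _ :=
    prod.snd ≫ prod.snd ≫ prod.fst ≫ prod.snd ≫ prod.snd
  let z : X ⨯ (pullback w₀ φ ⨯ ((C.C₁ ⨯ (C.C₁ ⨯ C.C₁)) ⨯ P.P)) ⟶ _ :=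
    prod.snd ≫ prod.snd ≫ prod.snd
  refine ((Definable.eq (y ≫ P.toObj) (a ≫ C.dom)).and
    (Definable.all (X := X)
      ((Definable.eq (i ≫ pullback.fst _ _) (prod.fst ≫ t)).and
        ((definable_isComp (prod.fst ≫ a) b k).and
          ((definable_isComp (i ≫ pullback.snd _ _ ≫ m) g k).and
            (definable_isAct (i ≫ x₀) g z))))
      (definable_isAct (prod.fst ≫ y) b z))).congr fun T x => and_congr (by simp) ⟨?_, ?_⟩
  · intro H R r i' b' g' k' z' h1 h2 h3 h4
    simpa [b, z] using H R r (prod.lift i' (prod.lift (prod.lift b' (prod.lift g' k')) z'))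
      ⟨by simpa [i] using h1, by simpa [b, k] using h2, by simpa [i, g, k] using h3,
        by simpa [i, g, z] using h4⟩
  · rintro H R r u ⟨h1, h2, h3, h4⟩
    simpa [b, z] using H R r (u ≫ prod.fst) (u ≫ prod.snd ≫ prod.fst ≫ prod.fst)
      (u ≫ prod.snd ≫ prod.fst ≫ prod.snd ≫ prod.fst)
      (u ≫ prod.snd ≫ prod.fst ≫ prod.snd ≫ prod.snd) (u ≫ prod.snd ≫ prod.snd)
      (by simpa [i] using h1) (by simpa [b, k] using h2) (by simpa [i, g, k] using h3)
      (by simpa [i, g, z] using h4)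

variable {t : S ⟶ T₀} {a : S ⟶ C.C₁} {y : S ⟶ P.P}

lemma IsPartialAmalgam.restrict (h : IsPartialAmalgam m x₀ t a y) {R : E} (r : R ⟶ S) :
    IsPartialAmalgam m x₀ (r ≫ t) (r ≫ a) (r ≫ y) :=
  ⟨by rw [Category.assoc, h.1, Category.assoc], fun R' r' i b g k z h1 h2 h3 h4 => by
    simpa using h.2 R' (r' ≫ r) i b g k z (by simpa using h1) (by simpa using h2) h3 h4⟩

lemma IsPartialAmalgam.act (h : IsPartialAmalgam m x₀ t a y) {b k : S ⟶ C.C₁} {z : S ⟶ P.P}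
    (hk : C.IsComp a b k) (hz : P.IsAct y b z) : IsPartialAmalgam m x₀ t k z := by
  refine ⟨by rw [isAct_toObj hz, isComp_dom hk], fun R r i b' g k' u h1 h2 h3 h4 => ?_⟩
  have hk' := isComp_restrict hk r
  obtain ⟨c, hc⟩ := exists_isComp (C := C) (g := r ≫ b) (f := b') (by
    rw [← isComp_dom hk', h2.1])
  exact (isAct_comp (isAct_restrict hz r) hc).2
    (h.2 R r i c g k' u h1 ((isComp_assoc hk' hc).1 h2) h3 h4)

/-- Along an arrow `a` which factors as `m(i) ∘ g`, the element `x₀(i) · g` is a partial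
amalgamation.  By compatibility it does not depend on `i` and `g`, so it exists even if these exist
only locally. -/
lemma exists_isPartialAmalgam_of_factorsThrough {J : CoveringFamilies C} {w₀ : T₀ ⟶ J.Cov}
    {x₀ : pullback w₀ J.φ ⟶ P.P}
    (hx₀ : x₀ ≫ P.toObj = pullback.snd _ _ ≫ J.m ≫ C.dom)
    (hx : ∀ (R : E) (i i' : R ⟶ pullback w₀ J.φ) (g g' k : R ⟶ C.C₁) (z : R ⟶ P.P),
      i ≫ pullback.fst _ _ = i' ≫ pullback.fst _ _ → C.IsComp (i ≫ pullback.snd _ _ ≫ J.m) g k →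
      C.IsComp (i' ≫ pullback.snd _ _ ≫ J.m) g' k → P.IsAct (i ≫ x₀) g z → P.IsAct (i' ≫ x₀) g' z)
    (ha : J.FactorsThrough a (t ≫ w₀)) : ∃ y, IsPartialAmalgam J.m x₀ t a y := by
  obtain ⟨S', q, l, g, hq, hl, hg⟩ := ha
  have hl' : (q ≫ t) ≫ w₀ = l ≫ J.φ := by rw [Category.assoc]; exact hl.symm
  obtain ⟨i, hi, hi'⟩ : ∃ i : S' ⟶ pullback w₀ J.φ, i ≫ pullback.fst _ _ = q ≫ t ∧
      i ≫ pullback.snd _ _ ≫ J.m = l ≫ J.m := ⟨pullback.lift _ l hl', by simp, by simp⟩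
  have hg' : C.IsComp (i ≫ pullback.snd _ _ ≫ J.m) g (q ≫ a) := by rw [hi']; exact hg
  obtain ⟨z, hz⟩ := exists_isAct (P := P) (x := i ≫ x₀) (a := g) (by
    rw [Category.assoc, hx₀, ← hg'.1]; simp)
  obtain ⟨y, hy⟩ := exists_desc_of_cover hq (y := z) (fun R c d hcd => by
    have h1 := isComp_restrict hg' c
    have h2 := isComp_restrict hg' d
    rw [← Category.assoc c q, hcd, Category.assoc] at h1
    have := hx R (c ≫ i) (d ≫ i) (c ≫ g) (d ≫ g) _ (c ≫ z)
      (by rw [Category.assoc, Category.assoc, hi, reassoc_of% hcd]) (by simpa using h1)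
      (by simpa using h2) (by simpa using isAct_restrict hz c)
    exact isAct_unique this (by simpa using isAct_restrict hz d))
  refine ⟨y, ?_, fun R r i₁ b g₁ k z₁ h1 h2 h3 h4 => ?_⟩
  · rw [← cancel_epi q, reassoc_of% hy, isAct_toObj hz, ← Category.assoc, isComp_dom hg']
  · refine isAct_of_cover (isRegularEpi_pullback_fst r hq) ?_
    let π := pullback.snd r q
    have hπ : pullback.fst r q ≫ r = π ≫ q := pullback.condition
    have hz' := isAct_restrict hz π
    have hgπ := isComp_restrict hg' π
    have h2' := isComp_restrict h2 (pullback.fst r q)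
    rw [reassoc_of% hπ] at h2'
    obtain ⟨c, hc⟩ := exists_isComp (C := C) (g := π ≫ g) (f := pullback.fst r q ≫ b) (by
      rw [← isComp_dom hgπ, h2'.1])
    rw [reassoc_of% hπ, hy]
    refine (isAct_comp hz' hc).2 ?_
    have := hx _ (pullback.fst r q ≫ i₁) (π ≫ i) (pullback.fst r q ≫ g₁) c
      (pullback.fst r q ≫ k) (pullback.fst r q ≫ z₁)
      (by rw [Category.assoc, Category.assoc, hi, h1, reassoc_of% hπ])
      (by simpa using isComp_restrict h3 (pullback.fst r q))
      (by simpa using (isComp_assoc hgπ hc).1 h2')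
      (by simpa using isAct_restrict h4 (pullback.fst r q))
    simpa using this

end Amalgamation

namespace Trees

variable {E : Type u} [Category.{v} E] [PiPretopos E] {C : InternalCategory E}

section

variable {J : CoveringFamilies C} (K : Trees J)

/-- The one-level tree on a covering family `U`, with the same members as `U`. -/
lemma exists_single {T : E} (U : T ⟶ J.Cov) :
    ∃ (w : T ⟶ K.W) (α : pullback w K.root ⟶ pullback U J.φ)
      (β : pullback U J.φ ⟶ pullback w K.root), w ≫ K.ob = U ≫ J.toObj ∧
      α ≫ pullback.fst _ _ = pullback.fst _ _ ∧
      α ≫ pullback.snd _ _ ≫ J.m = pullback.snd _ _ ≫ K.m ∧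
      β ≫ pullback.fst _ _ = pullback.fst _ _ ∧
      β ≫ pullback.snd _ _ ≫ K.m = pullback.snd _ _ ≫ J.m ∧
      β ≫ α = 𝟙 _ := by
  have ht : ((pullback.snd U J.φ ≫ J.m ≫ C.dom) ≫ K.leaf) ≫ K.ob =
      pullback.snd U J.φ ≫ J.m ≫ C.dom := by rw [Category.assoc, K.leaf_ob, Category.comp_id]
  obtain ⟨w, hw⟩ := K.exists_node U _ ht
  obtain ⟨i, hi, l', hl', hc⟩ := K.cons_inv hw (pullback.fst w K.root) (pullback.snd w K.root)
    pullback.condition.symm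
  obtain ⟨l, hl, hc'⟩ := K.exists_cons hw (pullback.fst U J.φ) (pullback.snd U J.φ)
    pullback.condition ((pullback.snd U J.φ ≫ J.m ≫ C.dom) ≫ K.triv) (by
      rw [Category.assoc, K.triv_root]; simp)
  have e : i ≫ J.m = pullback.snd w K.root ≫ K.m := by
    have := K.cons_comp hc
    rw [K.eq_triv l' (i ≫ J.m ≫ C.dom) (by rw [hl']; simp), Category.assoc, K.triv_m] at this
    exact isComp_unique (isComp_id (by simp)) this
  have e' : l ≫ K.m = pullback.snd U J.φ ≫ J.m := by
    have := K.cons_comp hc'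
    rw [Category.assoc, K.triv_m] at this
    exact isComp_unique this (isComp_id (by simp))
  refine ⟨w, pullback.lift (pullback.fst _ _) i hi, pullback.lift (pullback.fst _ _) l hl.symm,
    K.node_ob hw, by simp, by simpa using e, by simp, by simpa using e', ?_⟩
  have h := (K.cons_unique (K.cons_restrict hc (pullback.lift (pullback.fst U J.φ) l hl.symm))
    (by simpa using hc')).1
  apply pullback.hom_ext <;> simp [h]

end

variable {J : InternalSite C} (K : Trees J.toCoveringFamilies) {P : InternalPresheaf C}

/-- The sheaf condition for one-level trees is the sheaf condition for `J`. -/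
lemma isSheaf_of_isSheaf_families (hC : K.families.ConditionC)
    (hP : InternalSite.IsSheaf ⟨K.families, hC⟩ P) : J.IsSheaf P := by
  intro T U x hx
  obtain ⟨w, α, β, hw, hα, hα', hβ, hβ', e⟩ := K.exists_single U
  have key : ∀ y : T ⟶ P.P, P.IsAct (pullback.fst U J.φ ≫ y) (pullback.snd U J.φ ≫ J.m) x ↔
      P.IsAct (pullback.fst w K.root ≫ y) (pullback.snd w K.root ≫ K.m) (α ≫ x) := fun y => by
    constructor
    · intro h
      have := isAct_restrict h α
      rwa [hα', ← Category.assoc, hα] at this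
    · intro h
      have := isAct_restrict h β
      rwa [hβ', ← Category.assoc, hβ, reassoc_of% e] at this
  refine ((existsUnique_congr fun y => and_congr (by
    change _ ↔ y ≫ P.toObj = w ≫ K.ob
    rw [hw]) (key y)).2 (hP T w (α ≫ x) ⟨?_, ?_⟩))
  · change _ = pullback.snd w K.root ≫ K.m ≫ C.dom
    rw [Category.assoc, hx.1, ← reassoc_of% hα']
  · intro S i i' g g' k hi h h'
    have := hx.2 S (i ≫ α) (i' ≫ α) g g' k (by simpa [hα] using hi) (by simpa [hα'] using h)
      (by simpa [hα'] using h')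
    simpa using this

/-- The elements `y` and `y'` over the root of the tree `w` have the same restrictions along all
paths of `w`. -/
def Agree (P : InternalPresheaf C) {T : E} (w : T ⟶ K.W) (y y' : T ⟶ P.P) : Prop :=
  (y ≫ P.toObj = w ≫ K.ob ∧ y' ≫ P.toObj = w ≫ K.ob) ∧
    ∀ (S : E) (s : S ⟶ T) (l : S ⟶ K.L) (z : S ⟶ P.P), l ≫ K.root = s ≫ w →
      P.IsAct (s ≫ y) (l ≫ K.m) z → P.IsAct (s ≫ y') (l ≫ K.m) z

lemma definable_agree {X : E} (w : X ⟶ K.W) (y y' : X ⟶ P.P) :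
    Definable (fun T (x : T ⟶ X) => K.Agree P (x ≫ w) (x ≫ y) (x ≫ y')) := by
  refine (((Definable.eq (y ≫ P.toObj) (w ≫ K.ob)).and
    (Definable.eq (y' ≫ P.toObj) (w ≫ K.ob))).and
    (Definable.all (X := X) (Z := K.L ⨯ P.P)
      ((Definable.eq (prod.snd ≫ prod.fst ≫ K.root) (prod.fst ≫ w)).and
        (definable_isAct (prod.fst ≫ y) (prod.snd ≫ prod.fst ≫ K.m) (prod.snd ≫ prod.snd)))
      (definable_isAct (prod.fst ≫ y') (prod.snd ≫ prod.fst ≫ K.m)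
        (prod.snd ≫ prod.snd)))).congr fun T x => and_congr (by simp) ⟨?_, ?_⟩
  · intro H S s l z h1 h2
    simpa using H S s (prod.lift l z) ⟨by simpa using h1, by simpa using h2⟩
  · rintro H S s z ⟨h1, h2⟩
    simpa using H S s (z ≫ prod.fst) (z ≫ prod.snd) (by simpa using h1) (by simpa using h2)

/-- A sheaf for `J` is separated for the trees over `J`. -/
lemma eq_of_agree (hP : J.IsSheaf P) {T : E} {w : T ⟶ K.W} {y y' : T ⟶ P.P}
    (H : K.Agree P w y y') : y = y' := by
  have hQ := Definable.all (X := K.W) (Z := P.P ⨯ P.P)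
    (K.definable_agree (P := P) prod.fst (prod.snd ≫ prod.fst) (prod.snd ≫ prod.snd))
    (Definable.eq (prod.snd ≫ prod.fst) (prod.snd ≫ prod.snd))
  have hQ' := hQ.congr (Q := fun T w => ∀ (S : E) (s : S ⟶ T) (y y' : S ⟶ P.P),
      K.Agree P (s ≫ w) y y' → y = y') fun T w =>
    ⟨fun H S s y y' h => by simpa using H S s (prod.lift y y') (by simpa using h),
      fun H S s z h => by
        simpa using H S s (z ≫ prod.fst) (z ≫ prod.snd) (by simpa using h)⟩
  have key := K.induction hQ' ?_ ?_ T w T (𝟙 T) y y' (by simpa using H)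
  · exact key
  · rintro T c S s y y' ⟨⟨h1, h2⟩, H⟩
    rw [Category.assoc, Category.assoc, K.leaf_ob, Category.comp_id] at h1 h2
    have := H S (𝟙 S) ((s ≫ c) ≫ K.triv) y (by simp [K.triv_root])
      (by rw [Category.id_comp, Category.assoc, K.triv_m]; exact isAct_id h1)
    rw [Category.id_comp, Category.assoc, K.triv_m] at this
    exact isAct_unique this (isAct_id h2)
  · rintro T w U t hn IH S s y y' ⟨⟨h1, h2⟩, H⟩
    have hob : (s ≫ w) ≫ K.ob = (s ≫ U) ≫ J.toObj := by simp [K.node_ob hn]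
    refine eq_of_isSheaf hP (h1.trans hob) (h2.trans hob) fun R r i z hi hz => ?_
    obtain ⟨z', hz'⟩ := exists_isAct (P := P) (x := r ≫ y') (a := i ≫ J.m) (by
      rw [Category.assoc, h2, hob, ← Category.assoc, ← hi, Category.assoc, Category.assoc, J.comm])
    have hi' : (r ≫ s) ≫ U = i ≫ J.φ := by rw [hi, Category.assoc]
    have ht : (pullback.lift (r ≫ s) i hi' ≫ t) ≫ K.ob = (i ≫ J.m) ≫ C.dom := by
      rw [Category.assoc, K.node_typed hn, pullback.lift_snd_assoc, Category.assoc]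
    have e : z = z' := by
      refine IH R (pullback.lift (r ≫ s) i hi') z z'
        ⟨⟨(isAct_toObj hz).trans ht.symm, (isAct_toObj hz').trans ht.symm⟩,
          fun R' r' l' u hl' hu => ?_⟩
      obtain ⟨l, hl, hc⟩ := K.exists_cons hn (r' ≫ r ≫ s) (r' ≫ i) (by simpa using r' ≫= hi') l' (by
        rw [hl', ← Category.assoc]
        congr 1
        apply pullback.hom_ext <;> simp)
      have hcm := K.cons_comp hc
      rw [Category.assoc] at hcm
      refine (isAct_comp (isAct_restrict hz' r') hcm).2 ?_
      have := H R' (r' ≫ r) l u (by simpa using hl)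
      rw [Category.assoc, Category.assoc] at this
      exact this ((isAct_comp (isAct_restrict hz r') hcm).1 hu)
    exact e ▸ hz'

section Amalgamation

variable {T₀ : E} {w₀ : T₀ ⟶ K.W} {x₀ : pullback w₀ K.root ⟶ P.P} {S : E}

variable {K} {t : S ⟶ T₀} {a : S ⟶ C.C₁} {y : S ⟶ P.P}

/-- Any two partial amalgamations along `a` agree on the leaves of a pullback along `a` of the tree
`w₀`, and sheaves are separated for trees. -/
lemma isPartialAmalgam_unique (hP : J.IsSheaf P) (hC : K.families.ConditionC)
    (hx₀ : x₀ ≫ P.toObj = pullback.snd _ _ ≫ K.m ≫ C.dom)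
    (ha : a ≫ C.cod = (t ≫ w₀) ≫ K.ob) (h : IsPartialAmalgam K.m x₀ t a y) {y' : S ⟶ P.P}
    (h' : IsPartialAmalgam K.m x₀ t a y') : y = y' := by
  obtain ⟨S', p, V, hp, hV, hf⟩ := hC S a (t ≫ w₀) ha
  have hV' : V ≫ K.ob = (p ≫ a) ≫ C.dom := hV
  rw [← cancel_epi p]
  refine K.eq_of_agree hP (w := V) ⟨⟨?_, ?_⟩, fun R s l z hl hz => ?_⟩
  · rw [hV', Category.assoc, h.1, Category.assoc]
  · rw [hV', Category.assoc, h'.1, Category.assoc]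
  obtain ⟨k, hk⟩ := exists_isComp (C := C) (g := s ≫ p ≫ a) (f := l ≫ K.m) (by
    rw [Category.assoc, ← hV', Category.assoc, K.m_cod, reassoc_of% hl])
  obtain ⟨R', q, i, g, hq, hi, hg⟩ := hf R s l k hl hk
  have hi' : (q ≫ s ≫ p ≫ t) ≫ w₀ = i ≫ K.root := by simpa using hi.symm
  obtain ⟨u, hu⟩ := exists_isAct (P := P) (x := pullback.lift _ i hi' ≫ x₀) (a := g) (by
    rw [Category.assoc, hx₀, pullback.lift_snd_assoc, ← hg.1, Category.assoc])
  have hk' := isComp_restrict hk q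
  have key : ∀ y' : S ⟶ P.P, IsPartialAmalgam K.m x₀ t a y' →
      P.IsAct (q ≫ s ≫ p ≫ y') (q ≫ l ≫ K.m) u := fun y' h' => by
    simpa using h'.2 R' (q ≫ s ≫ p) (pullback.lift _ i hi') _ g _ u (by simp) (by simpa using hk')
      (by simpa using hg) hu
  refine isAct_of_cover hq ?_
  rw [isAct_unique (isAct_restrict hz q) (key y h)]
  exact key y' h'

/-- Partial amalgamations along the composites `a ∘ m(j)`, for `m(j)` in a covering family of `J`,
are compatible by uniqueness, and their amalgamation is a partial amalgamation along `a`. -/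
lemma exists_isPartialAmalgam_of_cover (hP : J.IsSheaf P) (hC : K.families.ConditionC)
    (hx₀ : x₀ ≫ P.toObj = pullback.snd _ _ ≫ K.m ≫ C.dom)
    (ha : a ≫ C.cod = (t ≫ w₀) ≫ K.ob) {U : S ⟶ J.Cov} (hU : U ≫ J.toObj = a ≫ C.dom)
    {am : pullback U J.φ ⟶ C.C₁} {y : pullback U J.φ ⟶ P.P}
    (ham : C.IsComp (pullback.fst _ _ ≫ a) (pullback.snd _ _ ≫ J.m) am)
    (hy : IsPartialAmalgam K.m x₀ (pullback.fst _ _ ≫ t) am y) :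
    ∃ y, IsPartialAmalgam K.m x₀ t a y := by
  have hcompat : J.IsCompatible P U y := by
    refine ⟨by rw [hy.1, isComp_dom ham, Category.assoc], fun R j j' g g' k hj h h' => ?_⟩
    have hjm := isComp_restrict ham j
    have hjm' := isComp_restrict ham j'
    obtain ⟨z, hz⟩ := exists_isAct (P := P) (x := j ≫ y) (a := g) (by
      rw [Category.assoc, hy.1, ← Category.assoc, isComp_dom hjm, h.1])
    obtain ⟨z', hz'⟩ := exists_isAct (P := P) (x := j' ≫ y) (a := g') (by
      rw [Category.assoc, hy.1, ← Category.assoc, isComp_dom hjm', h'.1])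
    obtain ⟨κ, hκ⟩ := exists_isComp (C := C) (g := j ≫ pullback.fst U J.φ ≫ a) (f := k) (by
      rw [hjm.1, isComp_cod h])
    have hκ' := hκ
    rw [reassoc_of% hj] at hκ'
    have a1 := (hy.restrict j).act ((isComp_assoc hjm h).2 hκ) hz
    have a2 := (hy.restrict j').act ((isComp_assoc hjm' h').2 hκ') hz'
    rw [← reassoc_of% hj] at a2
    obtain rfl := isPartialAmalgam_unique hP hC hx₀ (by
      rw [isComp_cod hκ, Category.assoc, Category.assoc, ha]; simp) a1 a2
    exact ⟨z, hz, hz'⟩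
  obtain ⟨Y, ⟨hY, hYa⟩, -⟩ := hP S U y hcompat
  refine ⟨Y, by rw [hY, hU], fun R r i b g k z h1 h2 h3 h4 => ?_⟩
  have hbU : b ≫ C.cod = (r ≫ U) ≫ J.toObj := by
    rw [← h2.1, Category.assoc, Category.assoc, hU]
  obtain ⟨z', hz'⟩ := exists_isAct (P := P) (x := r ≫ Y) (a := b) (by
    rw [hbU, Category.assoc, Category.assoc, hY])
  suffices e : z = z' from e ▸ hz'
  obtain ⟨R', p, V, hp, hV, hf⟩ := J.conditionC R b (r ≫ U) hbU
  rw [← cancel_epi p]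
  refine PredicativeSite.eq_of_isSheaf hP (U := V) ?_ ?_ fun S' s j u hj hu => ?_
  · rw [hV, Category.assoc, isAct_toObj h4, ← isComp_dom h3, isComp_dom h2, Category.assoc]
  · rw [hV, Category.assoc, isAct_toObj hz', Category.assoc]
  have hcod : (s ≫ p ≫ b) ≫ C.dom = (j ≫ J.m) ≫ C.cod := by
    rw [Category.assoc, ← hV, Category.assoc, J.comm, reassoc_of% hj]
  obtain ⟨c, hc⟩ := exists_isComp (C := C) hcod
  obtain ⟨Q, q, i', h, hq, hi', hh⟩ := hf S' s j c hj hc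
  refine isAct_of_cover hq ?_
  have hcq := isComp_restrict hc q
  have hz'q := isAct_restrict hz' (q ≫ s ≫ p)
  simp only [Category.assoc] at hz'q hcq
  refine (isAct_comp hz'q hcq).2 ?_
  -- The arrow `b ∘ m(j)` factors through the member `i'` of `U`.
  have hw : (q ≫ s ≫ p ≫ r) ≫ U = i' ≫ J.φ := by simpa using hi'.symm
  have hYe := isAct_restrict hYa (pullback.lift _ i' hw)
  have ham' := isComp_restrict ham (pullback.lift _ i' hw)
  simp only [Category.assoc, pullback.lift_fst_assoc, pullback.lift_snd_assoc] at hYe ham'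
  refine (isAct_comp hYe hh).1 ?_
  have h2q := isComp_restrict h2 (q ≫ s ≫ p)
  have h3q := isComp_restrict h3 (q ≫ s ≫ p)
  have h4q := isAct_restrict h4 (q ≫ s ≫ p)
  have huq := isAct_restrict hu q
  simp only [Category.assoc] at h2q h3q h4q huq
  obtain ⟨κ, hκ⟩ := exists_isComp (C := C) (g := q ≫ s ≫ p ≫ k) (f := q ≫ j ≫ J.m) (by
    rw [isComp_dom h2q, hcq.1])
  obtain ⟨g', hg'⟩ := exists_isComp (C := C) (g := q ≫ s ≫ p ≫ g) (f := q ≫ j ≫ J.m) (by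
    rw [← isComp_dom h3q, hκ.1])
  refine hy.2 Q (pullback.lift _ i' hw) (q ≫ s ≫ p ≫ i) h g' κ (q ≫ u) (by simp [h1]) ?_ ?_ ?_
  · exact (isComp_assoc ham' hh).2 ((isComp_assoc h2q hcq).1 hκ)
  · simpa using (isComp_assoc h3q hg').1 hκ
  · simpa using (isAct_comp h4q hg').1 huq

end Amalgamation

/-- A compatible family on the leaves of a tree `w₀` is amalgamated by recursion on trees.  The
recursion constructs partial amalgamations along all arrows `a`, given a pullback `v` of `w₀` along
`a`, and it runs over the tree `v`.  If `v` is a bare leaf then `a` factors through a member of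
`w₀`; if `v` is given by `U` and `t`, then `t(j)` is a pullback of `w₀` along `a ∘ m(j)`.  The
amalgamation itself is the case of the identity and `v = w₀`. -/
theorem isSheaf_families_of_isSheaf (hC : K.families.ConditionC) (hP : J.IsSheaf P) :
    InternalSite.IsSheaf ⟨K.families, hC⟩ P := by
  rintro T₀ w₀ x₀ ⟨hx₀, hx⟩
  replace hx₀ : x₀ ≫ P.toObj = pullback.snd _ _ ≫ K.m ≫ C.dom := hx₀
  have hx' : ∀ (R : E) (i i' : R ⟶ pullback w₀ K.root) (g g' k : R ⟶ C.C₁) (z : R ⟶ P.P),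
      i ≫ pullback.fst _ _ = i' ≫ pullback.fst _ _ → C.IsComp (i ≫ pullback.snd _ _ ≫ K.m) g k →
      C.IsComp (i' ≫ pullback.snd _ _ ≫ K.m) g' k → P.IsAct (i ≫ x₀) g z →
      P.IsAct (i' ≫ x₀) g' z := fun R i i' g g' k z h1 h2 h3 h4 => by
    obtain ⟨z', h5, h6⟩ := hx R i i' g g' k h1 h2 h3
    exact isAct_unique h4 h5 ▸ h6
  -- The object of triples of a tree `v`, a point `t` of the stage and an arrow `a` such that `v` is
  -- a pullback of `w₀` along `a` at `t`.
  obtain ⟨D, ι, hι, hD⟩ := (definable_isPullbackFamily (J := K.families)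
    (X := K.W ⨯ (T₀ ⨯ C.C₁)) prod.fst (prod.snd ≫ prod.snd) ((prod.snd ≫ prod.fst) ≫ w₀)).and
      (Definable.eq (prod.snd ≫ prod.snd ≫ C.cod) ((prod.snd ≫ prod.fst) ≫ w₀ ≫ K.ob))
  let p := ι ≫ prod.fst
  let st := ι ≫ prod.snd ≫ prod.fst
  let ar := ι ≫ prod.snd ≫ prod.snd
  have hD1 : ∀ {S : E} (d : S ⟶ D), K.families.IsPullbackFamily (d ≫ p) (d ≫ ar) ((d ≫ st) ≫ w₀) ∧
      (d ≫ ar) ≫ C.cod = ((d ≫ st) ≫ w₀) ≫ K.ob := fun {S} d => by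
    simpa [p, st, ar] using (hD S (d ≫ ι)).2 ⟨d, rfl⟩
  have hD2 : ∀ {S : E} (v : S ⟶ K.W) (t : S ⟶ T₀) (a : S ⟶ C.C₁),
      K.families.IsPullbackFamily v a (t ≫ w₀) → a ≫ C.cod = (t ≫ w₀) ≫ K.ob →
      ∃ d : S ⟶ D, d ≫ p = v ∧ d ≫ st = t ∧ d ≫ ar = a := fun {S} v t a h h' => by
    obtain ⟨d, hd⟩ := (hD S (prod.lift v (prod.lift t a))).1
      ⟨by simpa using h, by simpa using h'⟩
    exact ⟨d, by simp [p, reassoc_of% hd], by simp [st, reassoc_of% hd],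
      by simp [ar, reassoc_of% hd]⟩
  obtain ⟨X, κ, hκ, hX⟩ := definable_isPartialAmalgam (m := K.m) (P := P) (x₀ := x₀) (X := D ⨯ P.P)
    (prod.fst ≫ st) (prod.fst ≫ ar) prod.snd
  have hX1 : ∀ (S : E) (d : S ⟶ D), (∃ y, IsPartialAmalgam K.m x₀ (d ≫ st) (d ≫ ar) y) →
      ∃ x : S ⟶ X, x ≫ κ ≫ prod.fst = d := by
    rintro S d ⟨y, hy⟩
    obtain ⟨x, hx⟩ := (hX S (prod.lift d y)).1 (by simpa using hy)
    exact ⟨x, by rw [reassoc_of% hx, prod.lift_fst]⟩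
  refine Exists.elim (K.elim p (κ ≫ prod.fst) ?_ ?_) ?_
  · intro T d c hd
    refine hX1 T d (exists_isPartialAmalgam_of_factorsThrough (J := K.families) hx₀ hx' ?_)
    obtain ⟨⟨h1, h2⟩, -⟩ := hD1 d
    have h1' : (d ≫ p) ≫ K.ob = (d ≫ ar) ≫ C.dom := h1
    rw [hd, Category.assoc, K.leaf_ob, Category.comp_id] at h1'
    have h3 : (c ≫ K.triv) ≫ K.root = 𝟙 T ≫ d ≫ p := by
      rw [hd, Category.id_comp, Category.assoc, K.triv_root]
    have h4 : C.IsComp (𝟙 T ≫ d ≫ ar) ((c ≫ K.triv) ≫ K.m) (d ≫ ar) := by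
      rw [Category.id_comp, Category.assoc, K.triv_m]
      exact isComp_id h1'.symm
    simpa using h2 T (𝟙 T) (c ≫ K.triv) (d ≫ ar) h3 h4
  · intro T d U t hn
    obtain ⟨⟨h1, h2⟩, h3⟩ := hD1 d
    have h1' : U ≫ J.toObj = (d ≫ ar) ≫ C.dom := (K.node_ob hn).symm.trans h1
    obtain ⟨am, ham⟩ := exists_isComp (C := C) (g := pullback.fst U J.φ ≫ d ≫ ar)
      (f := pullback.snd U J.φ ≫ J.m) (by
        rw [Category.assoc, ← h1', pullback.condition_assoc, Category.assoc, J.comm])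
    -- The subtree `t(j)` is a pullback of `w₀` along `a ∘ m(j)`.
    obtain ⟨e, he, he', he''⟩ := hD2 t (pullback.fst U J.φ ≫ d ≫ st) am
      ⟨by
        change t ≫ K.ob = am ≫ C.dom
        rw [K.node_typed hn, isComp_dom ham, Category.assoc], fun S s j k hj hk => by
        obtain ⟨l, hl, hc⟩ := K.exists_cons hn (s ≫ pullback.fst _ _) (s ≫ pullback.snd _ _)
          (by simp [pullback.condition]) j (by
            refine Eq.trans hj ?_
            congr 1
            apply pullback.hom_ext <;> simp)
        have hcm := K.cons_comp hc
        rw [Category.assoc] at hcm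
        have := h2 S (s ≫ pullback.fst _ _) l k hl
          ((Category.assoc s _ _).symm ▸ (isComp_assoc (isComp_restrict ham s) hcm).1 hk)
        simpa using this⟩
      (by rw [isComp_cod ham, Category.assoc, h3]; simp)
    refine ⟨e, he, fun S s y hy => hX1 S (s ≫ d) ?_⟩
    have hy' : (y ≫ κ) ≫ prod.fst = pbMap J.φ s rfl ≫ e := by simpa using hy
    have hYi := (hX _ (y ≫ κ)).2 ⟨y, rfl⟩
    refine exists_isPartialAmalgam_of_cover hP hC hx₀ (U := s ≫ U) (am := pbMap J.φ s rfl ≫ am)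
      (y := (y ≫ κ) ≫ prod.snd) ?_ ?_ ?_ ?_
    · simpa using s ≫= h3
    · simpa using s ≫= h1'
    · simpa using isComp_restrict ham (pbMap J.φ s rfl)
    · simpa [reassoc_of% hy', he', he''] using hYi
  · intro r hr
    obtain ⟨d, hd, hd', hd''⟩ := hD2 w₀ (𝟙 T₀) ((w₀ ≫ K.ob) ≫ C.id)
      ⟨by
        change w₀ ≫ K.ob = ((w₀ ≫ K.ob) ≫ C.id) ≫ C.dom
        rw [Category.assoc, C.id_dom, Category.comp_id], fun S s j k hj hk => by
        obtain rfl : k = j ≫ K.m := by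
          refine isComp_unique hk ?_
          rw [← Category.assoc]
          refine isComp_id_left ?_
          change (j ≫ K.m) ≫ C.cod = _
          have hj' : j ≫ K.root = s ≫ w₀ := hj
          rw [Category.assoc, K.m_cod, reassoc_of% hj']
        exact factorsThrough_of_isComp (J := K.families) (i := j) (by simpa using hj)
          (isComp_id rfl)⟩
      (by simp [C.id_cod])
    have hy := (hX _ ((d ≫ r) ≫ κ)).2 ⟨_, rfl⟩
    have hr' : ((d ≫ r) ≫ κ) ≫ prod.fst = d := by simp [hr]
    have hy' : IsPartialAmalgam K.m x₀ (𝟙 T₀) ((w₀ ≫ K.ob) ≫ C.id) (((d ≫ r) ≫ κ) ≫ prod.snd) := by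
      have e : ((d ≫ r) ≫ κ) ≫ prod.fst ≫ st = 𝟙 T₀ := by rw [← Category.assoc, hr', hd']
      have e' : ((d ≫ r) ≫ κ) ≫ prod.fst ≫ ar = (w₀ ≫ K.ob) ≫ C.id := by
        rw [← Category.assoc, hr', hd'']
      beta_reduce at hy
      rwa [e, e'] at hy
    have hob : (((d ≫ r) ≫ κ) ≫ prod.snd) ≫ P.toObj = w₀ ≫ K.ob := by
      rw [hy'.1]
      simp [C.id_dom]
    have hact : P.IsAct (pullback.fst w₀ K.root ≫ ((d ≫ r) ≫ κ) ≫ prod.snd)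
        (pullback.snd w₀ K.root ≫ K.m) x₀ := by
      refine hy'.2 _ (pullback.fst _ _) (𝟙 _) (pullback.snd _ _ ≫ K.m) ((x₀ ≫ P.toObj) ≫ C.id)
        (pullback.snd _ _ ≫ K.m) x₀ (by simp) ?_ ?_ (by
          rw [Category.id_comp]
          exact isAct_id rfl)
      · rw [← Category.assoc]
        exact isComp_id_left (by rw [Category.assoc, K.m_cod, pullback.condition_assoc])
      · rw [Category.id_comp, hx₀]
        exact isComp_id (Category.assoc _ _ _)
    refine ⟨((d ≫ r) ≫ κ) ≫ prod.snd, ⟨hob, hact⟩, fun y ⟨h1, h2⟩ =>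
      K.eq_of_agree hP (w := w₀) ⟨⟨h1, hob⟩, fun S s l z hl hz => ?_⟩⟩
    have h2' : P.IsAct (pullback.fst w₀ K.root ≫ y) (pullback.snd w₀ K.root ≫ K.m) x₀ := h2
    have e1 := isAct_restrict h2' (pullback.lift s l hl.symm)
    have e2 := isAct_restrict hact (pullback.lift s l hl.symm)
    rw [pullback.lift_fst_assoc, pullback.lift_snd_assoc] at e1 e2
    exact isAct_unique e1 hz ▸ e2

theorem equivalent (hC : K.families.ConditionC) : J.Equivalent ⟨K.families, hC⟩ := fun _ =>
  ⟨K.isSheaf_families_of_isSheaf hC, K.isSheaf_of_isSheaf_families hC⟩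

end Trees

/-! ### The sieves generated by covering families -/

variable {E : Type u} [Category.{v} E] [PiPretopos E] {C : InternalCategory E}

section Sieve

variable {J : CoveringFamilies C} {S T : E}

lemma factorsThrough_restrict {a : T ⟶ C.C₁} {U : T ⟶ J.Cov} (h : J.FactorsThrough a U)
    (s : S ⟶ T) : J.FactorsThrough (s ≫ a) (s ≫ U) := by
  have := (definable_factorsThrough (J := J) (X := C.C₁ ⨯ J.Cov) prod.fst prod.snd).stable s
    (t := prod.lift a U) (by simpa using h)
  simpa using this

lemma factorsThrough_of_cover {q : S ⟶ T} (hq : IsRegularEpi q) {a : T ⟶ C.C₁} {U : T ⟶ J.Cov}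
    (h : J.FactorsThrough (q ≫ a) (q ≫ U)) : J.FactorsThrough a U := by
  have := (definable_factorsThrough (J := J) (X := C.C₁ ⨯ J.Cov) prod.fst prod.snd).of_cover hq
    (t := prod.lift a U) (by simpa using h)
  simpa using this

lemma factorsThrough_comp {a b g : T ⟶ C.C₁} {U : T ⟶ J.Cov} (h : J.FactorsThrough a U)
    (hb : C.IsComp a g b) : J.FactorsThrough b U := by
  obtain ⟨R, q, i, f, hq, hi, hf⟩ := h
  have hbq := isComp_restrict hb q
  obtain ⟨c, hc⟩ := exists_isComp (C := C) (g := f) (f := q ≫ g) (by rw [← isComp_dom hf, hbq.1])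
  exact ⟨R, q, i, c, hq, hi, (isComp_assoc hf hc).1 hbq⟩

lemma factorsThrough_cod {a : T ⟶ C.C₁} {U : T ⟶ J.Cov} (h : J.FactorsThrough a U) :
    a ≫ C.cod = U ≫ J.toObj := by
  obtain ⟨R, q, i, f, hq, hi, hf⟩ := h
  rw [← cancel_epi q, ← Category.assoc, isComp_cod hf, Category.assoc, J.comm, reassoc_of% hi]

variable (J)

/-- Factoring through a member of a covering family is a definable predicate; the object
representing it serves as the index object of the generated sieves. -/
lemma exists_sieveFamilies : ∃ (I : E) (φ : I ⟶ J.Cov) (m : I ⟶ C.C₁), m ≫ C.cod = φ ≫ J.toObj ∧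
    (∀ (T : E) (U : T ⟶ J.Cov) (a : T ⟶ C.C₁),
      J.FactorsThrough a U ↔ ∃ i : T ⟶ I, i ≫ φ = U ∧ i ≫ m = a) := by
  obtain ⟨I, ι, hι, hI⟩ := definable_factorsThrough (J := J) (X := J.Cov ⨯ C.C₁) prod.snd prod.fst
  have key : ∀ (T : E) (U : T ⟶ J.Cov) (a : T ⟶ C.C₁),
      J.FactorsThrough a U ↔ ∃ i : T ⟶ I, i ≫ ι ≫ prod.fst = U ∧ i ≫ ι ≫ prod.snd = a := by
    intro T U a
    have := hI T (prod.lift U a)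
    simp only [prod.lift_fst, prod.lift_snd] at this
    refine this.trans (exists_congr fun i => ⟨fun h => ?_, fun h => ?_⟩)
    · simp [reassoc_of% h]
    · apply Limits.prod.hom_ext <;> simp [h]
  exact ⟨I, ι ≫ prod.fst, ι ≫ prod.snd,
    factorsThrough_cod ((key _ _ _).2 ⟨𝟙 _, Category.id_comp _, Category.id_comp _⟩), key⟩

/-- The covering families of `J`, closed under precomposition: the family indexed by `U` consists of
all arrows which factor through a member of the original family indexed by `U`. -/
def sieveFamilies : CoveringFamilies C where
  Cov := J.Cov
  Idx := (exists_sieveFamilies J).choose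
  toObj := J.toObj
  φ := (exists_sieveFamilies J).choose_spec.choose
  m := (exists_sieveFamilies J).choose_spec.choose_spec.choose
  comm := (exists_sieveFamilies J).choose_spec.choose_spec.choose_spec.1

variable {J}

lemma factorsThrough_iff_exists_idx {U : T ⟶ J.Cov} {a : T ⟶ C.C₁} :
    J.FactorsThrough a U ↔
      ∃ i : T ⟶ (sieveFamilies J).Idx, i ≫ (sieveFamilies J).φ = U ∧ i ≫ (sieveFamilies J).m = a :=
  (exists_sieveFamilies J).choose_spec.choose_spec.choose_spec.2 T U a

lemma sieveFamilies_factorsThrough {U : T ⟶ J.Cov} {a : T ⟶ C.C₁} :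
    (sieveFamilies J).FactorsThrough a U ↔ J.FactorsThrough a U := by
  constructor
  · rintro ⟨R, q, i, g, hq, hi, hg⟩
    exact factorsThrough_of_cover hq
      (factorsThrough_comp (factorsThrough_iff_exists_idx.2 ⟨i, hi, rfl⟩) hg)
  · intro h
    obtain ⟨i, hi, rfl⟩ := factorsThrough_iff_exists_idx.1 h
    exact factorsThrough_of_isComp (J := sieveFamilies J) hi (isComp_id rfl)

lemma sieveFamilies_isPullbackFamily {V U : T ⟶ J.Cov} {f : T ⟶ C.C₁}
    (h : J.IsPullbackFamily V f U) : (sieveFamilies J).IsPullbackFamily V f U := by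
  refine ⟨h.1, fun S s j k hj hk => sieveFamilies_factorsThrough.2 ?_⟩
  obtain ⟨R, q, i, g, hq, hi, hg⟩ := factorsThrough_iff_exists_idx.2 ⟨j, hj, rfl⟩
  refine factorsThrough_of_cover hq ?_
  have hkq := isComp_restrict hk q
  obtain ⟨c, hc⟩ := exists_isComp (C := C) (g := q ≫ s ≫ f) (f := i ≫ J.m) (by
    rw [hkq.1, isComp_cod hg])
  have := h.2 R (q ≫ s) i c (hi.trans (Category.assoc _ _ _).symm) (by rwa [Category.assoc])
  rw [Category.assoc] at this
  exact factorsThrough_comp this ((isComp_assoc hc hg).2 hkq)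

lemma sieveFamilies_conditionC (h : J.ConditionC) : (sieveFamilies J).ConditionC :=
  fun T f U hf => by
    obtain ⟨T', p, V, hp, hV⟩ := h T f U hf
    exact ⟨T', p, V, hp, sieveFamilies_isPullbackFamily hV⟩

lemma sieveFamilies_strongConditionC (h : J.StrongConditionC) :
    (sieveFamilies J).StrongConditionC := by
  obtain ⟨σ, hσ⟩ := h
  exact ⟨σ, sieveFamilies_isPullbackFamily hσ⟩

end Sieve

section Equivalent

variable {P : InternalPresheaf C}

/-- The value of a partial amalgamation along an arrow factoring through a member `m(i)` of the
covering family is determined by `x₀(i)`. -/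
lemma IsPartialAmalgam.isAct {W L S T₀ : E} {φ : L ⟶ W} {m : L ⟶ C.C₁} {w₀ : T₀ ⟶ W}
    {x₀ : pullback w₀ φ ⟶ P.P} {t : S ⟶ T₀} {a : S ⟶ C.C₁} {y : S ⟶ P.P}
    (h : IsPartialAmalgam m x₀ t a y) (hx₀ : x₀ ≫ P.toObj = pullback.snd _ _ ≫ m ≫ C.dom)
    {i : S ⟶ pullback w₀ φ} {g : S ⟶ C.C₁} (hi : i ≫ pullback.fst _ _ = t)
    (hg : C.IsComp (i ≫ pullback.snd _ _ ≫ m) g a) : P.IsAct (i ≫ x₀) g y := by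
  obtain ⟨u, hu⟩ := exists_isAct (P := P) (x := i ≫ x₀) (a := g) (by
    rw [Category.assoc, hx₀, ← hg.1]; simp)
  have := h.2 S (𝟙 S) i ((a ≫ C.dom) ≫ C.id) g a u (by rw [hi, Category.id_comp])
    (by rw [Category.id_comp]; exact isComp_id rfl) hg hu
  rw [Category.id_comp] at this
  exact isAct_unique this (isAct_id h.1) ▸ hu

variable {J : InternalSite C}

/-- The generated sieve has the same amalgamations as the covering family itself. -/
lemma equivalent_of_factorsThrough_iff {I : E} {φ : I ⟶ J.Cov} {m : I ⟶ C.C₁}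
    (comm : m ≫ C.cod = φ ≫ J.toObj)
    (hI : ∀ (T : E) (U : T ⟶ J.Cov) (a : T ⟶ C.C₁),
      J.FactorsThrough a U ↔ ∃ i : T ⟶ I, i ≫ φ = U ∧ i ≫ m = a)
    (hC : CoveringFamilies.ConditionC ⟨J.Cov, I, J.toObj, φ, m, comm⟩) :
    J.Equivalent ⟨⟨J.Cov, I, J.toObj, φ, m, comm⟩, hC⟩ := by
  intro P
  -- Every member of a covering family belongs to the sieve which it generates.
  have hc : ∀ {T : E} (U : T ⟶ J.Cov), ∃ c : pullback U J.φ ⟶ pullback U φ,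
      c ≫ pullback.fst _ _ = pullback.fst _ _ ∧ c ≫ pullback.snd _ _ ≫ m = pullback.snd _ _ ≫ J.m :=
    fun U => by
      obtain ⟨i, hi, hi'⟩ := (hI _ _ _).1
        (factorsThrough_of_isComp (J := J.toCoveringFamilies) (i := pullback.snd U J.φ)
          pullback.condition.symm (isComp_id rfl))
      exact ⟨pullback.lift (pullback.fst _ _) i hi.symm, by simp, by simpa using hi'⟩
  have hft : ∀ {T : E} (U : T ⟶ J.Cov),
      J.FactorsThrough (pullback.snd U φ ≫ m) (pullback.fst U φ ≫ U) := fun U =>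
    (hI _ _ _).2 ⟨pullback.snd U φ, pullback.condition.symm, rfl⟩
  constructor
  · rintro hP T U x ⟨hx, hxc⟩
    replace hx : x ≫ P.toObj = pullback.snd U φ ≫ m ≫ C.dom := hx
    obtain ⟨c, hc1, hc2⟩ := hc U
    refine (existsUnique_congr fun y => and_congr Iff.rfl ⟨fun h => ?_, fun h => ?_⟩).2
      (hP T U (c ≫ x) ⟨?_, fun S i i' g g' k hi h h' => ?_⟩)
    · have := isAct_restrict h c
      rwa [reassoc_of% hc1, hc2] at this
    · obtain ⟨R, q, i, g, hq, hi, hg⟩ := hft U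
      refine isAct_of_cover hq ?_
      have hw : (q ≫ pullback.fst U φ) ≫ U = i ≫ J.φ := by rw [hi, Category.assoc]
      have he := isAct_restrict h (pullback.lift _ i hw)
      rw [pullback.lift_fst_assoc, pullback.lift_snd_assoc, Category.assoc] at he
      refine (isAct_comp he hg).1 ?_
      obtain ⟨z, hz, hz'⟩ := hxc R (pullback.lift _ i hw ≫ c) q g _ _ (by simp [hc1])
        (by simpa [hc2] using hg) (isComp_id rfl)
      obtain rfl := isAct_unique (isAct_id (by simp [hx])) hz'
      simpa using hz
    · rw [Category.assoc, hx, reassoc_of% hc2]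
    · obtain ⟨z, hz, hz'⟩ := hxc S (i ≫ c) (i' ≫ c) g g' k (by simpa [hc1] using hi)
        (by simpa [hc2] using h) (by simpa [hc2] using h')
      exact ⟨z, by simpa using hz, by simpa using hz'⟩
  · rintro hP T U x ⟨hx, hxc⟩
    have hxc' : ∀ (R : E) (i i' : R ⟶ pullback U J.φ) (g g' k : R ⟶ C.C₁) (z : R ⟶ P.P),
        i ≫ pullback.fst _ _ = i' ≫ pullback.fst _ _ → C.IsComp (i ≫ pullback.snd _ _ ≫ J.m) g k →
        C.IsComp (i' ≫ pullback.snd _ _ ≫ J.m) g' k → P.IsAct (i ≫ x) g z →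
        P.IsAct (i' ≫ x) g' z := fun R i i' g g' k z h1 h2 h3 h4 => by
      obtain ⟨z', h5, h6⟩ := hxc R i i' g g' k h1 h2 h3
      exact isAct_unique h4 h5 ▸ h6
    obtain ⟨x', hx'⟩ := exists_isPartialAmalgam_of_factorsThrough hx hxc' (hft U)
    obtain ⟨c, hc1, hc2⟩ := hc U
    have hcx : c ≫ x' = x := by
      have h1 := hx'.restrict c
      rw [hc1, hc2] at h1
      have h2 := h1.isAct hx (i := 𝟙 _) (by simp) (by rw [Category.id_comp]; exact isComp_id rfl)
      rw [Category.id_comp] at h2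
      exact isAct_unique h2 (isAct_id (by rw [hx, Category.assoc]))
    -- The values of `x'` are determined by those of `x`, locally.
    have key : ∀ {S : E} {t : S ⟶ T} {a : S ⟶ C.C₁} {z z' : S ⟶ P.P},
        J.FactorsThrough a (t ≫ U) → IsPartialAmalgam J.m x t a z →
        IsPartialAmalgam J.m x t a z' → z = z' := by
      rintro S t a z z' ⟨R, q, i, g, hq, hi, hg⟩ h h'
      rw [← cancel_epi q]
      have hw : (q ≫ t) ≫ U = i ≫ J.φ := by rw [hi, Category.assoc]
      exact isAct_unique ((h.restrict q).isAct hx (i := pullback.lift _ i hw) (by simp)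
        (by simpa using hg)) ((h'.restrict q).isAct hx (by simp) (by simpa using hg))
    refine (existsUnique_congr fun y => and_congr Iff.rfl ⟨fun h => ?_, fun h => ?_⟩).2
      (hP T U x' ⟨?_, fun S i i' g g' k hi h h' => ?_⟩)
    · obtain ⟨R, q, i, g, hq, hi, hg⟩ := hft U
      refine isAct_of_cover hq ?_
      have hw : (q ≫ pullback.fst U φ) ≫ U = i ≫ J.φ := by rw [hi, Category.assoc]
      have he := isAct_restrict h (pullback.lift _ i hw)
      rw [pullback.lift_fst_assoc, pullback.lift_snd_assoc, Category.assoc] at he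
      refine (isAct_comp he hg).1 ?_
      exact (hx'.restrict q).isAct hx (by simp) (by simpa using hg)
    · have := isAct_restrict h c
      change P.IsAct (c ≫ pullback.fst U φ ≫ y) (c ≫ pullback.snd U φ ≫ m) (c ≫ x') at this
      rwa [reassoc_of% hc1, hc2, hcx] at this
    · exact hx'.1.trans (Category.assoc _ _ _)
    · have hi1 := hx'.restrict i
      have hi2 := hx'.restrict i'
      obtain ⟨z, hz⟩ := exists_isAct (P := P) (x := i ≫ x') (a := g) (by rw [hi1.1]; exact h.1)
      obtain ⟨z', hz'⟩ := exists_isAct (P := P) (x := i' ≫ x') (a := g') (by rw [hi2.1]; exact h'.1)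
      have a1 := hi1.act h hz
      have a2 := hi2.act h' hz'
      have hi' : i ≫ pullback.fst U φ = i' ≫ pullback.fst U φ := hi
      rw [← hi'] at a2
      obtain rfl := key (factorsThrough_comp (by
        simpa using factorsThrough_restrict (hft U) i) h) a1 a2
      exact ⟨z, hz, hz'⟩

theorem equivalent_sieveFamilies :
    J.Equivalent ⟨sieveFamilies J.toCoveringFamilies, sieveFamilies_conditionC J.conditionC⟩ :=
  equivalent_of_factorsThrough_iff (sieveFamilies J.toCoveringFamilies).comm
    (fun _ _ _ => factorsThrough_iff_exists_idx) (sieveFamilies_conditionC J.conditionC)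

end Equivalent

namespace Trees

lemma isPullbackFamily_leaf {J : CoveringFamilies C} (K : Trees J) {T : E} {f : T ⟶ C.C₁}
    {c : T ⟶ C.C₀} (hf : f ≫ C.cod = c) :
    K.families.IsPullbackFamily ((f ≫ C.dom) ≫ K.leaf) f (c ≫ K.leaf) := by
  refine ⟨?_, fun S s j k hj hk => ?_⟩
  · exact (Category.assoc _ _ _).trans ((congrArg _ K.leaf_ob).trans (Category.comp_id _))
  · have hj' : j ≫ K.root = (s ≫ f ≫ C.dom) ≫ K.leaf := by simpa using hj
    have hk' : C.IsComp (s ≫ f) (j ≫ K.m) k := hk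
    rw [K.eq_triv j _ hj', Category.assoc, K.triv_m] at hk'
    obtain rfl := isComp_unique hk' (isComp_id (Category.assoc _ _ _))
    refine factorsThrough_of_isComp (J := K.families) (i := (s ≫ c) ≫ K.triv) ?_
      (K.triv_isComp _ (by rw [Category.assoc, hf]))
    change _ ≫ K.root = _
    rw [Category.assoc, K.triv_root, Category.assoc]

variable {J : CoveringFamilies C} (K : Trees (sieveFamilies J))

/-- The pullback along `f` of the tree given by `U` and `t` is the tree given by a pullback of `U`
along `f`, viewed as a sieve, and the trees `t(f ∘ h)` for `h` in this sieve.  In contrast to an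
index `i` such that `f ∘ h` factors through `m(i)`, the element `f ∘ h` of the sieve generated by
`U` is a function of `h`. -/
theorem strongConditionC (hJ : J.StrongConditionC) : K.families.StrongConditionC := by
  obtain ⟨σ, hσ⟩ := sieveFamilies_strongConditionC hJ
  obtain ⟨X, ι, hι, hX⟩ := definable_isPullbackFamily (J := K.families)
    (X := pullback C.cod K.ob ⨯ K.W) prod.snd (prod.fst ≫ pullback.fst _ _)
      (prod.fst ≫ pullback.snd _ _)
  have hX1 : ∀ {S : E} (d : S ⟶ pullback C.cod K.ob) (v : S ⟶ K.W),
      K.families.IsPullbackFamily v (d ≫ pullback.fst _ _) (d ≫ pullback.snd _ _) →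
      ∃ x : S ⟶ X, x ≫ ι ≫ prod.fst = d := fun {S} d v h => by
    obtain ⟨x, hx⟩ := (hX S (prod.lift d v)).1 (by simpa using h)
    exact ⟨x, by rw [reassoc_of% hx, prod.lift_fst]⟩
  refine Exists.elim (K.elim (pullback.snd C.cod K.ob) (ι ≫ prod.fst) ?_ ?_) ?_
  · intro T d c hd
    have hf : (d ≫ pullback.fst _ _) ≫ C.cod = c := by
      rw [Category.assoc, pullback.condition, ← Category.assoc, hd, Category.assoc, K.leaf_ob,
        Category.comp_id]
    exact hX1 d _ (hd ▸ K.isPullbackFamily_leaf hf)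
  · intro T d U t hn
    have ht := K.node_typed hn
    have hfU : (d ≫ pullback.fst _ _) ≫ C.cod = U ≫ (sieveFamilies J).toObj := by
      rw [Category.assoc, pullback.condition, ← Category.assoc, K.node_ob hn]
    obtain ⟨e, he⟩ : ∃ e : pullback U (sieveFamilies J).φ ⟶ pullback C.cod K.ob,
        e ≫ pullback.snd _ _ = t :=
      ⟨pullback.lift ((t ≫ K.ob) ≫ C.id) t (by rw [Category.assoc, C.id_cod, Category.comp_id]),
        pullback.lift_snd _ _ _⟩
    refine ⟨e, he, fun S s _ _ => ?_⟩
    let f := s ≫ d ≫ pullback.fst C.cod K.ob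
    have hf : f ≫ C.cod = (s ≫ U) ≫ (sieveFamilies J).toObj := by
      rw [Category.assoc, hfU, ← Category.assoc]
    obtain ⟨V, hV⟩ : ∃ V, (sieveFamilies J).IsPullbackFamily V f (s ≫ U) := by
      have := (definable_isPullbackFamily σ _ _).stable (pullback.lift f (s ≫ U) hf) (t := 𝟙 _)
        (by simpa using hσ)
      simp only [Category.comp_id, pullback.lift_fst, pullback.lift_snd] at this
      exact ⟨_, this⟩
    -- The composite of `f` with the generic element of the pullback sieve.
    obtain ⟨k, hk⟩ := exists_isComp (C := C) (g := pullback.fst V (sieveFamilies J).φ ≫ f)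
      (f := pullback.snd V (sieveFamilies J).φ ≫ (sieveFamilies J).m) (by
        rw [Category.assoc, ← hV.1, pullback.condition_assoc, Category.assoc,
          (sieveFamilies J).comm])
    obtain ⟨i, hi, him⟩ := factorsThrough_iff_exists_idx.1
      (sieveFamilies_factorsThrough.1 (hV.2 _ _ _ _ pullback.condition.symm hk))
    have hi' : (pullback.fst V (sieveFamilies J).φ ≫ s) ≫ U = i ≫ (sieveFamilies J).φ := by
      rw [hi, Category.assoc]
    obtain ⟨v, hv⟩ := K.exists_node V (pullback.lift _ i hi' ≫ t) (by
      rw [Category.assoc, ht, pullback.lift_snd_assoc, reassoc_of% him, isComp_dom hk,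
        Category.assoc])
    refine hX1 (s ≫ d) v ⟨?_, fun R r l k' hl hk' => ?_⟩
    · refine (K.node_ob hv).trans (hV.1.trans ?_)
      simp [f]
    · obtain ⟨h, hh, l', hl', hc⟩ := K.cons_inv hv r l hl
      obtain ⟨l₀, hl₀, hc₀⟩ := K.exists_cons hn (r ≫ s) (pullback.lift r h hh ≫ i)
        (by simp [hi]) l' (by
          rw [hl', ← Category.assoc]
          congr 1
          apply pullback.hom_ext <;> simp)
      refine factorsThrough_of_isComp (J := K.families) (i := l₀) ?_ ?_ (g := (k' ≫ C.dom) ≫ C.id)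
      · refine Eq.trans hl₀ ?_
        simp
      · have h1 := isComp_restrict hk (pullback.lift r h hh)
        rw [pullback.lift_fst_assoc, pullback.lift_snd_assoc, ← him] at h1
        have h2 := K.cons_comp hc₀
        rw [Category.assoc] at h2
        have h3 : C.IsComp (r ≫ f) (l ≫ K.m) k' := by simpa [f] using hk'
        obtain rfl := isComp_unique ((isComp_assoc h1 (K.cons_comp hc)).2 h3) h2
        exact isComp_id rfl
  · intro r hr
    refine ⟨r ≫ ι ≫ prod.snd, ?_⟩
    have := (hX _ (r ≫ ι)).2 ⟨r, rfl⟩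
    simpa [reassoc_of% hr] using this

end Trees

/-! ### Collection sites -/

section Child

variable {E : Type u} [Category.{v} E] [PiPretopos E]

/-- For an element `z` of the polynomial functor of a map `g`, the value of the family `z` at the
element `l` of its fibre is `u`. -/
def IsChild {A B X T : E} {g : B ⟶ A} (z : T ⟶ (polyFunctor g).obj X) (l : T ⟶ B) (u : T ⟶ X) :
    Prop :=
  ∃ h : z ≫ polyLabel g X = l ≫ g, pullback.lift z l h ≫ polyChild g X = u

variable {A B X Y T : E} {g : B ⟶ A}

lemma definable_isChild (z : Y ⟶ (polyFunctor g).obj X) (l : Y ⟶ B) (u : Y ⟶ X) :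
    Definable (fun T (y : T ⟶ Y) => IsChild (y ≫ z) (y ≫ l) (y ≫ u)) :=
  Definable.graph (polyChild g X) z l u

lemma IsChild.restrict {z : T ⟶ (polyFunctor g).obj X} {l : T ⟶ B} {u : T ⟶ X}
    (h : IsChild z l u) {S : E} (s : S ⟶ T) : IsChild (s ≫ z) (s ≫ l) (s ≫ u) := by
  obtain ⟨h, rfl⟩ := h
  have e : s ≫ pullback.lift z l h = pullback.lift (s ≫ z) (s ≫ l) (by simp [h]) := by
    apply pullback.hom_ext <;> simp
  exact ⟨by simp [h], by rw [← e, Category.assoc]⟩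

lemma IsChild.unique {z : T ⟶ (polyFunctor g).obj X} {l : T ⟶ B} {u u' : T ⟶ X}
    (h : IsChild z l u) (h' : IsChild z l u') : u = u' := by
  obtain ⟨_, rfl⟩ := h
  obtain ⟨_, rfl⟩ := h'
  rfl

lemma exists_isChild {z : T ⟶ (polyFunctor g).obj X} {l : T ⟶ B}
    (h : z ≫ polyLabel g X = l ≫ g) : ∃ u, IsChild z l u := ⟨_, h, rfl⟩

lemma IsPoly.isChild {z : T ⟶ (polyFunctor g).obj X} {a : T ⟶ A} {t : pullback a g ⟶ X}
    (h : IsPoly z a t) {S : E} {s : S ⟶ T} {l : S ⟶ B} (hl : s ≫ a = l ≫ g) :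
    IsChild (s ≫ z) l (pullback.lift s l hl ≫ t) := by
  obtain ⟨rfl, rfl⟩ := h
  exact ⟨by rw [Category.assoc, hl], by simp⟩

end Child

namespace Trees

variable {E : Type u} [Category.{v} E] [PiPretopos E] {C : InternalCategory E}
  {J : CoveringFamilies C} (K : Trees J)

/-- By induction, every tree has a pullback along every arrow `f`.  For the tree given by `U` and
`t`, the induction hypothesis provides for each index `j` of a pullback of `U` along `f` a pullback
of a suitable tree `t(i)`.  The collection axiom is used to choose such a tree as a function of the
index. -/
theorem conditionC (hJ : J.ConditionC) (hcoll : IsCollectionSpan J.φ J.m J.toObj) :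
    K.families.ConditionC := by
  have hQ := Definable.all (X := K.W) (Z := C.C₁)
    (Definable.eq (prod.snd ≫ C.cod) (prod.fst ≫ K.ob))
    (Definable.ex (Z := K.W) (definable_isPullbackFamily (J := K.families)
      (X := (K.W ⨯ C.C₁) ⨯ K.W) prod.snd (prod.fst ≫ prod.snd) (prod.fst ≫ prod.fst)))
  have hQ' := hQ.congr (Q := fun T w => ∀ (S : E) (s : S ⟶ T) (f : S ⟶ C.C₁),
      f ≫ C.cod = (s ≫ w) ≫ K.ob → ∃ (S' : E) (q : S' ⟶ S) (v : S' ⟶ K.W), IsRegularEpi q ∧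
        K.families.IsPullbackFamily v (q ≫ f) (q ≫ s ≫ w)) fun T w => by simp
  intro T f w hf
  have := K.induction hQ' ?_ ?_ T w T (𝟙 T) f (by simpa using hf)
  · simpa using this
  · intro T c S s f hf
    rw [Category.assoc, Category.assoc, K.leaf_ob, Category.comp_id] at hf
    refine ⟨S, 𝟙 S, (f ≫ C.dom) ≫ K.leaf, isRegularEpi_id S, ?_⟩
    rw [Category.id_comp, Category.id_comp, ← Category.assoc]
    exact K.isPullbackFamily_leaf hf
  · intro T w U t hn IH S s f hf
    have hfU : f ≫ C.cod = (s ≫ U) ≫ J.toObj := by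
      rw [hf, Category.assoc, K.node_ob hn, Category.assoc]
    obtain ⟨S₁, q, V, hq, hV⟩ := hJ S f (s ≫ U) hfU
    obtain ⟨k, hk⟩ := exists_isComp (C := C) (g := pullback.fst V J.φ ≫ q ≫ f)
      (f := pullback.snd V J.φ ≫ J.m) (by
        rw [Category.assoc, ← hV.1, pullback.condition_assoc, Category.assoc, J.comm])
    obtain ⟨R, r, i, g, hr, hi, hg⟩ := hV.2 _ _ _ _ pullback.condition.symm hk
    have hi' : (r ≫ pullback.fst V J.φ ≫ q ≫ s) ≫ U = i ≫ J.φ := by simp [hi]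
    let x := pullback.lift _ i hi'
    have hxt : (x ≫ t) ≫ K.ob = g ≫ C.cod := by
      rw [Category.assoc, K.node_typed hn, pullback.lift_snd_assoc, ← hg.1, Category.assoc]
    obtain ⟨R', p, v₀, hp, hv₀⟩ := IH R x g hxt.symm
    -- The trees `v₀` exist on a cover of the object of indices of `V`, which `V'` refines.
    obtain ⟨S₂, t₁, V', ρ, hρ, ht₁, hV', hρm, -⟩ :=
      hcoll S₁ V R' (p ≫ r) (isRegularEpi_comp hp hr)
    have hpr : C.IsComp (p ≫ r ≫ pullback.fst V J.φ ≫ q ≫ f)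
        (p ≫ r ≫ pullback.snd V J.φ ≫ J.m) (p ≫ r ≫ k) := by
      simpa using isComp_restrict hk (p ≫ r)
    have hpg := isComp_restrict hg p
    have hv₀1 : v₀ ≫ K.ob = (p ≫ g) ≫ C.dom := hv₀.1
    obtain ⟨v, hv⟩ := K.exists_node V' (ρ ≫ v₀) (by
      rw [Category.assoc, hv₀1, ← isComp_dom hpg, isComp_dom hpr]
      simpa using hρm =≫ C.dom)
    refine ⟨S₂, t₁ ≫ q, v, isRegularEpi_comp ht₁ hq, ?_, fun R₁ r₁ l k' hl hk' => ?_⟩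
    · refine (K.node_ob hv).trans (hV'.trans ?_)
      rw [hV.1]
      simp
    · obtain ⟨j, hj, l', hl', hc⟩ := K.cons_inv hv r₁ l hl
      let y := pullback.lift r₁ j hj ≫ ρ
      have hy1 : y ≫ p ≫ r ≫ pullback.fst V J.φ = r₁ ≫ t₁ := by
        simpa [y] using (pullback.lift r₁ j hj ≫= hρ).symm
      have hy2 : y ≫ p ≫ r ≫ pullback.snd V J.φ ≫ J.m = j ≫ J.m := by
        simpa [y] using pullback.lift r₁ j hj ≫= hρm
      have h1 := isComp_restrict hpr y
      rw [hy2, reassoc_of% hy1] at h1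
      have hk₁ : C.IsComp (r₁ ≫ t₁ ≫ q ≫ f) (l ≫ K.m) k' := by simpa using hk'
      have h2 := isComp_restrict hpg y
      have h3 := (isComp_assoc h1 (K.cons_comp hc)).2 hk₁
      obtain ⟨k'', hk''⟩ := exists_isComp (C := C) (g := y ≫ p ≫ g) (f := l' ≫ K.m) (by
        rw [← isComp_dom h2, h3.1])
      obtain ⟨R₂, q₂, l₂, h, hq₂, hl₂, hh⟩ := hv₀.2 R₁ y l' k''
        (hl'.trans (Category.assoc _ _ _).symm) hk''
      obtain ⟨l₃, hl₃, hc₃⟩ := K.exists_cons hn (q₂ ≫ y ≫ p ≫ r ≫ pullback.fst V J.φ ≫ q ≫ s)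
        (q₂ ≫ y ≫ p ≫ i) (by simp [hi]) l₂ (by
          refine Eq.trans hl₂ ?_
          simp only [← Category.assoc]
          congr 1
          apply pullback.hom_ext <;> simp [x])
      refine ⟨R₂, q₂, l₃, h, hq₂, ?_, ?_⟩
      · refine hl₃.trans ?_
        rw [reassoc_of% hy1]
        simp
      · have h4 := K.cons_comp hc₃
        have h5 := isComp_restrict ((isComp_assoc h2 hk'').1 h3) q₂
        simp only [Category.assoc] at h4 h5
        exact (isComp_assoc h4 hh).2 h5

section Collection

variable {T₀ F : E} {G : E} (e : F ⟶ G)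

/-- The element `z` consists of a tree together with a map from its leaves to `G`, and `z'` of a
tree together with a map from its leaves to `F` and to the leaves of the first tree.  The latter map
is onto and commutes with the maps to `C₁`, and the evident square over `G` commutes. -/
structure IsRefinement {T : E} (z : T ⟶ (polyFunctor K.root).obj G)
    (z' : T ⟶ (polyFunctor K.root).obj (F ⨯ K.L)) : Prop where
  ob : z' ≫ polyLabel K.root _ ≫ K.ob = z ≫ polyLabel K.root _ ≫ K.ob
  child : ∀ (S : E) (s : S ⟶ T) (l l₁ : S ⟶ K.L) (y : S ⟶ F),
    IsChild (s ≫ z') l (prod.lift y l₁) →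
      IsChild (s ≫ z) l₁ (y ≫ e) ∧ l₁ ≫ K.m = l ≫ K.m
  onto : ∀ (S : E) (s : S ⟶ T) (l₁ : S ⟶ K.L), s ≫ z ≫ polyLabel K.root _ = l₁ ≫ K.root →
    ∃ (S' : E) (q : S' ⟶ S) (l : S' ⟶ K.L) (y : S' ⟶ F), IsRegularEpi q ∧
      IsChild (q ≫ s ≫ z') l (prod.lift y (q ≫ l₁))

lemma definable_isRefinement {X : E} (z : X ⟶ (polyFunctor K.root).obj G)
    (z' : X ⟶ (polyFunctor K.root).obj (F ⨯ K.L)) :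
    Definable (fun T (x : T ⟶ X) => K.IsRefinement e (x ≫ z) (x ≫ z')) := by
  let l : X ⨯ ((K.L ⨯ K.L) ⨯ F) ⟶ _ := prod.snd ≫ prod.fst ≫ prod.fst
  let l₁ : X ⨯ ((K.L ⨯ K.L) ⨯ F) ⟶ _ := prod.snd ≫ prod.fst ≫ prod.snd
  let y : X ⨯ ((K.L ⨯ K.L) ⨯ F) ⟶ _ := prod.snd ≫ prod.snd
  have h1 := Definable.eq (z' ≫ polyLabel K.root _ ≫ K.ob) (z ≫ polyLabel K.root _ ≫ K.ob)
  have h2 := (definable_isChild (prod.fst ≫ z') l (prod.lift y l₁)).all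
    ((definable_isChild (prod.fst ≫ z) l₁ (y ≫ e)).and (Definable.eq (l₁ ≫ K.m) (l ≫ K.m)))
  have h3 := (Definable.eq (X := X ⨯ K.L) (prod.fst ≫ z ≫ polyLabel K.root _)
    (prod.snd ≫ K.root)).all
      ((definable_isChild (Y := (X ⨯ K.L) ⨯ (K.L ⨯ F)) (prod.fst ≫ prod.fst ≫ z')
        (prod.snd ≫ prod.fst) (prod.lift (prod.snd ≫ prod.snd) (prod.fst ≫ prod.snd))).ex)
  refine (h1.and (h2.and h3)).congr fun T x => ⟨?_, fun H => ⟨?_, ?_, ?_⟩⟩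
  · rintro ⟨H1, H2, H3⟩
    refine ⟨by simpa using H1, fun S s l' l₁' y' h => ?_, fun S s l₁' h => ?_⟩
    · simpa [y, l, l₁] using H2 S s (prod.lift (prod.lift l' l₁') y') (by simpa [y, l, l₁] using h)
    · obtain ⟨S', q, u, hq, hu⟩ := H3 S s l₁' (by simpa using h)
      exact ⟨S', q, u ≫ prod.fst, u ≫ prod.snd, hq, by simpa using hu⟩
  · simpa using H.ob
  · intro S s u hu
    have := H.child S s (u ≫ prod.fst ≫ prod.fst) (u ≫ prod.fst ≫ prod.snd) (u ≫ prod.snd)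
      (by simpa [y, l, l₁] using hu)
    simpa [y, l, l₁] using this
  · intro S s l₁' h
    obtain ⟨S', q, l', y', hq, hu⟩ := H.onto S s l₁' (by simpa using h)
    exact ⟨S', q, prod.lift l' y', hq, by simpa using hu⟩

variable {K e} in
/-- For `IsRefinement.child` it suffices to consider the generic leaf of the second tree. -/
lemma isRefinement_of_isPoly {T : E} {z : T ⟶ (polyFunctor K.root).obj G}
    {z' : T ⟶ (polyFunctor K.root).obj (F ⨯ K.L)} {w : T ⟶ K.W}
    {y : pullback w K.root ⟶ F} {l : pullback w K.root ⟶ K.L} (hz : IsPoly z' w (prod.lift y l))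
    (hob : w ≫ K.ob = z ≫ polyLabel K.root _ ≫ K.ob)
    (hchild : IsChild (pullback.fst w K.root ≫ z) l (y ≫ e))
    (hm : l ≫ K.m = pullback.snd w K.root ≫ K.m)
    (honto : ∀ (S : E) (s : S ⟶ T) (l₁ : S ⟶ K.L), s ≫ z ≫ polyLabel K.root _ = l₁ ≫ K.root →
      ∃ (S' : E) (q : S' ⟶ S) (k : S' ⟶ pullback w K.root), IsRegularEpi q ∧
        k ≫ pullback.fst _ _ = q ≫ s ∧ k ≫ l = q ≫ l₁) : K.IsRefinement e z z' := by
  have hw : z' ≫ polyLabel K.root _ = w := hz.1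
  refine ⟨by rw [reassoc_of% hw, hob], fun S s l' l₁ y' h => ?_, fun S s l₁ h => ?_⟩
  · have hs : s ≫ w = l' ≫ K.root := by rw [← h.1, Category.assoc, hw]
    have h1 := h.unique (hz.isChild hs)
    obtain rfl : y' = pullback.lift s l' hs ≫ y := by simpa using h1 =≫ prod.fst
    obtain rfl : l₁ = pullback.lift s l' hs ≫ l := by simpa using h1 =≫ prod.snd
    exact ⟨by simpa using hchild.restrict (pullback.lift s l' hs), by simp [hm]⟩
  · obtain ⟨S', q, k, hq, hk, hl⟩ := honto S s l₁ h
    have hk' : (q ≫ s) ≫ w = (k ≫ pullback.snd _ _) ≫ K.root := by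
      rw [← hk, Category.assoc, pullback.condition, Category.assoc]
    refine ⟨S', q, k ≫ pullback.snd _ _, k ≫ y, hq, ?_⟩
    have h1 := hz.isChild hk'
    have h2 : pullback.lift _ _ hk' = k := by apply pullback.hom_ext <;> simp [hk]
    rw [h2] at h1
    simpa [hl] using h1

lemma exists_isRefinement_leaf (he : IsRegularEpi e) {T : E}
    (z : T ⟶ (polyFunctor K.root).obj G) (c : T ⟶ C.C₀) (hc : z ≫ polyLabel K.root G = c ≫ K.leaf) :
    ∃ (S : E) (q : S ⟶ T) (z' : S ⟶ (polyFunctor K.root).obj (F ⨯ K.L)), IsRegularEpi q ∧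
      K.IsRefinement e (q ≫ z) z' := by
  obtain ⟨u, hu⟩ := exists_isChild (z := z) (l := c ≫ K.triv) (by simp [hc, K.triv_root])
  let q := pullback.fst u e
  let w := q ≫ c ≫ K.leaf
  have hw : pullback.snd w K.root = (pullback.fst w K.root ≫ q ≫ c) ≫ K.triv :=
    K.eq_triv _ _ (by rw [← pullback.condition]; simp [w])
  obtain ⟨z', hz'⟩ := exists_poly w
    (prod.lift (pullback.fst w K.root ≫ pullback.snd u e) (pullback.snd w K.root))
  refine ⟨_, q, z', isRegularEpi_pullback_fst u he, isRefinement_of_isPoly hz' ?_ ?_ rfl ?_⟩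
  · simp [w, reassoc_of% hc]
  · rw [hw]
    have := hu.restrict (pullback.fst w K.root ≫ q)
    simpa [q, pullback.condition] using this
  · intro S s l₁ h
    exact ⟨S, 𝟙 S, pullback.lift s l₁ (by rw [← h]; simp [w, hc]), isRegularEpi_id S,
      by simp, by simp⟩

/-- Every family of elements of `G`, indexed by the leaves of a tree, has a refinement along a
cover of `G`.  For the tree given by `U` and `t`, the collection axiom is used to choose, as a
function of the index, a refinement of the restriction of the family to the leaves of `t(i)`. -/
lemma exists_isRefinement (hcoll : IsCollectionSpan J.φ J.m J.toObj) (he : IsRegularEpi e) {T : E}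
    (z : T ⟶ (polyFunctor K.root).obj G) :
    ∃ (S : E) (q : S ⟶ T) (z' : S ⟶ (polyFunctor K.root).obj (F ⨯ K.L)), IsRegularEpi q ∧
      K.IsRefinement e (q ≫ z) z' := by
  have hdef := (K.definable_isRefinement e (X := (polyFunctor K.root).obj G ⨯
    (polyFunctor K.root).obj (F ⨯ K.L)) prod.fst prod.snd).ex
  obtain ⟨M, ι, hι, hM⟩ := hdef.congr (Q := fun T (z : T ⟶ (polyFunctor K.root).obj G) =>
    ∃ (S : E) (q : S ⟶ T) (z' : S ⟶ (polyFunctor K.root).obj (F ⨯ K.L)), IsRegularEpi q ∧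
      K.IsRefinement e (q ≫ z) z') fun T z => by simp
  refine Exists.elim (K.elim (polyLabel K.root G) ι ?_ ?_) ?_
  · exact fun T d c hd => (hM T d).1 (K.exists_isRefinement_leaf e he d c hd)
  · intro T d U t hn
    -- The leaf of the whole tree given by an index and a leaf of the subtree at this index.
    obtain ⟨l₀, hl₀, hc₀⟩ := K.exists_cons hn (pullback.fst t K.root ≫ pullback.fst U J.φ)
      (pullback.fst t K.root ≫ pullback.snd U J.φ) (by simp [pullback.condition])
      (pullback.snd t K.root) (by
        rw [← pullback.condition]
        congr 1
        apply pullback.hom_ext <;> simp)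
    obtain ⟨u₀, hu₀⟩ := exists_isChild
      (z := (pullback.fst t K.root ≫ pullback.fst U J.φ) ≫ d) (l := l₀) (by
        rw [hl₀, Category.assoc])
    -- The restriction of the given family to the leaves of the subtrees.
    obtain ⟨e', he'⟩ := exists_poly t u₀
    have het : e' ≫ polyLabel K.root G = t := he'.1
    refine ⟨e', het, fun S s y hy => (hM S _).1 ?_⟩
    obtain ⟨R, q, z', hq, H⟩ := (hM _ _).2 ⟨y, hy⟩
    -- The refinements `z'` exist on a cover of the object of indices of `U`, which `U'` refines.
    obtain ⟨S₁, t₁, U', ρ, hρ, ht₁, hU', hρm, hsurj⟩ := hcoll S (s ≫ U) R q hq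
    have hH : z' ≫ polyLabel K.root _ ≫ K.ob = q ≫ pbMap J.φ s rfl ≫ t ≫ K.ob := by
      rw [H.ob, ← het]; simp
    obtain ⟨w, hw⟩ := K.exists_node U' (ρ ≫ z' ≫ polyLabel K.root _) (by
      rw [Category.assoc, Category.assoc, hH, K.node_typed hn, pbMap_snd_assoc]
      simpa using hρm =≫ C.dom)
    obtain ⟨i, hi, l, hl, hc⟩ := K.cons_inv hw (pullback.fst w K.root) (pullback.snd w K.root)
      pullback.condition.symm
    let j := pullback.lift _ i hi ≫ ρ
    obtain ⟨u, hu⟩ := exists_isChild (z := j ≫ z') (l := l) (by simp [j, hl])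
    have hu' : u = prod.lift (u ≫ prod.fst) (u ≫ prod.snd) := by
      apply Limits.prod.hom_ext <;> simp
    obtain ⟨h1, h2⟩ := H.child _ _ _ (u ≫ prod.snd) (u ≫ prod.fst) (hu' ▸ hu)
    have hjt : (j ≫ q ≫ pbMap J.φ s rfl) ≫ t = (u ≫ prod.snd) ≫ K.root := by
      rw [← h1.1, ← het]; simp
    -- The leaf of the given tree assigned to the generic leaf of the new tree `w`.
    let k := pullback.lift _ _ hjt
    have hjq : j ≫ q ≫ pullback.fst (s ≫ U) J.φ = pullback.fst w K.root ≫ t₁ := by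
      simpa [j] using (pullback.lift _ i hi ≫= hρ).symm
    have hk1 : k ≫ pullback.fst t K.root ≫ pullback.fst U J.φ =
        pullback.fst w K.root ≫ t₁ ≫ s := by
      simp [k, reassoc_of% hjq]
    have hk2 : k ≫ pullback.fst t K.root ≫ pullback.snd U J.φ =
        j ≫ q ≫ pullback.snd (s ≫ U) J.φ := by
      simp [k]
    have hk3 : k ≫ pullback.snd t K.root = u ≫ prod.snd := by simp [k]
    have hkc := K.cons_restrict hc₀ k
    rw [hk2, hk3] at hkc
    have hku : k ≫ u₀ = (u ≫ prod.fst) ≫ e := by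
      have := he'.isChild hjt
      exact this.unique (by simpa using h1)
    obtain ⟨z₁, hz₁⟩ := exists_poly w (prod.lift (u ≫ prod.fst) (k ≫ l₀))
    refine ⟨S₁, t₁, z₁, ht₁, isRefinement_of_isPoly hz₁ ?_ ?_ ?_ ?_⟩
    · rw [K.node_ob hw, hU', Category.assoc, ← K.node_ob hn]
      simp
    · have := hu₀.restrict k
      rw [← Category.assoc k, hk1, hku] at this
      simpa using this
    · have h3 := K.cons_comp hkc
      have h4 : (j ≫ q ≫ pullback.snd (s ≫ U) J.φ) ≫ J.m = i ≫ J.m := by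
        simpa [j] using pullback.lift _ i hi ≫= hρm
      rw [h2, h4] at h3
      exact isComp_unique h3 (K.cons_comp hc)
    · intro S₂ s₂ l₁ hl₁
      obtain ⟨i₁, hi₁, l', hl', hc₁⟩ := K.cons_inv hn (s₂ ≫ t₁ ≫ s) l₁ (by
        rw [← hl₁]; simp)
      have hi₂ : (s₂ ≫ t₁) ≫ s ≫ U = i₁ ≫ J.φ := by rw [← hi₁]; simp
      -- Locally, the index `i₁` comes from an index of `U'`.
      let p := pullback.lift s₂ (pullback.lift _ i₁ hi₂) (pullback.lift_fst _ _ _).symm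
      let g := pullback.lift (pullback.fst U' J.φ) (ρ ≫ q) hρ
      let v := pullback.snd p g
      have hv : pullback.fst p g ≫ p = v ≫ g := pullback.condition
      have hv1 : v ≫ pullback.fst U' J.φ = pullback.fst p g ≫ s₂ := by
        simpa [p, g] using (hv =≫ pullback.fst _ _).symm
      have hv2 : v ≫ ρ ≫ q = pullback.fst p g ≫ pullback.lift _ i₁ hi₂ := by
        simpa [p, g] using (hv =≫ pullback.snd _ _).symm
      obtain ⟨S₃, q₂, l₂, y₂, hq₂, hl₂⟩ := H.onto _ (v ≫ ρ) (pullback.fst p g ≫ l') (by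
        have : (pullback.lift _ i₁ hi₂ ≫ pbMap J.φ s rfl) ≫ t = l' ≫ K.root := by
          rw [hl']; simp
        rw [Category.assoc _ l', ← this, Category.assoc q, Category.assoc (pbMap _ _ _), het,
          Category.assoc v, reassoc_of% hv2]
        simp)
      obtain ⟨l₃, hl₃, hc₃⟩ := K.exists_cons hw (q₂ ≫ v ≫ pullback.fst U' J.φ)
        (q₂ ≫ v ≫ pullback.snd U' J.φ) (by simp [pullback.condition]) l₂ (by
          rw [← hl₂.1]
          simp only [Category.assoc]
          rw [← Category.assoc q₂ v]
          simp only [← Category.assoc]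
          congr 3
          apply pullback.hom_ext <;> simp)
      let κ := pullback.lift _ l₃ hl₃.symm
      have hκ : κ ≫ pullback.fst w K.root = (q₂ ≫ pullback.fst p g) ≫ s₂ := by simp [κ, hv1]
      obtain ⟨e1, e2⟩ := K.cons_unique (K.cons_restrict hc κ)
        (by simpa [κ] using hc₃ : K.IsCons (κ ≫ pullback.snd w K.root) _ _)
      have hκj : κ ≫ j = q₂ ≫ v ≫ ρ := by
        have : κ ≫ pullback.lift _ i hi = q₂ ≫ v := by
          apply pullback.hom_ext
          · simp [κ]
          · simp [e1]
        simp only [j, reassoc_of% this]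
      have hκu : κ ≫ u = prod.lift y₂ (q₂ ≫ pullback.fst p g ≫ l') := by
        have := hu.restrict κ
        rw [e2, reassoc_of% hκj] at this
        exact this.unique (by simpa using hl₂)
      refine ⟨S₃, q₂ ≫ pullback.fst p g, κ, isRegularEpi_comp hq₂
        (isRegularEpi_pullback_fst p hsurj), hκ, ?_⟩
      have h5 := K.cons_restrict hkc κ
      rw [reassoc_of% hκu, prod.lift_snd, reassoc_of% hκj, reassoc_of% hv2, pullback.lift_snd] at h5
      have h6 := K.cons_restrict hc₁ (q₂ ≫ pullback.fst p g)
      simp only [Category.assoc] at h6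
      refine (K.cons_ext h5 h6 ?_).trans (Category.assoc _ _ _).symm
      rw [Category.assoc, Category.assoc, hl₀, Category.assoc (pullback.fst t K.root),
        reassoc_of% hk1, reassoc_of% hκ, Category.assoc, Category.assoc, ← hl₁]
      simp
  · intro r hr
    exact (hM T z).2 ⟨z ≫ r, by rw [Category.assoc, hr, Category.comp_id]⟩

end Collection

/-- A cover of the fibre of leaves of a tree is refined by applying `exists_isRefinement` to the
identity of this fibre, as a family indexed by the leaves. -/
theorem isCollectionSpan (hcoll : IsCollectionSpan J.φ J.m J.toObj) :
    IsCollectionSpan K.root K.m K.ob := by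
  intro T c F e he
  obtain ⟨z, hz⟩ := exists_poly c (𝟙 (pullback c K.root))
  obtain ⟨S, t, z', ht, h⟩ := K.exists_isRefinement e hcoll he z
  have hzc := hz.1
  let c' := z' ≫ polyLabel K.root _
  obtain ⟨u, hu⟩ := exists_isChild (z := pullback.fst c' K.root ≫ z') (l := pullback.snd c' K.root)
    (by simpa [c'] using pullback.condition (f := c') (g := K.root))
  let ρ := u ≫ prod.snd
  have hu' : u = prod.lift (u ≫ prod.fst) ρ := by apply Limits.prod.hom_ext <;> simp [ρ]
  obtain ⟨h1, h2⟩ := h.child _ _ _ ρ (u ≫ prod.fst) (hu' ▸ hu)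
  have h3 : (pullback.fst c' K.root ≫ t) ≫ c = ρ ≫ K.root := by
    rw [← h1.1]
    simp [hzc]
  have h4 : (u ≫ prod.fst) ≫ e = pullback.lift _ ρ h3 := by
    have := hz.isChild h3
    rw [Category.comp_id, Category.assoc] at this
    exact h1.unique this
  refine ⟨S, t, c', u ≫ prod.fst, ?_, ht, ?_, ?_, ?_⟩
  · rw [h4, pullback.lift_fst]
  · simpa [c', reassoc_of% hzc] using h.ob
  · rw [h4, pullback.lift_snd_assoc, h2]
  · obtain ⟨S', q, l, y, hq, hl⟩ := h.onto (pullback t (pullback.fst c K.root))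
      (pullback.fst _ _) (pullback.snd _ _ ≫ pullback.snd _ _) (by
        rw [Category.assoc t, hzc, pullback.condition_assoc, pullback.condition, Category.assoc])
    have hκ : (q ≫ pullback.fst t (pullback.fst c K.root)) ≫ c' = l ≫ K.root := by
      rw [← hl.1]
      simp [c']
    have h5 := hu.restrict (pullback.lift _ l hκ)
    rw [pullback.lift_fst_assoc, pullback.lift_snd, Category.assoc] at h5
    have h6 := h5.unique hl
    have h7 : pullback.lift _ l hκ ≫ ρ = q ≫ pullback.snd _ _ ≫ pullback.snd _ _ := by
      simp [ρ, reassoc_of% h6]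
    refine isRegularEpi_of_comp (f := pullback.lift _ l hκ) ?_
    convert hq using 1
    apply pullback.hom_ext
    · simp
    · apply pullback.hom_ext
      · simp [h4, pullback.condition]
      · simp [h4, h7]

end Trees

end PredicativeSite

end


theorem mainTheorem6 {E : Type u} [Category.{v} E] [PiWPretopos E] (C : InternalCategory E)
    (J : InternalSite C) :
    (J.IsStrong →
      ∃ K : InternalSite C, K.IsStrongGrothendieck ∧ J.Equivalent K) ∧
    (J.IsCollection →
      ∃ K : InternalSite C, K.IsGrothendieck ∧ K.IsCollection ∧ J.Equivalent K) := by
  open PredicativeSite in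
  refine ⟨fun hJ => ?_, fun hJ => ?_⟩
  · obtain ⟨K⟩ := nonempty_trees (sieveFamilies J.toCoveringFamilies)
    have hC := K.strongConditionC hJ
    exact ⟨⟨K.families, conditionC_of_strong hC⟩,
      ⟨⟨K.conditionM, K.conditionL⟩, hC, K.strongConditionL⟩, fun P =>
      (equivalent_sieveFamilies P).trans (Trees.equivalent
        (J := ⟨sieveFamilies J.toCoveringFamilies, sieveFamilies_conditionC J.conditionC⟩) K _ P)⟩
  · obtain ⟨K⟩ := nonempty_trees J.toCoveringFamilies
    exact ⟨⟨K.families, K.conditionC J.conditionC hJ⟩, ⟨K.conditionM, K.conditionL⟩,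
      K.isCollectionSpan hJ, K.equivalent _⟩
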